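/- **Model.** Let $\alpha>2$ (path loss exponent), $\beta>0$ (SINR threshold), $\delta,P_D,P_B,B,\lambda_B>0$, $\lambda_U,b_C\ge 0$, $0\le\theta<1$, and for $i=1,\dots,M$ let $\lambda_{D_i}>0$, $b_{D_i}\ge 0$, $p_{t_i},p_{f_i}\in[0,1]$. A transmitter of power $P$ at $x\in\mathbb R^2$ is received at $y\in\mathbb R^2$ with power $P\,h\,|x-y|^{-\alpha}$, where the fading coefficients $h$ of different transmitter-receiver pairs are independent exponential variables with mean $1$ (Rayleigh fading), independent of everything else. The noise power is $\sigma^2\ge 0$. *D2D links.* The transmitters of the potential D2D links of types $1,\dots,M$ form independent homogeneous Poisson point processes in the plane with densities $\lambda_{D_i}$. Each receiver is displaced from its transmitter by an independent centred planar Gaussian vector with independent coordinates of variance $\delta^2$. Independently of one another, the links of type $i$ are active in the given time slot with probability $p_{t_i}$ and access the given subband with probability $p_{f_i}$; a link transmits if both happen. Put $\tilde\lambda_D=\sum_{i=1}^M p_{t_i}p_{f_i}\lambda_{D_i}$. The SINR of a transmitting link is the received power of its own signal, divided by $\sigma^2$ plus the sum $I$ of the powers received at its receiver from all other transmitting links ($\mathrm{SINR}=\infty$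 if $I+\sigma^2=0$). If $\tilde\lambda_D>0$, the coverage probability $\mathbb P_D^{(O)}(\beta)$ of D2D links is the probability that $\mathrm{SINR}>\beta$ for the typical transmitting link, i.e., for any Borel set $W\subset\mathbb R^2$ with $0<|W|<\infty$, the expected number of transmitting links with receiver in $W$ and $\mathrm{SINR}>\beta$, divided by the expected number of transmitting links with receiver in $W$. *Cellular users.* The base stations form a homogeneous Poisson point process of density $\lambda_B$. A user at a fixed location $u\in\mathbb R^2$ is served by the nearest base station. Each other base station interferes, independently, with probability $$\rho^{(O)}=\min\Big\{\frac{b_C\lambda_U+\sum_{i=1}^M(1-p_{t_i})b_{D_i}\lambda_{D_i}}{\lambda_B(1-\theta)B},\,1\Big\}.$$ All base stations transmit with power $P_B$. The SINR of the user is the power received from the serving base station, divided by $\sigma^2$ plus the sum of the powers received from the interfering base stations (and $\infty$ if this denominator is $0$), and $\mathbb P_C^{(O)}(\beta)=\mathbb P(\mathrm{SINR}>\beta)$. **Claim.** In the interference-limited regime, that is, both in the limit $\sigma^2\downarrow 0$ and for $\sigma^2=0$, $$\mathbb P_D^{(O)}(\beta)=\frac{1}{1+2\delta^2\,\tilde\lambda_D\,\frac{2\pi^2/\alpha}{\sin(2\pi/\alpha)}\,\beta^{2/\alpha}}\quad(\text{if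 }\tilde\lambda_D>0),$$ for every choice of $W$, and, for every user location $u$, $$\mathbb P_C^{(O)}(\beta)=\frac{1}{2\rho^{(O)}H_1(\beta,\alpha)+1},\qquad H_1(\beta,\alpha)=\int_1^\infty\frac{x}{1+\beta^{-1}x^{\alpha}}\,dx.$$ -/

import Mathlib

open MeasureTheory ProbabilityTheory Filter Topology
open scoped ENNReal NNReal

noncomputable section

namespace D2D

/-- The Euclidean plane. -/
abbrev Plane : Type := EuclideanSpace ℝ (Fin 2)

variable {Ω : Type*} [MeasurableSpace Ω]

/-- The number of points of the enumerated random point set `{X 0, X 1, …}` lying in `A`. -/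
def pointCount {E : Type*} (X : ℕ → Ω → E) (A : Set E) (ω : Ω) : ℝ≥0∞ :=
  ∑' n, A.indicator (fun _ => 1) (X n ω)

/-- `X` enumerates (measurably) a Poisson point process with intensity measure `Λ`: the number of
points in a set `A` with `Λ A < ∞` is Poisson with mean `Λ A`, and the numbers of points in
finitely many pairwise disjoint sets are independent. -/
structure IsPoissonProcess {E : Type*} [MeasurableSpace E] (μ : Measure Ω) (X : ℕ → Ω → E)
    (Λ : Measure E) : Prop where
  measurable : ∀ n, Measurable (X n)
  count_law : ∀ A : Set E, MeasurableSet A → Λ A ≠ ∞ →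
    HasLaw (pointCount X A) ((poissonMeasure (Λ A).toNNReal).map (fun k : ℕ => (k : ℝ≥0∞))) μ
  count_indep : ∀ (m : ℕ) (A : Fin m → Set E), (∀ j, MeasurableSet (A j)) →
    Pairwise (Function.onFun Disjoint A) → iIndepFun (fun j => pointCount X (A j)) μ

/-- `X` enumerates a homogeneous Poisson point process in the plane with density `lam`. -/
def IsHomogeneousPPP (μ : Measure Ω) (X : ℕ → Ω → Plane) (lam : ℝ) : Prop :=
  IsPoissonProcess μ X (ENNReal.ofReal lam • (volume : Measure Plane))

/-- The received power `P h |x - y|^(-α)` at `y` of a transmitter at `x` of power `P`,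
with fading coefficient `h` and path loss exponent `α`. -/
def receivedPower (P α h : ℝ) (x y : Plane) : ℝ≥0∞ :=
  ENNReal.ofReal (P * h) * edist x y ^ (-α)

/-! ### D2D links

Links are indexed by `(i, n)`: the `n`-th potential link of type `i`. -/

/-- The two-dimensional Gaussian law on the plane with independent centred coordinates of
variance `δ ^ 2`. -/
def planarGaussian (δ : ℝ) : Measure Plane :=
  (Measure.pi fun _ : Fin 2 => gaussianReal 0 (δ ^ 2).toNNReal).map (WithLp.toLp 2)

/-- The random elements of the D2D network with `M` types of potential links:
`X k` is the position of the transmitter of link `k`, `G k` the displacement from it to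
its receiver, `T k` tells whether the link is active in the given time slot, `F k` whether it
accesses the given subband, and `h k l` is the power fading from the transmitter of link `k`
to the receiver of link `l`.
The transmitters of type `i` form a homogeneous Poisson process of density `lamD i`,
the displacements are Gaussian, the hopping probabilities are `pt i` and `pf i`, the fading
is Rayleigh (the power is exponential with mean one), and everything is independent. -/
structure IsD2DNetwork (μ : Measure Ω) {M : ℕ} (lamD pt pf : Fin M → ℝ) (δ : ℝ)
    (X G : Fin M × ℕ → Ω → Plane) (T F : Fin M × ℕ → Ω → Bool)
    (h : Fin M × ℕ → Fin M × ℕ → Ω → ℝ) : Prop where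
  points_ppp : ∀ i, IsHomogeneousPPP μ (fun n => X (i, n)) (lamD i)
  points_indep : iIndepFun (fun (i : Fin M) (ω : Ω) (n : ℕ) => X (i, n) ω) μ
  displacement_measurable : ∀ k, Measurable (G k)
  displacement_law : ∀ k, HasLaw (G k) (planarGaussian δ) μ
  displacement_indep : iIndepFun G μ
  time_measurable : ∀ k, Measurable (T k)
  time_prob : ∀ k, μ {ω | T k ω = true} = ENNReal.ofReal (pt k.1)
  time_indep : iIndepFun T μ
  freq_measurable : ∀ k, Measurable (F k)
  freq_prob : ∀ k, μ {ω | F k ω = true} = ENNReal.ofReal (pf k.1)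
  freq_indep : iIndepFun F μ
  fading_measurable : ∀ k l, Measurable (h k l)
  fading_law : ∀ k l, HasLaw (h k l) (expMeasure 1) μ
  fading_indep : iIndepFun (fun q : (Fin M × ℕ) × (Fin M × ℕ) => h q.1 q.2) μ
  -- mutual independence of the five families
  indep_points_displacement : IndepFun (fun ω k => X k ω) (fun ω k => G k ω) μ
  indep_time : IndepFun (fun ω => ((fun k => X k ω), (fun k => G k ω))) (fun ω k => T k ω) μ
  indep_freq : IndepFun (fun ω => ((fun k => X k ω), (fun k => G k ω), (fun k => T k ω)))
    (fun ω k => F k ω) μ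
  indep_fading : IndepFun
    (fun ω => ((fun k => X k ω), (fun k => G k ω), (fun k => T k ω), (fun k => F k ω)))
    (fun ω k l => h k l ω) μ

section D2DLinks

variable {M : ℕ} (X G : Fin M × ℕ → Ω → Plane) (T F : Fin M × ℕ → Ω → Bool)
  (h : Fin M × ℕ → Fin M × ℕ → Ω → ℝ)

/-- The position of the receiver of link `k`. -/
def receiver (k : Fin M × ℕ) (ω : Ω) : Plane := X k ω + G k ω

/-- Link `k` transmits in the given time slot and subband. -/
def transmits (k : Fin M × ℕ) (ω : Ω) : Prop := T k ω = true ∧ F k ω = true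

open Classical in
/-- The interference at the receiver of link `l` from all other links that transmit in the
given time slot and subband. -/
def d2dInterference (PD α : ℝ) (l : Fin M × ℕ) (ω : Ω) : ℝ≥0∞ :=
  ∑' k, if k ≠ l ∧ transmits T F k ω then
    receivedPower PD α (h k l ω) (X k ω) (receiver X G l ω) else 0

/-- The SINR at the receiver of link `l`, with noise power `s`; it is `∞` if the received
power of the signal is positive and there is neither interference nor noise. -/
def d2dSINR (PD α s : ℝ) (l : Fin M × ℕ) (ω : Ω) : ℝ≥0∞ :=
  receivedPower PD α (h l l ω) (X l ω) (receiver X G l ω) /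
    (d2dInterference X G T F h PD α l ω + ENNReal.ofReal s)

/-- The coverage probability `ℙ(SINR > β)` of the typical D2D link with active transmitter, that
is, its probability under the Palm distribution of the receivers: the expected number of
transmitting links with receiver in the window `W` and with `SINR > β`, divided by the expected
number of transmitting links with receiver in `W`. -/
def d2dCoverage (μ : Measure Ω) (PD α s β : ℝ) (W : Set Plane) : ℝ :=
  ((∫⁻ ω, ∑' l, {ω' | transmits T F l ω' ∧ receiver X G l ω' ∈ W ∧
        ENNReal.ofReal β < d2dSINR X G T F h PD α s l ω'}.indicator (fun _ => (1 : ℝ≥0∞)) ω ∂μ) /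
    (∫⁻ ω, ∑' l, {ω' | transmits T F l ω' ∧ receiver X G l ω' ∈ W}.indicator
        (fun _ => (1 : ℝ≥0∞)) ω ∂μ)).toReal

end D2DLinks

/-- The density of the transmitting D2D links in a given time slot and subband. -/
def transmitDensity {M : ℕ} (lamD pt pf : Fin M → ℝ) : ℝ := ∑ i, pt i * pf i * lamD i

/-! ### Cellular downlink -/

/-- The fraction of normal resource blocks in the dedicated network. -/
def normalRBFraction {M : ℕ} (lamD pt bD : Fin M → ℝ) (lamB lamU bC B θ : ℝ) : ℝ :=
  min ((bC * lamU + ∑ i, (1 - pt i) * bD i * lamD i) / (lamB * (1 - θ) * B)) 1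

/-- The random elements of the cellular downlink, as seen by one user: `Z n` is the position of
the `n`-th base station, `a n` tells whether it is an active interferer in the given resource
block (unless it is the serving one), and `g n` is the power fading from it to the user.
The base stations form a homogeneous Poisson process of density `lamB`, which is thinned
independently with retention probability `ρ`, the fading is Rayleigh (the power is exponential
with mean one), and everything is independent. -/
structure IsCellularNetwork (μ : Measure Ω) (lamB ρ : ℝ)
    (Z : ℕ → Ω → Plane) (a : ℕ → Ω → Bool) (g : ℕ → Ω → ℝ) : Prop where
  points_ppp : IsHomogeneousPPP μ Z lamB
  normal_measurable : ∀ n, Measurable (a n)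
  normal_prob : ∀ n, μ {ω | a n ω = true} = ENNReal.ofReal ρ
  normal_indep : iIndepFun a μ
  fading_measurable : ∀ n, Measurable (g n)
  fading_law : ∀ n, HasLaw (g n) (expMeasure 1) μ
  fading_indep : iIndepFun g μ
  -- mutual independence of the three families
  indep_points_normal : IndepFun (fun ω n => Z n ω) (fun ω n => a n ω) μ
  indep_fading : IndepFun (fun ω => ((fun n => Z n ω), (fun n => a n ω))) (fun ω n => g n ω) μ

section CellularLinks

variable (Z : ℕ → Ω → Plane) (a : ℕ → Ω → Bool) (g : ℕ → Ω → ℝ)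

/-- The index of the base station nearest to `u` (almost surely there is exactly one). -/
def servingBS (u : Plane) (ω : Ω) : ℕ :=
  sInf {n | ∀ m, dist (Z n ω) u ≤ dist (Z m ω) u}

/-- The interference at a user at `u` from the other base stations that transmit. -/
def cellularInterference (PB α : ℝ) (u : Plane) (ω : Ω) : ℝ≥0∞ :=
  ∑' n, if n ≠ servingBS Z u ω ∧ a n ω = true then
    receivedPower PB α (g n ω) (Z n ω) u else 0

/-- The SINR of a user at `u` that is served by the nearest base station, with noise power `s`. -/
def cellularSINR (PB α s : ℝ) (u : Plane) (ω : Ω) : ℝ≥0∞ :=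
  receivedPower PB α (g (servingBS Z u ω) ω) (Z (servingBS Z u ω) ω) u /
    (cellularInterference Z a g PB α u ω + ENNReal.ofReal s)

/-- The coverage probability `ℙ(SINR > β)` of a cellular user at `u`. -/
def cellularCoverage (μ : Measure Ω) (PB α s β : ℝ) (u : Plane) : ℝ :=
  (μ {ω | ENNReal.ofReal β < cellularSINR Z a g PB α s u ω}).toReal

end CellularLinks

/-- `H₁(β, α) = ∫_1^∞ x / (1 + β⁻¹ x^α) dx`. -/
def H₁ (β α : ℝ) : ℝ := ∫ x in Set.Ioi (1 : ℝ), x / (1 + β⁻¹ * x ^ α)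

end D2D

end

/-! Both formulas come from one computation. Under Rayleigh fading, SINR > β says that one mean-one
exponential variable exceeds a nonnegative combination of independent others plus a noise constant.
Given geometry and activity this has probability exp(-noise term) times the product over the
interferers of (1 + β y_k / D)⁻¹, where D and y_k are the path gains of signal and interferers
(`measure_lt_sinr`). Averaging over independent activity turns each factor a into q a + (1 - q).
What remains is the mean of a sum over Poisson points x of a product, over the other points y, of
factors v x y. The reduced Campbell–Mecke formula evaluates it as ∫ exp(-∫ (1 - v x y) dΛ(y)) dΛ(x).

That formula is derived from the counting definition of a Poisson process. Poisson counts that are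
independent on disjoint sets give the generating functional E ∏ v(Y_k) = exp(-∫ (1 - v) dΛ)
(`IsPoissonProcess.hasPoissonPGFL`). Its derivative at t = 0 along w exp(-t 1_B) inserts the number
of points in B, and dividing by w at the counted point removes that point's own factor. Factors
depending on the counted point are reached by discretizing its position
(`HasPoissonPGFL.tsum_lintegral_infProd`). All of this takes place in [0, ∞], where sums and
decreasing products always converge.

D2D links: for a fixed displacement g the interference integral is λ̃ K |g|² with K = β^(2/α)
(2π²/α) / sin(2π/α), wherever the link lies. Hence λ̃ |W| factors out and cancels in the Palm ratio.
Without noise there remains E exp(-λ̃ K |g|²) = 1 / (1 + 2δ² λ̃ K) for the planar Gaussian.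

Cellular users: coverage is split according to which station is nearest. Being nearest is itself
multiplicative: a closer station contributes the factor 0. At serving distance r the exponent is λ_B
π (1 + 2ρH₁) r², and integrating λ_B exp(-exponent) over the plane gives 1 / (1 + 2ρH₁).

The limit of vanishing noise is dominated convergence for D2D links, and continuity of the measure
along increasing events for cellular users. -/

noncomputable section

namespace D2D

/-! ### The function `x ↦ exp (-x)` on the extended nonnegative reals -/

/-- The decreasing function `x ↦ exp (-x)` from `[0, ∞]` to `[0, 1]`. -/
def expNeg (x : ℝ≥0∞) : ℝ≥0∞ := EReal.exp (-(x : EReal))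

lemma expNeg_add (x y : ℝ≥0∞) : expNeg (x + y) = expNeg x * expNeg y := by
  unfold expNeg
  rw [EReal.coe_ennreal_add, EReal.neg_add, sub_eq_add_neg, EReal.exp_add]
  · left; simp
  · right; simp

@[simp] lemma expNeg_zero : expNeg 0 = 1 := by simp [expNeg]

@[simp] lemma expNeg_top : expNeg ∞ = 0 := by simp [expNeg]

lemma expNeg_le_one (x : ℝ≥0∞) : expNeg x ≤ 1 := by
  simp [expNeg, EReal.coe_ennreal_nonneg]

lemma expNeg_anti : Antitone expNeg := fun x y h => by
  simpa [expNeg] using h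

lemma continuous_expNeg : Continuous expNeg := by
  unfold expNeg
  exact ENNReal.continuous_exp.comp (continuous_neg.comp continuous_coe_ennreal_ereal)

@[fun_prop] lemma measurable_expNeg : Measurable expNeg := continuous_expNeg.measurable

lemma expNeg_ofReal {x : ℝ} (hx : 0 ≤ x) :
    expNeg (ENNReal.ofReal x) = ENNReal.ofReal (Real.exp (-x)) := by
  unfold expNeg
  rw [EReal.coe_ennreal_ofReal, max_eq_left hx, ← EReal.coe_neg, EReal.exp_coe]

lemma expNeg_ne_top (x : ℝ≥0∞) : expNeg x ≠ ∞ :=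
  ((expNeg_le_one x).trans_lt ENNReal.one_lt_top).ne

lemma expNeg_sum {ι : Type*} (s : Finset ι) (w : ι → ℝ≥0∞) :
    expNeg (∑ k ∈ s, w k) = ∏ k ∈ s, expNeg (w k) := by
  classical
  induction s using Finset.induction_on with
  | empty => simp
  | insert a s ha ih => rw [Finset.sum_insert ha, Finset.prod_insert ha, expNeg_add, ih]

/-- Taking w = -log v, with w = ∞ where v = 0, makes products of numbers in [0, 1] into sums in [0,
∞], which converge unconditionally. -/
lemma exists_expNeg_eq {v : ℝ≥0∞} (hv : v ≤ 1) :
    expNeg (-(ENNReal.log v)).toENNReal = v := by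
  unfold expNeg
  rw [EReal.coe_toENNReal, neg_neg, ENNReal.exp_log]
  rw [EReal.le_neg]
  simpa using hv

/-! ### Infinite products of numbers in `[0, 1]` -/

section InfProd

variable {ι : Type*}

/-- The infinite product of a family of numbers in `[0, 1]`. -/
def infProd (v : ι → ℝ≥0∞) : ℝ≥0∞ := ⨅ s : Finset ι, ∏ k ∈ s, v k

lemma infProd_le_one (v : ι → ℝ≥0∞) : infProd v ≤ 1 := by
  exact (iInf_le (fun s : Finset ι => ∏ k ∈ s, v k) ∅).trans (by simp)

lemma infProd_mono {v w : ι → ℝ≥0∞} (h : ∀ k, v k ≤ w k) : infProd v ≤ infProd w :=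
  iInf_mono fun _ => Finset.prod_le_prod' fun k _ => h k

lemma tendsto_infProd {v : ι → ℝ≥0∞} (hv : ∀ k, v k ≤ 1) :
    Tendsto (fun s : Finset ι => ∏ k ∈ s, v k) atTop (𝓝 (infProd v)) :=
  tendsto_atTop_iInf (Finset.prod_anti_set_of_le_one' hv)

lemma infProd_expNeg (w : ι → ℝ≥0∞) :
    infProd (fun k => expNeg (w k)) = expNeg (∑' k, w k) := by
  refine tendsto_nhds_unique (tendsto_infProd fun k => expNeg_le_one _) ?_
  simp_rw [← expNeg_sum]
  exact (continuous_expNeg.tendsto _).comp ENNReal.summable.hasSum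

lemma measurable_infProd [Countable ι] {α : Type*} [MeasurableSpace α] {v : ι → α → ℝ≥0∞}
    (hv : ∀ k, Measurable (v k)) : Measurable fun a => infProd fun k => v k a :=
  Measurable.iInf fun s => Finset.measurable_fun_prod s fun k _ => hv k

/-- Every finite product over a set containing `l` splits this way, and such sets are cofinal. This
isolates the typical point, and shows that one vanishing factor kills the product. -/
lemma infProd_eq_mul [DecidableEq ι] {v : ι → ℝ≥0∞} (hv : ∀ k, v k ≤ 1) (l : ι) :
    infProd v = v l * infProd (fun k => if k = l then 1 else v k) := by
  have h1 : ∀ k, (if k = l then 1 else v k) ≤ 1 := fun k => by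
    split_ifs
    exacts [le_rfl, hv k]
  refine tendsto_nhds_unique (tendsto_infProd hv) ?_
  have h2 := ENNReal.Tendsto.const_mul (a := v l) (tendsto_infProd h1)
    (Or.inr ((hv l).trans_lt ENNReal.one_lt_top).ne)
  refine h2.congr' ?_
  filter_upwards [eventually_ge_atTop ({l} : Finset ι)] with s hs
  have hl : l ∈ s := hs (Finset.mem_singleton_self l)
  rw [← Finset.mul_prod_erase s v hl, ← Finset.mul_prod_erase s _ hl]
  simp only [if_true, one_mul]
  congr 1
  refine Finset.prod_congr rfl fun k hk => ?_
  rw [if_neg (Finset.ne_of_mem_erase hk)]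

lemma infProd_mul {v w : ι → ℝ≥0∞} (hv : ∀ k, v k ≤ 1) (hw : ∀ k, w k ≤ 1) :
    infProd (fun k => v k * w k) = infProd v * infProd w := by
  refine tendsto_nhds_unique (tendsto_infProd fun k => mul_le_one' (hv k) (hw k)) ?_
  simp_rw [Finset.prod_mul_distrib]
  exact ENNReal.Tendsto.mul (tendsto_infProd hv)
    (Or.inr ((infProd_le_one w).trans_lt ENNReal.one_lt_top).ne) (tendsto_infProd hw)
    (Or.inr ((infProd_le_one v).trans_lt ENNReal.one_lt_top).ne)

/-- Infinite products converge along a sequence of factors that converges from above. -/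
lemma tendsto_infProd_of_le {v : ι → ℝ≥0∞} {w : ℕ → ι → ℝ≥0∞} (hw : ∀ n k, w n k ≤ 1)
    (hvw : ∀ n k, v k ≤ w n k) (h : ∀ k, Tendsto (fun n => w n k) atTop (𝓝 (v k))) :
    Tendsto (fun n => infProd (w n)) atTop (𝓝 (infProd v)) := by
  -- Only the upper bound needs work: each infinite product is at most each of its finite
  -- subproducts, and those converge.
  refine tendsto_of_le_liminf_of_limsup_le ?_ ?_
  · exact le_liminf_of_le (by isBoundedDefault) (Eventually.of_forall fun n => infProd_mono (hvw n))
  · refine le_iInf fun s => ?_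
    have hs : Tendsto (fun n => ∏ k ∈ s, w n k) atTop (𝓝 (∏ k ∈ s, v k)) := by
      classical
      induction s using Finset.induction_on with
      | empty => simp
      | insert a s ha ih =>
        simp_rw [Finset.prod_insert ha]
        refine ENNReal.Tendsto.mul (h a) (Or.inr ?_) ih (Or.inr ?_)
        · exact ((Finset.prod_le_one' fun k _ => (hvw 0 k).trans (hw 0 k)).trans_lt
            ENNReal.one_lt_top).ne
        · exact (((hvw 0 a).trans (hw 0 a)).trans_lt ENNReal.one_lt_top).ne
    rw [← hs.limsup_eq]
    exact limsup_le_limsup (Eventually.of_forall fun n => iInf_le _ s)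

/-- The expectation of an infinite product of independent factors in `[0, 1]`. -/
lemma lintegral_infProd [Countable ι] {Ω : Type*} [MeasurableSpace Ω] {μ : Measure Ω}
    {V : ι → Ω → ℝ≥0∞} (hV : iIndepFun V μ) (hm : ∀ k, Measurable (V k))
    (h1 : ∀ k ω, V k ω ≤ 1) :
    ∫⁻ ω, infProd (fun k => V k ω) ∂μ = infProd fun k => ∫⁻ ω, V k ω ∂μ := by
  have := hV.isProbabilityMeasure
  have h1' : ∀ k, ∫⁻ ω, V k ω ∂μ ≤ 1 := fun k =>
    (lintegral_mono (h1 k)).trans (by simp)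
  refine tendsto_nhds_unique ?_ (tendsto_infProd h1')
  simp_rw [← lintegral_prod_eq_prod_lintegral_of_indepFun _ V hV hm]
  refine tendsto_lintegral_filter_of_dominated_convergence (fun _ => 1) ?_ ?_ (by simp) ?_
  · exact Eventually.of_forall fun s => Finset.measurable_fun_prod s fun k _ => hm k
  · exact Eventually.of_forall fun s => Eventually.of_forall fun ω =>
      Finset.prod_le_one' fun k _ => h1 k ω
  · exact Eventually.of_forall fun ω => tendsto_infProd fun k => h1 k ω

end InfProd

/-- Averaging over an independent family of Boolean variables. -/
lemma lintegral_infProd_bool {ι : Type*} [Countable ι] {Ω : Type*} [MeasurableSpace Ω]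
    {μ : Measure Ω} {b : ι → Ω → Bool} (hb : iIndepFun b μ) (hm : ∀ k, Measurable (b k))
    {p : ι → ℝ≥0∞} (hp : ∀ k, μ {ω | b k ω = true} = p k)
    {t e : ι → ℝ≥0∞} (ht : ∀ k, t k ≤ 1) (he : ∀ k, e k ≤ 1) :
    ∫⁻ ω, infProd (fun k => if b k ω = true then t k else e k) ∂μ
      = infProd fun k => p k * t k + (1 - p k) * e k := by
  have := hb.isProbabilityMeasure
  have hf : ∀ k, Measurable fun x : Bool => if x = true then t k else e k :=
    fun k => measurable_from_top
  rw [lintegral_infProd (V := fun k ω => if b k ω = true then t k else e k)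
    (hb.comp (fun k (x : Bool) => if x = true then t k else e k) hf)
    (fun k => (hf k).comp (hm k))]
  · congr 1
    ext k
    have hms : MeasurableSet {ω | b k ω = true} := hm k (measurableSet_singleton true)
    have : ∀ ω, (if b k ω = true then t k else e k)
        = {ω | b k ω = true}.indicator (fun _ => t k) ω
          + {ω | b k ω = true}ᶜ.indicator (fun _ => e k) ω := by
      intro ω
      by_cases h : b k ω = true <;> simp [h]
    simp_rw [this]
    rw [lintegral_add_left (measurable_const.indicator hms), lintegral_indicator_const hms,
      lintegral_indicator_const hms.compl, hp k, prob_compl_eq_one_sub hms, hp k]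
    ring
  · intro k ω
    split_ifs
    exacts [ht k, he k]

/-- Integration of a function of two independent random elements. -/
lemma lintegral_indepFun {Ω 𝓤 𝓥 : Type*} [MeasurableSpace Ω] [MeasurableSpace 𝓤]
    [MeasurableSpace 𝓥] {μ : Measure Ω} [IsProbabilityMeasure μ] {U : Ω → 𝓤} {V : Ω → 𝓥}
    (hU : Measurable U) (hV : Measurable V) (h : IndepFun U V μ) {φ : 𝓤 × 𝓥 → ℝ≥0∞}
    (hφ : Measurable φ) :
    ∫⁻ ω, φ (U ω, V ω) ∂μ = ∫⁻ ω, ∫⁻ ω', φ (U ω, V ω') ∂μ ∂μ := by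
  have h1 := (indepFun_iff_map_prod_eq_prod_map_map hU.aemeasurable hV.aemeasurable).1 h
  have := Measure.isProbabilityMeasure_map (μ := μ) hU.aemeasurable
  have := Measure.isProbabilityMeasure_map (μ := μ) hV.aemeasurable
  rw [← lintegral_map hφ (hU.prodMk hV), h1, lintegral_prod _ hφ.aemeasurable,
    lintegral_map hφ.lintegral_prod_right' hU]
  refine lintegral_congr fun ω => ?_
  exact lintegral_map (hφ.comp measurable_prodMk_left) hV

/-! ### The probability generating functional of a Poisson process -/

section PGFL

variable {Ω E ι : Type*} [MeasurableSpace Ω] [MeasurableSpace E]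

/-- The random points `Y k` have the probability generating functional of a Poisson process with
intensity measure `Λ`. -/
def HasPoissonPGFL (μ : Measure Ω) (Y : ι → Ω → E) (Λ : Measure E) : Prop :=
  ∀ v : E → ℝ≥0∞, Measurable v → (∀ x, v x ≤ 1) →
    ∫⁻ ω, infProd (fun k => v (Y k ω)) ∂μ = expNeg (∫⁻ x, (1 - v x) ∂Λ)

lemma expNeg_mul_natCast (c : ℝ≥0∞) (n : ℕ) : expNeg (c * n) = expNeg c ^ n := by
  have := expNeg_sum (Finset.range n) fun _ => c
  simpa [mul_comm] using this

/-- The exponential series: e^(-r) ∑ (rq)^n / n! = e^(-(1 - q) r). -/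
lemma lintegral_pow_poissonMeasure (r : ℝ≥0) {q : ℝ≥0∞} (hq : q ≤ 1) :
    ∫⁻ n, q ^ n ∂(poissonMeasure r) = expNeg ((1 - q) * r) := by
  lift q to ℝ≥0 using (hq.trans_lt ENNReal.one_lt_top).ne
  have hq' : (q : ℝ) ≤ 1 := by exact_mod_cast hq
  have hr : (1 - (q : ℝ≥0∞)) * r = ENNReal.ofReal ((1 - q) * r) := by
    rw [ENNReal.ofReal_mul (by linarith), ENNReal.ofReal_sub _ (by positivity)]
    simp
  rw [hr, expNeg_ofReal (mul_nonneg (by linarith) (by positivity)), lintegral_countable']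
  simp_rw [poissonMeasure_singleton]
  have h1 : HasSum (fun n : ℕ => Real.exp (-r) * ((r * q : ℝ) ^ n / n.factorial))
      (Real.exp (-r) * Real.exp (r * q)) := by
    have := NormedSpace.expSeries_div_hasSum_exp (r * q : ℝ)
    rw [← Real.exp_eq_exp_ℝ] at this
    exact this.mul_left _
  rw [show -((1 - (q : ℝ)) * r) = -r + r * q by ring, Real.exp_add, ← h1.tsum_eq,
    ENNReal.ofReal_tsum_of_nonneg (fun n => by positivity) h1.summable]
  congr 1
  ext n
  rw [← ENNReal.coe_pow, ← ENNReal.ofReal_coe_nnreal, ← ENNReal.ofReal_mul (by positivity)]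
  congr 1
  push_cast
  rw [mul_pow]
  ring

variable {μ : Measure Ω} {X : ℕ → Ω → E} {Λ : Measure E}

lemma measurable_pointCount (hX : ∀ n, Measurable (X n)) {A : Set E} (hA : MeasurableSet A) :
    Measurable (pointCount X A) :=
  Measurable.tsum fun n => (measurable_const.indicator hA).comp (hX n)

lemma IsPoissonProcess.lintegral_expNeg_pointCount (hX : IsPoissonProcess μ X Λ) {A : Set E}
    (hA : MeasurableSet A) (hΛ : Λ A ≠ ∞) (c : ℝ≥0∞) :
    ∫⁻ ω, expNeg (c * pointCount X A ω) ∂μ = expNeg ((1 - expNeg c) * Λ A) := by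
  have hm : Measurable fun y : ℝ≥0∞ => expNeg (c * y) := by fun_prop
  rw [← lintegral_map hm (measurable_pointCount hX.measurable hA), (hX.count_law A hA hΛ).map_eq,
    lintegral_map hm measurable_from_top]
  simp_rw [expNeg_mul_natCast]
  rw [lintegral_pow_poissonMeasure _ (expNeg_le_one c), ENNReal.coe_toNNReal hΛ]

/-- The sum of `f` over the points is a combination of the counts in the level sets of `f`. These
are disjoint, so the counts are independent and the expectation factorizes. -/
lemma IsPoissonProcess.lintegral_infProd_simpleFunc (hX : IsPoissonProcess μ X Λ)
    (f : SimpleFunc E ℝ≥0∞) (hf : ∀ y, y ≠ 0 → Λ (f ⁻¹' {y}) ≠ ∞) :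
    ∫⁻ ω, infProd (fun n => expNeg (f (X n ω))) ∂μ = expNeg (∫⁻ x, (1 - expNeg (f x)) ∂Λ) := by
  have h1 : ∀ x, f x = ∑ y ∈ f.range, y * (f ⁻¹' {y}).indicator (fun _ => 1) x := by
    intro x
    rw [Finset.sum_eq_single (f x)]
    · simp
    · intro y _ hy
      rw [Set.indicator_of_notMem (by simpa using hy.symm), mul_zero]
    · intro h
      exact absurd (f.mem_range_self x) h
  have h2 : ∀ ω, ∑' n, f (X n ω) = ∑ y ∈ f.range, y * pointCount X (f ⁻¹' {y}) ω := by
    intro ω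
    simp_rw [pointCount, ← ENNReal.tsum_mul_left]
    rw [← Summable.tsum_finsetSum fun _ _ => ENNReal.summable]
    exact tsum_congr fun n => h1 _
  have h3 : ∫⁻ x, (1 - expNeg (f x)) ∂Λ
      = ∑ y ∈ f.range, (1 - expNeg y) * Λ (f ⁻¹' {y}) := by
    rw [← SimpleFunc.map_lintegral (fun y => 1 - expNeg y) f, ← SimpleFunc.lintegral_eq_lintegral]
    rfl
  simp_rw [infProd_expNeg, h2, h3, expNeg_sum]
  let e := f.range.equivFin
  have hind : iIndepFun (fun j : Fin f.range.card =>
      pointCount X (f ⁻¹' {((e.symm j : f.range) : ℝ≥0∞)})) μ := by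
    refine hX.count_indep _ _ (fun j => f.measurableSet_fiber _) fun i j hij => ?_
    refine Set.disjoint_left.2 fun x hx hx' => hij ?_
    have : (e.symm i : ℝ≥0∞) = e.symm j := by
      rw [Set.mem_preimage, Set.mem_singleton_iff] at hx hx'
      rw [← hx, ← hx']
    exact e.symm.injective (Subtype.ext this)
  have hm : ∀ j : Fin f.range.card, Measurable fun y => expNeg ((e.symm j : ℝ≥0∞) * y) :=
    fun j => by fun_prop
  have hre : ∀ g : ℝ≥0∞ → ℝ≥0∞, ∏ y ∈ f.range, g y = ∏ j : Fin f.range.card, g (e.symm j) := by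
    intro g
    rw [← Finset.prod_coe_sort, ← e.symm.prod_comp]
  simp_rw [hre]
  rw [lintegral_prod_eq_prod_lintegral_of_indepFun Finset.univ
    (fun j ω => expNeg ((e.symm j : ℝ≥0∞) * pointCount X (f ⁻¹' {((e.symm j : f.range) : ℝ≥0∞)}) ω))
    (hind.comp _ hm)
    (fun j => (hm j).comp (measurable_pointCount hX.measurable (f.measurableSet_fiber _)))]
  refine Finset.prod_congr rfl fun j _ => ?_
  -- The zero level set may have infinite intensity, where the count law says nothing; but there the
  -- weight is 0 and both sides are 1.
  by_cases hj : (e.symm j : ℝ≥0∞) = 0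
  · have := (hX.count_indep 0 (fun _ => ∅) (fun _ => MeasurableSet.empty)
      fun i => i.elim0).isProbabilityMeasure
    simp [hj]
  · exact hX.lintegral_expNeg_pointCount (f.measurableSet_fiber _) (hf _ hj) _

/-- Simple functions of finite-measure support increase to -log v, so the factors decrease to v.
Dominated convergence handles the expectation, monotone convergence the exponent. -/
lemma IsPoissonProcess.hasPoissonPGFL [SigmaFinite Λ] (hX : IsPoissonProcess μ X Λ) :
    HasPoissonPGFL μ X Λ := by
  have := (hX.count_indep 0 (fun _ => ∅) (fun _ => MeasurableSet.empty)
      fun i => i.elim0).isProbabilityMeasure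
  intro v hv hv1
  set w : E → ℝ≥0∞ := fun x => (-(ENNReal.log (v x))).toENNReal with hw
  have hwm : Measurable w := (hv.ennreal_log.neg).ereal_toENNReal
  have hvw : ∀ x, v x = expNeg (w x) := fun x => (exists_expNeg_eq (hv1 x)).symm
  let f : ℕ → SimpleFunc E ℝ≥0∞ := fun n => (SimpleFunc.eapprox w n).restrict (spanningSets Λ n)
  have hfapp : ∀ n x, f n x = (spanningSets Λ n).indicator (SimpleFunc.eapprox w n) x := fun n x =>
    SimpleFunc.restrict_apply _ (measurableSet_spanningSets Λ n) _
  have hfmono : ∀ x, Monotone fun n => f n x := by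
    intro x m n hmn
    simp only [hfapp]
    refine (Set.indicator_le_indicator (SimpleFunc.monotone_eapprox w hmn x)).trans ?_
    exact Set.indicator_le_indicator_of_subset (monotone_spanningSets Λ hmn) (fun _ => zero_le) x
  have hflim : ∀ x, Tendsto (fun n => f n x) atTop (𝓝 (w x)) := by
    intro x
    refine (SimpleFunc.tendsto_eapprox hwm x).congr' ?_
    filter_upwards [eventually_ge_atTop (spanningSetsIndex Λ x)] with n hn
    rw [hfapp, Set.indicator_of_mem (monotone_spanningSets Λ hn (mem_spanningSetsIndex Λ x))]
  have hfle : ∀ n x, f n x ≤ w x := fun n x => (hfmono x).ge_of_tendsto (hflim x) n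
  have hstep : ∀ n, ∫⁻ ω, infProd (fun k => expNeg (f n (X k ω))) ∂μ
      = expNeg (∫⁻ x, (1 - expNeg (f n x)) ∂Λ) := by
    refine fun n => hX.lintegral_infProd_simpleFunc (f n) fun y hy => ?_
    refine (lt_of_le_of_lt (measure_mono ?_) (measure_spanningSets_lt_top Λ n)).ne
    intro x hx
    by_contra hxs
    have : f n x = 0 := by rw [hfapp, Set.indicator_of_notMem hxs]
    rw [Set.mem_preimage, Set.mem_singleton_iff, this] at hx
    exact hy hx.symm
  simp_rw [hvw]
  refine tendsto_nhds_unique (f := fun n => ∫⁻ ω, infProd (fun k => expNeg (f n (X k ω))) ∂μ)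
    (l := atTop) ?_ ?_
  · refine tendsto_lintegral_of_dominated_convergence (fun _ => 1) ?_ ?_ (by simp) ?_
    · intro n
      exact measurable_infProd fun k =>
        measurable_expNeg.comp ((f n).measurable.comp (hX.measurable k))
    · exact fun n => Eventually.of_forall fun ω => infProd_le_one _
    · refine Eventually.of_forall fun ω => tendsto_infProd_of_le (fun _ _ => expNeg_le_one _)
        (fun n k => expNeg_anti (hfle n _)) fun k => ?_
      exact (continuous_expNeg.tendsto _).comp (hflim _)
  · simp_rw [hstep]
    refine (continuous_expNeg.tendsto _).comp ?_
    refine lintegral_tendsto_of_tendsto_of_monotone ?_ ?_ ?_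
    · intro n
      exact (measurable_const.sub (measurable_expNeg.comp (f n).measurable)).aemeasurable
    · exact Eventually.of_forall fun x m n hmn => tsub_le_tsub_left (expNeg_anti (hfmono x hmn)) _
    · refine Eventually.of_forall fun x => ?_
      exact ENNReal.Tendsto.sub tendsto_const_nhds ((continuous_expNeg.tendsto _).comp (hflim x))
        (Or.inl ENNReal.one_ne_top)

lemma IsHomogeneousPPP.hasPoissonPGFL {Y : ℕ → Ω → Plane} {lam : ℝ}
    (hY : IsHomogeneousPPP μ Y lam) :
    HasPoissonPGFL μ Y (ENNReal.ofReal lam • (volume : Measure Plane)) :=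
  have : SigmaFinite (ENNReal.ofReal lam • (volume : Measure Plane)) :=
    SMul.sigmaFinite (μ := (volume : Measure Plane)) lam.toNNReal
  IsPoissonProcess.hasPoissonPGFL hY

/-- The superposition of finitely many independent processes, each point being marked with the
type of the process it belongs to. -/
lemma HasPoissonPGFL.superposition {κ : Type*} [Fintype κ] [MeasurableSpace κ]
    {X : κ × ℕ → Ω → E} (hXm : ∀ k, Measurable (X k)) {Λ : κ → Measure E}
    (hX : ∀ i, HasPoissonPGFL μ (fun n => X (i, n)) (Λ i))
    (hind : iIndepFun (fun (i : κ) (ω : Ω) (n : ℕ) => X (i, n) ω) μ) :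
    HasPoissonPGFL μ (fun k ω => (k.1, X k ω)) (Measure.sum fun i => (Λ i).map (Prod.mk i)) := by
  intro v hv hv1
  have hvi : ∀ i, Measurable fun x => v (i, x) := fun i => hv.comp measurable_prodMk_left
  have h1 : ∀ ω, infProd (fun k : κ × ℕ => v (k.1, X k ω))
      = ∏ i, infProd (fun n => v (i, X (i, n) ω)) := by
    intro ω
    obtain ⟨w, rfl⟩ : ∃ w : κ × E → ℝ≥0∞, v = fun z => expNeg (w z) :=
      -- In logarithmic form, splitting the product by type is an iterated sum over pairs.
      ⟨fun z => (-(ENNReal.log (v z))).toENNReal, funext fun z => (exists_expNeg_eq (hv1 z)).symm⟩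
    simp_rw [infProd_expNeg, ← expNeg_sum]
    rw [ENNReal.tsum_prod', tsum_fintype]
  have hm : ∀ i, Measurable fun s : ℕ → E => infProd fun n => v (i, s n) := fun i =>
    measurable_infProd fun n => (hvi i).comp (measurable_pi_apply n)
  simp_rw [h1]
  rw [lintegral_prod_eq_prod_lintegral_of_indepFun Finset.univ
    (fun i ω => infProd (fun n => v (i, X (i, n) ω))) (hind.comp _ hm)
    (fun i => (hm i).comp (measurable_pi_lambda _ fun n => hXm _))]
  rw [lintegral_sum_measure, tsum_fintype, expNeg_sum]
  refine Finset.prod_congr rfl fun i _ => ?_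
  rw [hX i _ (hvi i) fun x => hv1 _]
  congr 1
  exact (lintegral_map (measurable_const.sub hv) measurable_prodMk_left).symm

end PGFL

/-! ### The reduced Campbell–Mecke formula -/

lemma tendsto_two_pow_mul_of_hasDerivAt {φ : ℝ → ℝ} {d : ℝ} (h : HasDerivAt φ d 0)
    (h0 : φ 0 = 0) : Tendsto (fun n : ℕ => 2 ^ n * φ ((2 ^ n)⁻¹)) atTop (𝓝 d) := by
  have h1 := hasDerivAt_iff_tendsto_slope.1 h
  have h2 : Tendsto (fun n : ℕ => ((2 : ℝ) ^ n)⁻¹) atTop (𝓝[≠] 0) := by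
    refine tendsto_nhdsWithin_iff.2 ⟨?_, Eventually.of_forall fun n => by simp⟩
    exact tendsto_inv_atTop_zero.comp (tendsto_pow_atTop_atTop_of_one_lt one_lt_two)
  refine (h1.comp h2).congr fun n => ?_
  simp [slope, h0]

lemma two_pow_mul_one_sub_expNeg_ofReal {c x : ℝ} (n : ℕ) (hc : c = (2 ^ n)⁻¹) (hx : 0 ≤ x) :
    (2 : ℝ≥0∞) ^ n * (1 - expNeg (ENNReal.ofReal c * ENNReal.ofReal x))
      = ENNReal.ofReal (2 ^ n * (1 - Real.exp (-(c * x)))) := by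
  have hc0 : 0 ≤ c := by rw [hc]; positivity
  have h0 : 0 ≤ c * x := mul_nonneg hc0 hx
  rw [← ENNReal.ofReal_mul hc0, expNeg_ofReal h0, ENNReal.ofReal_mul (by positivity),
    ENNReal.ofReal_sub _ (Real.exp_nonneg _), ENNReal.ofReal_one, ENNReal.ofReal_pow zero_le_two]
  simp

lemma tendsto_two_pow_mul_one_sub_expNeg (x : ℝ≥0∞) :
    Tendsto (fun n : ℕ => (2 : ℝ≥0∞) ^ n * (1 - expNeg (ENNReal.ofReal (2 ^ n)⁻¹ * x))) atTop
      (𝓝 x) := by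
  rcases eq_or_ne x ∞ with rfl | hx
  · have : ∀ n : ℕ, ENNReal.ofReal (2 ^ n)⁻¹ * ∞ = ∞ := fun n =>
      ENNReal.mul_top (by simp)
    simp only [this, expNeg_top, tsub_zero, mul_one]
    exact ENNReal.tendsto_pow_atTop_nhds_top_iff.2 ENNReal.one_lt_two
  · have hd : HasDerivAt (fun t : ℝ => 1 - Real.exp (-(t * x.toReal))) x.toReal 0 := by
      have := (((hasDerivAt_id (0 : ℝ)).mul_const x.toReal).neg.exp).const_sub 1
      simpa using this
    have h := ENNReal.tendsto_ofReal (tendsto_two_pow_mul_of_hasDerivAt hd (by simp))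
    rw [ENNReal.ofReal_toReal hx] at h
    refine h.congr fun n => ?_
    rw [← two_pow_mul_one_sub_expNeg_ofReal n rfl ENNReal.toReal_nonneg, ENNReal.ofReal_toReal hx]

/-- Dyadic step sizes make consecutive terms comparable: with y the exponential at half the step, 1
- y² = (1 - y)(1 + y) ≤ 2 (1 - y). This permits monotone convergence in the derivative below,
without a moment bound on the number of points. -/
lemma monotone_two_pow_mul_one_sub_expNeg (x : ℝ≥0∞) :
    Monotone fun n : ℕ => (2 : ℝ≥0∞) ^ n * (1 - expNeg (ENNReal.ofReal (2 ^ n)⁻¹ * x)) := by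
  refine monotone_nat_of_le_succ fun n => ?_
  set y := expNeg (ENNReal.ofReal (2 ^ (n + 1))⁻¹ * x) with hy
  have hy1 : y ≤ 1 := expNeg_le_one _
  have h2 : expNeg (ENNReal.ofReal (2 ^ n)⁻¹ * x) = y * y := by
    rw [hy, ← expNeg_add, ← add_mul, ← ENNReal.ofReal_add (by positivity) (by positivity)]
    congr 3
    field_simp
    ring
  rw [h2, pow_succ, mul_assoc]
  refine mul_le_mul_right ?_ _
  rw [tsub_le_iff_right]
  calc (1 : ℝ≥0∞) = (1 - y) + y := (tsub_add_cancel_of_le hy1).symm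
    _ = (1 - y) + y * ((1 - y) + y) := by
      rw [tsub_add_cancel_of_le hy1, mul_one, tsub_add_cancel_of_le hy1]
    _ = (1 - y) + y * (1 - y) + y * y := by ring
    _ ≤ (1 - y) + 1 * (1 - y) + y * y := by gcongr
    _ = 2 * (1 - y) + y * y := by ring

section Mecke

variable {Ω E ι : Type*} [MeasurableSpace Ω] [MeasurableSpace E] [Countable ι]
  {μ : Measure Ω} [IsProbabilityMeasure μ] {Y : ι → Ω → E} {Λ : Measure E}

/-- This is the derivative at t = 0 of the generating functional at w exp(-t 1_B): on one side it
brings down the count N of B, on the other the integral b of w over B. -/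
lemma HasPoissonPGFL.lintegral_tsum_mul_infProd (hY : HasPoissonPGFL μ Y Λ)
    (hYm : ∀ k, Measurable (Y k)) {w : E → ℝ≥0∞} (hw : Measurable w) (hw1 : ∀ x, w x ≤ 1)
    {B : Set E} (hB : MeasurableSet B) (hΛ : Λ B ≠ ∞) :
    ∫⁻ ω, infProd (fun k => w (Y k ω)) * ∑' l, B.indicator (fun _ => 1) (Y l ω) ∂μ
      = expNeg (∫⁻ x, (1 - w x) ∂Λ) * ∫⁻ x in B, w x ∂Λ := by
  set D : Ω → ℝ≥0∞ := fun ω => infProd fun k => w (Y k ω) with hD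
  set N : Ω → ℝ≥0∞ := fun ω => ∑' l, B.indicator (fun _ => 1) (Y l ω) with hN
  set b := ∫⁻ x in B, w x ∂Λ with hb
  have hbfin : b ≠ ∞ := by
    refine ((lintegral_mono hw1).trans_lt ?_).ne
    simpa using hΛ.lt_top
  have hDm : Measurable D := measurable_infProd fun k => hw.comp (hYm k)
  have hNm : Measurable N := Measurable.tsum fun l => (measurable_const.indicator hB).comp (hYm l)
  have hDfin : ∫⁻ ω, D ω ∂μ ≠ ∞ :=
    ((lintegral_mono fun ω => infProd_le_one _).trans_lt (by simp)).ne
  -- Rests on 1 - w exp(-t 1_B) = (1 - w) + (1 - exp(-t)) w 1_B.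
  have hkey : ∀ t : ℝ≥0∞, ∫⁻ ω, D ω * expNeg (t * N ω) ∂μ
      = expNeg (∫⁻ x, (1 - w x) ∂Λ) * expNeg ((1 - expNeg t) * b) := by
    intro t
    have hvm : Measurable fun x => expNeg (t * B.indicator (fun _ => 1) x) :=
      measurable_expNeg.comp ((measurable_const.indicator hB).const_mul t)
    have h := hY (fun x => w x * expNeg (t * B.indicator (fun _ => 1) x)) (hw.mul hvm)
      fun x => mul_le_one' (hw1 x) (expNeg_le_one _)
    simp_rw [infProd_mul (fun k => hw1 _) (fun k => expNeg_le_one _), infProd_expNeg,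
      ENNReal.tsum_mul_left] at h
    have hw' : Measurable fun x => 1 - w x := measurable_const.sub hw
    rw [h, ← expNeg_add]
    congr 1
    rw [hb, ← lintegral_indicator hB, ← lintegral_const_mul _ (hw.indicator hB),
      ← lintegral_add_left hw']
    refine lintegral_congr fun x => ?_
    by_cases hx : x ∈ B
    · simp only [Set.indicator_of_mem hx, mul_one]
      have e1 := hw1 x
      have e2 := expNeg_le_one t
      generalize w x = a at *
      generalize expNeg t = s at *
      refine ENNReal.sub_eq_of_eq_add_rev ((mul_le_one' e1 e2).trans_lt ENNReal.one_lt_top).ne ?_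
      calc (1 : ℝ≥0∞) = (1 - a) + a * ((1 - s) + s) := by
            rw [tsub_add_cancel_of_le e2, mul_one, tsub_add_cancel_of_le e1]
        _ = a * s + (1 - a + (1 - s) * a) := by ring
    · simp [Set.indicator_of_notMem hx]
  have hL : ∫⁻ ω, D ω ∂μ = expNeg (∫⁻ x, (1 - w x) ∂Λ) := hY w hw hw1
  have hdiff : ∀ t : ℝ≥0∞, ∫⁻ ω, D ω * (1 - expNeg (t * N ω)) ∂μ
      = expNeg (∫⁻ x, (1 - w x) ∂Λ) * (1 - expNeg ((1 - expNeg t) * b)) := by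
    intro t
    have hm : Measurable fun ω => D ω * expNeg (t * N ω) := by fun_prop
    have hle : ∀ ω, D ω * expNeg (t * N ω) ≤ D ω := fun ω =>
      mul_le_of_le_one_right zero_le (expNeg_le_one _)
    calc ∫⁻ ω, D ω * (1 - expNeg (t * N ω)) ∂μ
        = ∫⁻ ω, (D ω - D ω * expNeg (t * N ω)) ∂μ := by
          refine lintegral_congr fun ω => ?_
          rw [ENNReal.mul_sub fun _ _ => ((infProd_le_one _).trans_lt ENNReal.one_lt_top).ne,
            mul_one]
      _ = _ := by
          rw [lintegral_sub hm ((lintegral_mono hle).trans_lt hDfin.lt_top).ne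
            (Eventually.of_forall hle), hkey, hL, ENNReal.mul_sub fun _ _ => expNeg_ne_top _,
            mul_one]
  -- Difference quotients with t = 2⁻ⁿ: monotone convergence on the probabilistic side, an ordinary
  -- derivative on the explicit side.
  refine tendsto_nhds_unique (f := fun n : ℕ =>
    ∫⁻ ω, D ω * ((2 : ℝ≥0∞) ^ n * (1 - expNeg (ENNReal.ofReal (2 ^ n)⁻¹ * N ω))) ∂μ)
    (l := atTop) ?_ ?_
  · refine lintegral_tendsto_of_tendsto_of_monotone (fun n => ?_) ?_ ?_
    · exact (by fun_prop : Measurable _).aemeasurable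
    · exact Eventually.of_forall fun ω m n hmn =>
        mul_le_mul_right (monotone_two_pow_mul_one_sub_expNeg (N ω) hmn) _
    · exact Eventually.of_forall fun ω =>
        ENNReal.Tendsto.const_mul (tendsto_two_pow_mul_one_sub_expNeg (N ω))
          (Or.inr ((infProd_le_one _).trans_lt ENNReal.one_lt_top).ne)
  · have h1 : ∀ n : ℕ,
        ∫⁻ ω, D ω * ((2 : ℝ≥0∞) ^ n * (1 - expNeg (ENNReal.ofReal (2 ^ n)⁻¹ * N ω))) ∂μ
        = expNeg (∫⁻ x, (1 - w x) ∂Λ) *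
          ((2 : ℝ≥0∞) ^ n * (1 - expNeg ((1 - expNeg (ENNReal.ofReal (2 ^ n)⁻¹)) * b))) := by
      intro n
      rw [mul_left_comm, ← hdiff, ← lintegral_const_mul _ (by fun_prop)]
      refine lintegral_congr fun ω => ?_
      ring
    simp_rw [h1]
    refine ENNReal.Tendsto.const_mul ?_ (Or.inr (expNeg_ne_top _))
    have hd : HasDerivAt (fun t : ℝ => 1 - Real.exp (-((1 - Real.exp (-t)) * b.toReal)))
        b.toReal 0 := by
      have h2 : HasDerivAt (fun t : ℝ => 1 - Real.exp (-t)) 1 0 := by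
        simpa using ((hasDerivAt_id (0 : ℝ)).neg.exp).const_sub 1
      have := ((h2.mul_const b.toReal).neg.exp).const_sub 1
      simpa using this
    have h := ENNReal.tendsto_ofReal (tendsto_two_pow_mul_of_hasDerivAt hd (by simp))
    rw [ENNReal.ofReal_toReal hbfin] at h
    refine h.congr fun n => ?_
    have hp : (0 : ℝ) ≤ (2 ^ n)⁻¹ := by positivity
    have he : Real.exp (-(2 ^ n)⁻¹) ≤ 1 := Real.exp_le_one_iff.2 (by linarith)
    rw [expNeg_ofReal hp, ← ENNReal.ofReal_one, ← ENNReal.ofReal_sub _ (Real.exp_nonneg _)]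
    conv_rhs => rw [← ENNReal.ofReal_toReal hbfin]
    rw [← ENNReal.ofReal_mul (by linarith),
      expNeg_ofReal (mul_nonneg (by linarith) ENNReal.toReal_nonneg),
      ← ENNReal.ofReal_sub _ (Real.exp_nonneg _), ENNReal.ofReal_mul (by positivity),
      ENNReal.ofReal_pow zero_le_two]
    simp

variable [DecidableEq ι]

/-- The reduced Campbell–Mecke formula for a functional that does not depend on the typical
point. -/
lemma HasPoissonPGFL.tsum_lintegral_indicator (hY : HasPoissonPGFL μ Y Λ)
    (hYm : ∀ k, Measurable (Y k)) {w : E → ℝ≥0∞} (hw : Measurable w) (hw1 : ∀ x, w x ≤ 1)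
    {A : Set E} (hA : MeasurableSet A) (hΛ : Λ A ≠ ∞) (hw0 : ∀ x ∈ A, w x ≠ 0) :
    ∑' l, ∫⁻ ω, A.indicator (fun _ => 1) (Y l ω) *
        infProd (fun k => if k = l then 1 else w (Y k ω)) ∂μ
      = expNeg (∫⁻ x, (1 - w x) ∂Λ) * Λ A := by
  set D : Ω → ℝ≥0∞ := fun ω => infProd fun k => w (Y k ω) with hD
  have hDm : Measurable D := measurable_infProd fun k => hw.comp (hYm k)
  set L := expNeg (∫⁻ x, (1 - w x) ∂Λ) with hL
  -- `ν₁` is the mean point measure weighted by the full product. The preceding lemma, applied to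
  -- subsets of `A`, identifies it there with `ν₂`, of density L w with respect to Λ.
  let ν₁ : Measure E := Measure.sum fun l => (μ.withDensity D).map (Y l)
  let ν₂ : Measure E := (L • Λ).withDensity w
  have hν : ν₁.restrict A = ν₂.restrict A := by
    ext B hB
    rw [Measure.restrict_apply hB, Measure.restrict_apply hB]
    have hBA := hB.inter hA
    have h := hY.lintegral_tsum_mul_infProd hYm hw hw1 hBA
      ((measure_mono Set.inter_subset_right).trans_lt hΛ.lt_top).ne
    rw [Measure.sum_apply _ hBA, withDensity_apply _ hBA, Measure.restrict_smul,
      lintegral_smul_measure, smul_eq_mul, ← h]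
    simp_rw [← ENNReal.tsum_mul_left]
    have hm : ∀ l, Measurable fun ω => infProd (fun k => w (Y k ω)) *
        (B ∩ A).indicator (fun _ => 1) (Y l ω) := fun l =>
      hDm.mul ((measurable_const.indicator hBA).comp (hYm l))
    rw [lintegral_tsum fun l => (hm l).aemeasurable]
    refine tsum_congr fun l => ?_
    rw [Measure.map_apply (hYm l) hBA, withDensity_apply _ (hYm l hBA),
      ← lintegral_indicator (hYm l hBA)]
    refine lintegral_congr fun ω => ?_
    by_cases hx : Y l ω ∈ B ∩ A
    · rw [Set.indicator_of_mem (show ω ∈ Y l ⁻¹' (B ∩ A) from hx), Set.indicator_of_mem hx, mul_one]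
    · rw [Set.indicator_of_notMem (show ω ∉ Y l ⁻¹' (B ∩ A) from hx), Set.indicator_of_notMem hx,
        mul_zero]
  -- Integrating 1/w over `A` cancels the factor of the counted point in `ν₁` and the density w in
  -- `ν₂`.
  have hwi : Measurable fun x => (w x)⁻¹ := hw.inv
  have h1 : ∫⁻ x in A, (w x)⁻¹ ∂ν₁ = ∑' l, ∫⁻ ω, A.indicator (fun _ => 1) (Y l ω) *
        infProd (fun k => if k = l then 1 else w (Y k ω)) ∂μ := by
    rw [← lintegral_indicator hA, lintegral_sum_measure]
    refine tsum_congr fun l => ?_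
    have hm : Measurable fun ω => A.indicator (fun x => (w x)⁻¹) (Y l ω) :=
      (hwi.indicator hA).comp (hYm l)
    rw [lintegral_map (hwi.indicator hA) (hYm l), lintegral_withDensity_eq_lintegral_mul _ hDm hm]
    refine lintegral_congr fun ω => ?_
    simp only [Pi.mul_apply, hD]
    by_cases hx : Y l ω ∈ A
    · rw [Set.indicator_of_mem hx, Set.indicator_of_mem hx, one_mul,
        infProd_eq_mul (fun k => hw1 _) l, mul_comm, ← mul_assoc, ENNReal.inv_mul_cancel (hw0 _ hx)
        ((hw1 _).trans_lt ENNReal.one_lt_top).ne, one_mul]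
    · rw [Set.indicator_of_notMem hx, Set.indicator_of_notMem hx, mul_zero, zero_mul]
  have h2 : ∫⁻ x in A, (w x)⁻¹ ∂ν₂ = L * Λ A := by
    rw [← lintegral_indicator hA, lintegral_withDensity_eq_lintegral_mul _ hw (hwi.indicator hA),
      lintegral_smul_measure, smul_eq_mul, ← lintegral_indicator_one hA]
    congr 1
    refine lintegral_congr fun x => ?_
    by_cases hx : x ∈ A
    · simp [Set.indicator_of_mem hx, ENNReal.mul_inv_cancel (hw0 _ hx)
        ((hw1 _).trans_lt ENNReal.one_lt_top).ne]
    · simp [Set.indicator_of_notMem hx]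
  rw [← h1, ← h2, hν]

/-- The expected number of points in a set. -/
lemma HasPoissonPGFL.tsum_lintegral_indicator_one (hY : HasPoissonPGFL μ Y Λ)
    (hYm : ∀ k, Measurable (Y k)) {A : Set E} (hA : MeasurableSet A) (hΛ : Λ A ≠ ∞) :
    ∑' l, ∫⁻ ω, A.indicator (fun _ => 1) (Y l ω) ∂μ = Λ A := by
  have h := hY.tsum_lintegral_indicator hYm (w := fun _ => 1) measurable_const (fun _ => le_rfl)
    hA hΛ (fun _ _ => one_ne_zero)
  have h1 : infProd (fun _ : ι => (1 : ℝ≥0∞)) = 1 := by simp [infProd]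
  simpa only [ite_self, h1, mul_one, tsub_self, lintegral_zero, expNeg_zero, one_mul] using h

/-- The reduced Campbell–Mecke formula, for a multiplicative functional whose factors `v x y` are
limits from above of factors that depend on `x` only through a discretization of `x`. -/
theorem HasPoissonPGFL.tsum_lintegral_infProd (hY : HasPoissonPGFL μ Y Λ)
    (hYm : ∀ k, Measurable (Y k)) {v : E → E → ℝ≥0∞} {c : ℕ → E → ℕ} (hc : ∀ n, Measurable (c n))
    {w : ℕ → ℕ → E → ℝ≥0∞} (hw : ∀ n j, Measurable (w n j)) (hw1 : ∀ n j x, w n j x ≤ 1)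
    (hw0 : ∀ n x, w n (c n x) x ≠ 0) (hvw : ∀ n x y, v x y ≤ w n (c n x) y)
    (hlim : ∀ x y, Tendsto (fun n => w n (c n x) y) atTop (𝓝 (v x y)))
    (hfin : ∀ x, ∫⁻ y, (1 - v x y) ∂Λ ≠ ∞)
    {A : Set E} (hA : MeasurableSet A) (hΛ : Λ A ≠ ∞) :
    ∑' l, ∫⁻ ω, A.indicator (fun _ => 1) (Y l ω) *
        infProd (fun k => if k = l then 1 else v (Y l ω) (Y k ω)) ∂μ
      = ∫⁻ x in A, expNeg (∫⁻ y, (1 - v x y) ∂Λ) ∂Λ := by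
  have hwm : ∀ n, Measurable fun z : E × E => w n (c n z.1) z.2 := fun n =>
    (measurable_from_prod_countable_right (f := fun z : ℕ × E => w n z.1 z.2) (hw n)).comp
      (((hc n).comp measurable_fst).prodMk measurable_snd)
  have hLm : ∀ n, Measurable fun x => expNeg (∫⁻ y, (1 - w n (c n x) y) ∂Λ) := fun n =>
    (measurable_from_top (f := fun j : ℕ => expNeg (∫⁻ y, (1 - w n j y) ∂Λ))).comp (hc n)
  -- On each cell `c n = j` the factor function is the fixed `w n j`, so the previous formula
  -- applies cell by cell.
  have hstep : ∀ n, ∑' l, ∫⁻ ω, A.indicator (fun _ => 1) (Y l ω) *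
        infProd (fun k => if k = l then 1 else w n (c n (Y l ω)) (Y k ω)) ∂μ
      = ∫⁻ x in A, expNeg (∫⁻ y, (1 - w n (c n x) y) ∂Λ) ∂Λ := by
    intro n
    have hAj : ∀ j, MeasurableSet (A ∩ c n ⁻¹' {j}) := fun j =>
      hA.inter (hc n (measurableSet_singleton j))
    have hdec : ∀ (x : E) (g : ℕ → ℝ≥0∞), A.indicator (fun _ => 1) x * g (c n x)
        = ∑' j, (A ∩ c n ⁻¹' {j}).indicator (fun _ => 1) x * g j := by
      intro x g
      rw [tsum_eq_single (c n x)]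
      · by_cases hx : x ∈ A <;> simp [hx]
      · intro j hj
        rw [Set.indicator_of_notMem (fun h => hj h.2.symm), zero_mul]
    have hm : ∀ l j, Measurable fun ω => (A ∩ c n ⁻¹' {j}).indicator (fun _ => (1 : ℝ≥0∞)) (Y l ω)
        * infProd (fun k => if k = l then 1 else w n j (Y k ω)) := by
      intro l j
      refine ((measurable_const.indicator (hAj j)).comp (hYm l)).mul (measurable_infProd fun k => ?_)
      split_ifs
      exacts [measurable_const, (hw n j).comp (hYm k)]
    calc _ = ∑' l, ∑' j, ∫⁻ ω, (A ∩ c n ⁻¹' {j}).indicator (fun _ => (1 : ℝ≥0∞)) (Y l ω)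
        * infProd (fun k => if k = l then 1 else w n j (Y k ω)) ∂μ := by
          refine tsum_congr fun l => ?_
          rw [← lintegral_tsum fun j => (hm l j).aemeasurable]
          refine lintegral_congr fun ω => ?_
          exact hdec (Y l ω) fun j => infProd (fun k => if k = l then 1 else w n j (Y k ω))
      _ = ∑' j, expNeg (∫⁻ x, (1 - w n j x) ∂Λ) * Λ (A ∩ c n ⁻¹' {j}) := by
          rw [ENNReal.tsum_comm]
          refine tsum_congr fun j => ?_
          refine hY.tsum_lintegral_indicator hYm (hw n j) (hw1 n j) (hAj j)
            ((measure_mono Set.inter_subset_left).trans_lt hΛ.lt_top).ne fun x hx => ?_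
          rw [← show c n x = j from hx.2]
          exact hw0 n x
      _ = _ := by
          rw [← lintegral_indicator hA]
          have h2 : ∀ x, A.indicator (fun x => expNeg (∫⁻ y, (1 - w n (c n x) y) ∂Λ)) x
              = ∑' j, (A ∩ c n ⁻¹' {j}).indicator (fun _ => 1) x *
                expNeg (∫⁻ y, (1 - w n j y) ∂Λ) := by
            intro x
            rw [← hdec x fun j => expNeg (∫⁻ y, (1 - w n j y) ∂Λ)]
            by_cases hx : x ∈ A <;> simp [hx]
          simp_rw [h2]
          rw [lintegral_tsum fun j => ((measurable_const.indicator (hAj j)).mul_const _).aemeasurable]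
          refine tsum_congr fun j => ?_
          rw [lintegral_mul_const _ (measurable_const.indicator (hAj j)),
            lintegral_indicator_const (hAj j), one_mul, mul_comm]
  have hv1 : ∀ x y, v x y ≤ 1 := fun x y => (hvw 0 x y).trans (hw1 _ _ _)
  have hcamp : ∑' l, ∫⁻ ω, A.indicator (fun _ => (1 : ℝ≥0∞)) (Y l ω) ∂μ ≠ ∞ := by
    rwa [hY.tsum_lintegral_indicator_one hYm hA hΛ]
  refine tendsto_nhds_unique (f := fun n => ∑' l, ∫⁻ ω, A.indicator (fun _ => 1) (Y l ω) *
        infProd (fun k => if k = l then 1 else w n (c n (Y l ω)) (Y k ω)) ∂μ) (l := atTop) ?_ ?_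
  -- The sum over points becomes an integral for counting measure. Dominated convergence applies to
  -- it because the probabilities of Y l ∈ A sum to Λ A < ∞.
  · let _ : MeasurableSpace ι := ⊤
    simp_rw [← lintegral_count]
    refine tendsto_lintegral_of_dominated_convergence
      (fun l => ∫⁻ ω, A.indicator (fun _ => (1 : ℝ≥0∞)) (Y l ω) ∂μ)
      (fun n => measurable_from_top) (fun n => Eventually.of_forall fun l => ?_) ?_
      (Eventually.of_forall fun l => ?_)
    · exact lintegral_mono fun ω => mul_le_of_le_one_right zero_le (infProd_le_one _)
    · rwa [lintegral_count]
    · refine tendsto_lintegral_of_dominated_convergence (fun _ => 1) (fun n => ?_)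
        (fun n => Eventually.of_forall fun ω => ?_) (by simp) (Eventually.of_forall fun ω => ?_)
      · refine ((measurable_const.indicator hA).comp (hYm l)).mul (measurable_infProd fun k => ?_)
        split_ifs
        exacts [measurable_const, (hwm n).comp ((hYm l).prodMk (hYm k))]
      · refine mul_le_one' ?_ (infProd_le_one _)
        exact Set.indicator_le_self' (fun _ _ => zero_le) _
      · refine ENNReal.Tendsto.const_mul (tendsto_infProd_of_le ?_ ?_ ?_) (Or.inr ?_)
        · intro n k
          split_ifs
          exacts [le_rfl, hw1 _ _ _]
        · intro n k
          split_ifs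
          exacts [le_rfl, hvw _ _ _]
        · intro k
          split_ifs
          exacts [tendsto_const_nhds, hlim _ _]
        · exact ((Set.indicator_le_self' (f := fun _ => (1 : ℝ≥0∞)) (fun _ _ => zero_le) _).trans_lt
            ENNReal.one_lt_top).ne
  · simp_rw [hstep]
    refine tendsto_lintegral_of_dominated_convergence (fun _ => 1) hLm
      (fun n => Eventually.of_forall fun x => expNeg_le_one _) (by simpa using hΛ)
      (Eventually.of_forall fun x => ?_)
    refine (continuous_expNeg.tendsto _).comp ?_
    refine tendsto_lintegral_of_dominated_convergence (fun y => 1 - v x y)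
      (fun n => measurable_const.sub (hw n _))
      (fun n => Eventually.of_forall fun y => tsub_le_tsub_left (hvw n x y) _) (hfin x)
      (Eventually.of_forall fun y => ?_)
    exact ENNReal.Tendsto.sub tendsto_const_nhds (hlim x y) (Or.inl ENNReal.one_ne_top)

end Mecke

/-! ### Rayleigh fading -/

section Fading

variable {Ω : Type*} [MeasurableSpace Ω] {μ : Measure Ω}

lemma measure_lt_of_hasLaw_exp {H : Ω → ℝ} (hm : Measurable H) (hH : HasLaw H (expMeasure 1) μ)
    (x : ℝ≥0∞) : μ {ω | x < ENNReal.ofReal (H ω)} = expNeg x := by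
  rcases eq_or_ne x ∞ with rfl | hx
  · simp
  have := isProbabilityMeasure_expMeasure one_pos
  have h1 : {ω | x < ENNReal.ofReal (H ω)} = H ⁻¹' (Set.Iic x.toReal)ᶜ := by
    ext ω
    simp [ENNReal.lt_ofReal_iff_toReal_lt hx]
  rw [h1, ← Measure.map_apply hm measurableSet_Iic.compl, hH.map_eq,
    prob_compl_eq_one_sub measurableSet_Iic, ← ofReal_cdf, cdf_expMeasure_eq one_pos,
    if_pos ENNReal.toReal_nonneg, one_mul, ENNReal.ofReal_sub _ (Real.exp_nonneg _),
    ENNReal.ofReal_one, ← expNeg_ofReal ENNReal.toReal_nonneg, ENNReal.ofReal_toReal hx]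
  exact ENNReal.sub_sub_cancel ENNReal.one_ne_top (expNeg_le_one _)

lemma ae_pos_of_hasLaw_exp [IsProbabilityMeasure μ] {H : Ω → ℝ} (hm : Measurable H)
    (hH : HasLaw H (expMeasure 1) μ) : ∀ᵐ ω ∂μ, 0 < H ω := by
  have h := measure_lt_of_hasLaw_exp hm hH 0
  rw [expNeg_zero] at h
  have h2 := (prob_compl_eq_zero_iff (measurableSet_lt measurable_const
    (ENNReal.measurable_ofReal.comp hm))).2 h
  filter_upwards [measure_eq_zero_iff_ae_notMem.1 h2] with ω hω
  simpa using hω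

/-- Tilting the rate-one exponential density by exp(-z x) gives (1 + z)⁻¹ times the density of rate
1 + z. For z = ∞ both sides vanish, since the variable is almost surely positive. -/
lemma lintegral_expNeg_mul_of_hasLaw_exp [IsProbabilityMeasure μ] {H : Ω → ℝ} (hm : Measurable H)
    (hH : HasLaw H (expMeasure 1) μ) (z : ℝ≥0∞) :
    ∫⁻ ω, expNeg (z * ENNReal.ofReal (H ω)) ∂μ = (1 + z)⁻¹ := by
  rcases eq_or_ne z ∞ with rfl | hz
  · have : ∀ᵐ ω ∂μ, expNeg (∞ * ENNReal.ofReal (H ω)) = 0 := by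
      filter_upwards [ae_pos_of_hasLaw_exp hm hH] with ω hω
      rw [ENNReal.top_mul (by simpa using hω), expNeg_top]
    rw [lintegral_congr_ae this]
    simp
  lift z to ℝ≥0 using hz
  have hpos : (0 : ℝ) < 1 + z := by positivity
  have hf : Measurable fun x : ℝ => expNeg (z * ENNReal.ofReal x) := by fun_prop
  have hexp : expMeasure 1 = volume.withDensity (exponentialPDF 1) := rfl
  have hpdf : ∀ r, Measurable (exponentialPDF r) := fun r =>
    (measurable_exponentialPDFReal r).ennreal_ofReal
  rw [← lintegral_map hf hm, hH.map_eq, hexp, lintegral_withDensity_eq_lintegral_mul _ (hpdf 1) hf]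
  have h1 : ∀ x : ℝ, (exponentialPDF 1 * fun x => expNeg (z * ENNReal.ofReal x)) x
      = (1 + (z : ℝ≥0∞))⁻¹ * exponentialPDF (1 + z) x := by
    intro x
    rw [Pi.mul_apply]
    rcases lt_or_ge x 0 with hx | hx
    · rw [exponentialPDF_of_neg hx, exponentialPDF_of_neg hx, zero_mul, mul_zero]
    · have hz1 : (1 + (z : ℝ≥0∞)) = ENNReal.ofReal (1 + z) := by
        rw [ENNReal.ofReal_add zero_le_one (by positivity)]; simp
      rw [exponentialPDF_of_nonneg hx, exponentialPDF_of_nonneg hx, ← ENNReal.ofReal_coe_nnreal,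
        ← ENNReal.ofReal_mul (by positivity), expNeg_ofReal (by positivity),
        ← ENNReal.ofReal_mul (by positivity), ENNReal.ofReal_coe_nnreal, hz1,
        ← ENNReal.ofReal_inv_of_pos hpos, ← ENNReal.ofReal_mul (by positivity)]
      congr 1
      rw [← mul_assoc, inv_mul_cancel₀ hpos.ne', one_mul, one_mul, one_mul, ← Real.exp_add]
      congr 1
      ring
  simp_rw [h1]
  rw [lintegral_const_mul _ (hpdf _), lintegral_exponentialPDF_eq_one hpos, mul_one]

lemma measurable_tsum_mul_ofReal {α ι : Type*} [MeasurableSpace α] [Countable ι] {H : ι → α → ℝ}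
    {l : ι} (hH : ∀ k, k ≠ l → Measurable (H k)) {z : ι → ℝ≥0∞} (hz : z l = 0) :
    Measurable fun a => ∑' k, z k * ENNReal.ofReal (H k a) := by
  refine Measurable.tsum fun k => ?_
  rcases eq_or_ne k l with rfl | hk
  · simp [hz]
  · exact ((hH k hk).ennreal_ofReal).const_mul _

/-- Since z l = 0, the sum is measurable with respect to the σ-algebra generated by the other
variables. -/
lemma indepFun_tsum_mul_ofReal {ι : Type*} [Countable ι] {H : ι → Ω → ℝ} (hind : iIndepFun H μ)
    (hm : ∀ k, Measurable (H k)) {l : ι} {z : ι → ℝ≥0∞} (hz : z l = 0) :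
    IndepFun (fun ω => ∑' k, z k * ENNReal.ofReal (H k ω)) (H l) μ := by
  have h := indep_iSup_of_disjoint (fun k => (hm k).comap_le) hind.iIndep
    (disjoint_compl_left (a := ({l} : Set ι)))
  rw [IndepFun_iff_Indep]
  refine indep_of_indep_of_le_left (indep_of_indep_of_le_right h ?_) ?_
  · exact le_iSup₂_of_le l (Set.mem_singleton l) le_rfl
  · refine Measurable.comap_le ?_
    refine @measurable_tsum_mul_ofReal Ω ι (_) _ H l (fun k hk => ?_) z hz
    refine Measurable.mono (comap_measurable (H k)) ?_ le_rfl
    exact le_iSup₂_of_le (f := fun k (_ : k ∈ ({l} : Set ι)ᶜ) =>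
      MeasurableSpace.comap (H k) inferInstance) k (by simpa using hk) le_rfl

/-- Conditionally on the interference R, the exponential tail gives exp(-(R + c)), and the Laplace
transform of R factorizes by independence. -/
lemma measure_tsum_add_lt [IsProbabilityMeasure μ] {ι : Type*} [Countable ι] {H : ι → Ω → ℝ}
    (hind : iIndepFun H μ) (hm : ∀ k, Measurable (H k)) (hlaw : ∀ k, HasLaw (H k) (expMeasure 1) μ)
    {l : ι} {z : ι → ℝ≥0∞} (hz : z l = 0) (c : ℝ≥0∞) :
    μ {ω | ∑' k, z k * ENNReal.ofReal (H k ω) + c < ENNReal.ofReal (H l ω)}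
      = expNeg c * infProd fun k => (1 + z k)⁻¹ := by
  set R : Ω → ℝ≥0∞ := fun ω => ∑' k, z k * ENNReal.ofReal (H k ω)
  have hR : Measurable R := measurable_tsum_mul_ofReal (fun k _ => hm k) hz
  have hS : MeasurableSet {p : ℝ≥0∞ × ℝ | p.1 + c < ENNReal.ofReal p.2} :=
    measurableSet_lt (by fun_prop) (by fun_prop)
  have hφ : Measurable ({p : ℝ≥0∞ × ℝ | p.1 + c < ENNReal.ofReal p.2}.indicator
      fun _ => (1 : ℝ≥0∞)) := measurable_const.indicator hS
  have h1 : ∫⁻ ω, expNeg (R ω + c) ∂μ = expNeg c * infProd fun k => (1 + z k)⁻¹ := by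
    simp_rw [expNeg_add]
    rw [lintegral_mul_const _ (by fun_prop), mul_comm]
    congr 1
    simp_rw [R, ← infProd_expNeg]
    have hg : ∀ k, Measurable fun x : ℝ => expNeg (z k * ENNReal.ofReal x) := fun k => by fun_prop
    rw [lintegral_infProd (V := fun k ω => expNeg (z k * ENNReal.ofReal (H k ω)))
      (hind.comp _ hg) (fun k => (hg k).comp (hm k)) fun _ _ => expNeg_le_one _]
    congr 1
    ext k
    exact lintegral_expNeg_mul_of_hasLaw_exp (hm k) (hlaw k) _
  rw [← h1]
  have h2 := lintegral_indepFun hR (hm l) (indepFun_tsum_mul_ofReal hind hm hz) hφ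
  have h3 : {ω | R ω + c < ENNReal.ofReal (H l ω)}
      = (fun ω => (R ω, H l ω)) ⁻¹' {p : ℝ≥0∞ × ℝ | p.1 + c < ENNReal.ofReal p.2} := rfl
  rw [h3, ← lintegral_indicator_one ((hR.prodMk (hm l)) hS)]
  refine Eq.trans ?_ (h2.trans ?_)
  · rfl
  · refine lintegral_congr fun ω => ?_
    rw [← measure_lt_of_hasLaw_exp (hm l) (hlaw l) (R ω + c),
      ← lintegral_indicator_one (measurableSet_lt measurable_const (hm l).ennreal_ofReal)]
    rfl

/-- The success probability of a link under Rayleigh fading, with fixed gains `D` of the signal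
and `y k` of the interferers. -/
lemma measure_lt_sinr [IsProbabilityMeasure μ] {ι : Type*} [Countable ι] {H : ι → Ω → ℝ}
    (hind : iIndepFun H μ) (hm : ∀ k, Measurable (H k)) (hlaw : ∀ k, HasLaw (H k) (expMeasure 1) μ)
    {l : ι} {y : ι → ℝ≥0∞} (hy : y l = 0) {D S : ℝ≥0∞} (hD : D ≠ 0) (hD' : D ≠ ∞)
    {P β : ℝ} (hP : 0 < P) (hβ : 0 < β) :
    μ {ω | ENNReal.ofReal β < ENNReal.ofReal (P * H l ω) * D /
        (∑' k, ENNReal.ofReal (P * H k ω) * y k + S)}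
      = expNeg (ENNReal.ofReal β * S / (ENNReal.ofReal P * D)) *
        infProd fun k => (1 + ENNReal.ofReal β * y k / D)⁻¹ := by
  have hb0 : ENNReal.ofReal β ≠ 0 := by simpa using hβ
  have hp0 : ENNReal.ofReal P ≠ 0 := by simpa using hP
  have hpD0 : ENNReal.ofReal P * D ≠ 0 := mul_ne_zero hp0 hD
  have hpDt : ENNReal.ofReal P * D ≠ ∞ := ENNReal.mul_ne_top ENNReal.ofReal_ne_top hD'
  rw [← measure_tsum_add_lt hind hm hlaw (l := l) (z := fun k => ENNReal.ofReal β * y k / D)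
    (by simp [hy])]
  congr 1
  ext ω
  simp only [Set.mem_ofPred_eq, ENNReal.ofReal_mul hP.le]
  rw [ENNReal.lt_div_iff_mul_lt (Or.inr ENNReal.ofReal_ne_top) (Or.inr hb0),
    mul_right_comm, mul_comm (ENNReal.ofReal P * D), ← ENNReal.div_lt_iff (Or.inl hpD0) (Or.inl hpDt)]
  have : ENNReal.ofReal β * (∑' k, ENNReal.ofReal P * ENNReal.ofReal (H k ω) * y k + S) /
        (ENNReal.ofReal P * D)
      = ∑' k, ENNReal.ofReal β * y k / D * ENNReal.ofReal (H k ω) +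
        ENNReal.ofReal β * S / (ENNReal.ofReal P * D) := by
    rw [mul_add, ENNReal.add_div, ← ENNReal.tsum_mul_left, ENNReal.div_eq_inv_mul,
      ← ENNReal.tsum_mul_left]
    congr 1
    refine tsum_congr fun k => ?_
    rw [ENNReal.mul_inv (Or.inl hp0) (Or.inl ENNReal.ofReal_ne_top), div_eq_mul_inv]
    calc _ = ((ENNReal.ofReal P)⁻¹ * ENNReal.ofReal P) *
        (ENNReal.ofReal β * y k * D⁻¹ * ENNReal.ofReal (H k ω)) := by ring
      _ = _ := by rw [ENNReal.inv_mul_cancel hp0 ENNReal.ofReal_ne_top, one_mul]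
  rw [this]

end Fading

/-! ### Integrals -/

section Integrals

/-- Polar coordinates on the punctured plane; 2π is the length of the unit circle. -/
lemma lintegral_fun_norm {f : ℝ → ℝ≥0∞} (hf : Measurable f) :
    ∫⁻ z : Plane, f ‖z‖ = ∫⁻ r in Set.Ioi (0 : ℝ), ENNReal.ofReal (2 * Real.pi * r) * f r := by
  have hdim : Module.finrank ℝ Plane = 2 := by simp
  have hsphere : (volume : Measure Plane).toSphere Set.univ = ENNReal.ofReal (2 * Real.pi) := by
    rw [Measure.toSphere_apply_univ, hdim, EuclideanSpace.volume_ball]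
    have h2 : Real.Gamma (1 + 1) = 1 := by norm_num [Real.Gamma_two]
    rw [ENNReal.ofReal_mul zero_le_two]
    simp [h2, Real.sq_sqrt Real.pi_pos.le]
  have hmap : (volume : Measure Plane).restrict ({(0 : Plane)}ᶜ) = volume := by
    rw [restrict_compl_singleton]
  have hfs : Measurable fun r : Set.Ioi (0 : ℝ) => f r := hf.comp measurable_subtype_coe
  have hmp := (volume : Measure Plane).measurePreserving_homeomorphUnitSphereProd
  rw [hdim] at hmp
  calc ∫⁻ z : Plane, f ‖z‖
      = ∫⁻ z : ({(0 : Plane)}ᶜ : Set Plane), f ‖(z : Plane)‖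
          ∂((volume : Measure Plane).comap Subtype.val) := by
        rw [lintegral_subtype_comap (measurableSet_singleton _).compl fun z : Plane => f ‖z‖, hmap]
    _ = ∫⁻ p, f p.2 ∂((volume : Measure Plane).toSphere.prod (Measure.volumeIoiPow (2 - 1))) := by
        rw [← hmp.lintegral_comp (f := fun p => f p.2) (hfs.comp measurable_snd)]
        simp
    _ = ∫⁻ p, (1 : ℝ≥0∞) * f p.2
          ∂((volume : Measure Plane).toSphere.prod (Measure.volumeIoiPow (2 - 1))) := by simp
    _ = ENNReal.ofReal (2 * Real.pi) * ∫⁻ r : Set.Ioi (0 : ℝ), f r ∂Measure.volumeIoiPow 1 := by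
        rw [lintegral_prod_mul (f := fun _ => 1) aemeasurable_const hfs.aemeasurable]
        simp [hsphere]
    _ = ENNReal.ofReal (2 * Real.pi) *
          ∫⁻ r in Set.Ioi (0 : ℝ), ENNReal.ofReal r * f r := by
        congr 1
        rw [Measure.volumeIoiPow, lintegral_withDensity_eq_lintegral_mul _ (by fun_prop) hfs,
          ← lintegral_subtype_comap measurableSet_Ioi]
        simp
    _ = _ := by
        rw [← lintegral_const_mul _ (by fun_prop)]
        refine setLIntegral_congr_fun measurableSet_Ioi fun r hr => ?_
        rw [← mul_assoc, ← ENNReal.ofReal_mul (by positivity)]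

lemma lintegral_fun_dist {f : ℝ → ℝ≥0∞} (hf : Measurable f) (c : Plane) :
    ∫⁻ z : Plane, f (dist z c)
      = ∫⁻ r in Set.Ioi (0 : ℝ), ENNReal.ofReal (2 * Real.pi * r) * f r := by
  rw [← lintegral_fun_norm hf, ← lintegral_sub_right_eq_self (fun z : Plane => f ‖z‖) c]
  simp_rw [dist_eq_norm]

lemma setLIntegral_rpow_mul_exp {q p b : ℝ} (hq : -1 < q) (hp : 0 < p) (hb : 0 < b) :
    ∫⁻ x in Set.Ioi (0 : ℝ), ENNReal.ofReal (x ^ q * Real.exp (-b * x ^ p))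
      = ENNReal.ofReal (b ^ (-(q + 1) / p) * (1 / p) * Real.Gamma ((q + 1) / p)) := by
  rw [← integral_rpow_mul_exp_neg_mul_rpow hp hq hb, ofReal_integral_eq_lintegral_ofReal]
  · exact integrableOn_rpow_mul_exp_neg_mul_rpow hq hp hb
  · filter_upwards [ae_restrict_mem measurableSet_Ioi] with x hx
    have : (0 : ℝ) < x := hx
    positivity

/-- Writing κ / (r^α + κ) as an integral of exponentials and applying Tonelli yields two Gamma
integrals. Their product Γ(2/α) Γ(1 - 2/α) is π / sin(2π/α) by reflection; α > 2 makes the second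
one converge. -/
lemma lintegral_radial_success {α : ℝ} (hα : 2 < α) {κ : ℝ} (hκ : 0 < κ) :
    ∫⁻ r in Set.Ioi (0 : ℝ), ENNReal.ofReal (2 * Real.pi * r) * ENNReal.ofReal (κ / (r ^ α + κ))
      = ENNReal.ofReal (κ ^ (2 / α) * (2 * Real.pi ^ 2 / α / Real.sin (2 * Real.pi / α))) := by
  have hα0 : 0 < α := by linarith
  have h2α : 2 / α < 1 := by rw [div_lt_one hα0]; exact hα
  have hexp : ∀ r : ℝ, 0 < r → ENNReal.ofReal (κ / (r ^ α + κ))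
      = ∫⁻ x in Set.Ioi (0 : ℝ), ENNReal.ofReal (κ * Real.exp (-(r ^ α + κ) * x)) := by
    intro r hr
    have hb : 0 < r ^ α + κ := by positivity
    have h := setLIntegral_rpow_mul_exp (q := 0) (p := 1) (by norm_num) one_pos hb
    simp only [Real.rpow_zero, one_mul, Real.rpow_one, zero_add, div_one, Real.Gamma_one,
      mul_one, Real.rpow_neg_one] at h
    simp_rw [ENNReal.ofReal_mul hκ.le]
    rw [lintegral_const_mul _ (by fun_prop), h, ← ENNReal.ofReal_mul hκ.le, div_eq_mul_inv]
  calc _ = ∫⁻ r in Set.Ioi (0 : ℝ), ∫⁻ x in Set.Ioi (0 : ℝ),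
        ENNReal.ofReal (2 * Real.pi * r) * ENNReal.ofReal (κ * Real.exp (-(r ^ α + κ) * x)) := by
        refine setLIntegral_congr_fun measurableSet_Ioi fun r hr => ?_
        rw [hexp r hr, lintegral_const_mul _ (by fun_prop)]
    _ = ∫⁻ x in Set.Ioi (0 : ℝ), ∫⁻ r in Set.Ioi (0 : ℝ),
        ENNReal.ofReal (2 * Real.pi * r) * ENNReal.ofReal (κ * Real.exp (-(r ^ α + κ) * x)) := by
        rw [lintegral_lintegral_swap]
        exact (by fun_prop : Measurable _).aemeasurable
    _ = ∫⁻ x in Set.Ioi (0 : ℝ), ENNReal.ofReal (2 * Real.pi * κ * (1 / α) * Real.Gamma (2 / α)) *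
        ENNReal.ofReal (x ^ (-(2 / α)) * Real.exp (-κ * x ^ (1 : ℝ))) := by
        refine setLIntegral_congr_fun measurableSet_Ioi fun x hx => ?_
        have hx : 0 < x := hx
        have h := setLIntegral_rpow_mul_exp (q := 1) (p := α) (by norm_num) hα0 hx
        have hG : 0 < Real.Gamma (2 / α) := Real.Gamma_pos_of_pos (by positivity)
        rw [← ENNReal.ofReal_mul (by positivity)]
        calc _ = ∫⁻ r in Set.Ioi (0 : ℝ), ENNReal.ofReal (2 * Real.pi * κ * Real.exp (-κ * x)) *
              ENNReal.ofReal (r ^ (1 : ℝ) * Real.exp (-x * r ^ α)) := by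
              refine setLIntegral_congr_fun measurableSet_Ioi fun r hr => ?_
              have hr : 0 < r := hr
              rw [← ENNReal.ofReal_mul (by positivity), ← ENNReal.ofReal_mul (by positivity),
                Real.rpow_one, show -(r ^ α + κ) * x = -κ * x + -x * r ^ α by ring, Real.exp_add]
              congr 1
              ring
          _ = _ := by
              rw [lintegral_const_mul _ (by fun_prop), h, ← ENNReal.ofReal_mul (by positivity)]
              congr 1
              rw [Real.rpow_one, show (1 : ℝ) + 1 = 2 by norm_num, neg_div]
              ring
    _ = _ := by
        rw [lintegral_const_mul _ (by fun_prop),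
          setLIntegral_rpow_mul_exp (by linarith) one_pos hκ]
        have hG : 0 < Real.Gamma (2 / α) := Real.Gamma_pos_of_pos (by positivity)
        rw [← ENNReal.ofReal_mul (by positivity)]
        congr 1
        have hrefl := Real.Gamma_mul_Gamma_one_sub (2 / α)
        rw [show Real.pi * (2 / α) = 2 * Real.pi / α by ring] at hrefl
        have hpow : κ * κ ^ (-(-(2 / α) + 1) / 1) = κ ^ (2 / α) := by
          rw [← Real.rpow_one_add' hκ.le]
          · congr 1; ring
          · have : 0 < 2 / α := by positivity
            ring_nf
            positivity
        rw [show (-(2 / α) + 1) / 1 = 1 - 2 / α by ring]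
        calc _ = (κ * κ ^ (-(-(2 / α) + 1) / 1)) * (2 * Real.pi / α *
              (Real.Gamma (2 / α) * Real.Gamma (1 - 2 / α))) := by ring
          _ = _ := by rw [hpow, hrefl]; ring

/-- The integrand is at most β x^(1 - α). Integrability ensures that the Bochner integral `H₁` is
the true value and not the default 0. -/
lemma integrableOn_H₁ {α β : ℝ} (hα : 2 < α) (hβ : 0 < β) :
    IntegrableOn (fun x : ℝ => x / (1 + β⁻¹ * x ^ α)) (Set.Ioi 1) := by
  have h := (integrableOn_Ioi_rpow_of_lt (a := 1 - α) (by linarith) one_pos).const_mul β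
  refine h.mono' ?_ ?_
  · exact (by fun_prop : Measurable _).aestronglyMeasurable
  · filter_upwards [ae_restrict_mem measurableSet_Ioi] with x hx
    have hx : (0 : ℝ) < x := one_pos.trans hx
    have hxa : 0 < x ^ α := Real.rpow_pos_of_pos hx _
    rw [Real.norm_of_nonneg (by positivity), Real.rpow_sub hx, Real.rpow_one, ← mul_div_assoc,
      div_le_div_iff₀ (by positivity) hxa]
    have : β * x * (1 + β⁻¹ * x ^ α) = β * x + x * x ^ α := by
      field_simp
    rw [this]
    nlinarith [mul_pos hβ hx]

lemma H₁_nonneg {α β : ℝ} (hβ : 0 < β) : 0 ≤ H₁ β α := by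
  refine setIntegral_nonneg measurableSet_Ioi fun x hx => ?_
  have hx : (0 : ℝ) < x := one_pos.trans hx
  positivity

/-- The substitution t = r x removes r from the integrand up to the factor r². -/
lemma lintegral_radial_outside {α β r : ℝ} (hα : 2 < α) (hβ : 0 < β) (hr : 0 < r) :
    ∫⁻ t in Set.Ioi r, ENNReal.ofReal (2 * Real.pi * t) *
        ENNReal.ofReal (β * r ^ α / (t ^ α + β * r ^ α))
      = ENNReal.ofReal (2 * Real.pi * r ^ 2 * H₁ β α) := by
  have hra : 0 < r ^ α := Real.rpow_pos_of_pos hr _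
  set f : ℝ → ℝ := fun t => 2 * Real.pi * t * (β * r ^ α / (t ^ α + β * r ^ α)) with hf
  have hcomp : ∀ x ∈ Set.Ioi (1 : ℝ), f (r * x) = 2 * Real.pi * r * (x / (1 + β⁻¹ * x ^ α)) := by
    intro x hx
    have hx : (0 : ℝ) < x := one_pos.trans hx
    have hxa : 0 < x ^ α := Real.rpow_pos_of_pos hx _
    simp only [hf]
    rw [Real.mul_rpow hr.le hx.le]
    field_simp
    ring
  have hint : IntegrableOn f (Set.Ioi r) := by
    have h := (integrableOn_Ioi_comp_mul_left_iff f 1 hr).1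
    rw [mul_one] at h
    refine h (IntegrableOn.congr_fun ((integrableOn_H₁ hα hβ).const_mul (2 * Real.pi * r))
      (fun x hx => (hcomp x hx).symm) measurableSet_Ioi)
  have hval : ∫ t in Set.Ioi r, f t = 2 * Real.pi * r ^ 2 * H₁ β α := by
    have h := integral_comp_mul_left_Ioi' f 1 hr
    rw [mul_one] at h
    rw [← h, setIntegral_congr_fun measurableSet_Ioi hcomp, integral_const_mul, H₁, smul_eq_mul]
    ring
  rw [← hval, ofReal_integral_eq_lintegral_ofReal hint]
  · refine setLIntegral_congr_fun measurableSet_Ioi fun t ht => ?_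
    have ht : 0 < t := hr.trans ht
    simp only [hf]
    rw [← ENNReal.ofReal_mul (by positivity)]
  · filter_upwards [ae_restrict_mem measurableSet_Ioi] with t ht
    have ht : 0 < t := hr.trans ht
    simp only [hf]
    positivity

lemma lintegral_radial_inside {r : ℝ} (hr : 0 ≤ r) :
    ∫⁻ t in Set.Ioo 0 r, ENNReal.ofReal (2 * Real.pi * t) = ENNReal.ofReal (Real.pi * r ^ 2) := by
  rw [Measure.restrict_congr_set Ioo_ae_eq_Ioc, ← ofReal_integral_eq_lintegral_ofReal]
  · rw [← intervalIntegral.integral_of_le hr, intervalIntegral.integral_const_mul, integral_id]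
    congr 1
    ring
  · exact (by fun_prop : Continuous fun t : ℝ => 2 * Real.pi * t).integrableOn_Ioc
  · filter_upwards [ae_restrict_mem measurableSet_Ioc] with t ht
    have : 0 < t := ht.1
    positivity

lemma lintegral_exp_neg_sq_dist {b : ℝ} (hb : 0 < b) (u : Plane) :
    ∫⁻ z : Plane, expNeg (ENNReal.ofReal (b * dist z u ^ 2)) = ENNReal.ofReal (Real.pi / b) := by
  rw [lintegral_fun_dist (f := fun t => expNeg (ENNReal.ofReal (b * t ^ 2))) (by fun_prop)]
  have h := setLIntegral_rpow_mul_exp (q := 1) (p := 2) (by norm_num) two_pos hb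
  have h2 : ∀ t ∈ Set.Ioi (0 : ℝ),
      ENNReal.ofReal (2 * Real.pi * t) * expNeg (ENNReal.ofReal (b * t ^ 2))
      = ENNReal.ofReal (2 * Real.pi) * ENNReal.ofReal (t ^ (1 : ℝ) * Real.exp (-b * t ^ (2 : ℝ))) := by
    intro t ht
    have ht : 0 < t := ht
    rw [expNeg_ofReal (by positivity), ← ENNReal.ofReal_mul (by positivity),
      ← ENNReal.ofReal_mul (by positivity), Real.rpow_one, Real.rpow_two, neg_mul, ← mul_assoc]
  rw [setLIntegral_congr_fun measurableSet_Ioi h2, lintegral_const_mul _ (by fun_prop), h,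
    ← ENNReal.ofReal_mul (by positivity)]
  congr 1
  norm_num [Real.rpow_neg_one]
  field_simp

lemma lintegral_expNeg_sq_gaussianReal {v : ℝ≥0} (hv : v ≠ 0) {κ : ℝ} (hκ : 0 ≤ κ) :
    ∫⁻ x, expNeg (ENNReal.ofReal (κ * x ^ 2)) ∂(gaussianReal 0 v)
      = ENNReal.ofReal (√(1 + 2 * v * κ))⁻¹ := by
  have hv0 : (0 : ℝ) < v := by positivity
  have hpos : (0 : ℝ) < 1 + 2 * v * κ := by positivity
  -- The tilted density is a multiple of a centred Gaussian one with 1/v' = 1/v + 2κ; the multiple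
  -- is the ratio of the normalizations.
  obtain ⟨v', hv'⟩ : ∃ v' : ℝ≥0, (v' : ℝ) = v / (1 + 2 * v * κ) :=
    ⟨⟨v / (1 + 2 * v * κ), by positivity⟩, rfl⟩
  have hv'0 : v' ≠ 0 := by
    have : (0 : ℝ) < v' := by rw [hv']; positivity
    exact_mod_cast this.ne'
  have hf : Measurable fun x : ℝ => expNeg (ENNReal.ofReal (κ * x ^ 2)) := by fun_prop
  rw [gaussianReal_of_var_ne_zero _ hv,
    lintegral_withDensity_eq_lintegral_mul _ (measurable_gaussianPDF _ _) hf]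
  have h1 : ∀ x, (gaussianPDF 0 v * fun x : ℝ => expNeg (ENNReal.ofReal (κ * x ^ 2))) x
      = ENNReal.ofReal (√(1 + 2 * v * κ))⁻¹ * gaussianPDF 0 v' x := by
    intro x
    rw [Pi.mul_apply, gaussianPDF, gaussianPDF, expNeg_ofReal (by positivity),
      ← ENNReal.ofReal_mul (gaussianPDFReal_nonneg _ _ _), ← ENNReal.ofReal_mul (by positivity)]
    congr 1
    rw [gaussianPDFReal, gaussianPDFReal, mul_assoc, ← Real.exp_add, ← mul_assoc, hv']
    congr 1
    · rw [← mul_inv, ← Real.sqrt_mul hpos.le]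
      congr 2
      field_simp
    · congr 1
      field_simp
      ring
  simp_rw [h1]
  rw [lintegral_const_mul _ (measurable_gaussianPDF _ _), lintegral_gaussianPDF_eq_one _ hv'0,
    mul_one]

/-- The two independent coordinates contribute equal factors, so the square root disappears. -/
lemma lintegral_expNeg_sq_planarGaussian {δ κ : ℝ} (hδ : 0 < δ) (hκ : 0 ≤ κ) :
    ∫⁻ g, expNeg (ENNReal.ofReal (κ * ‖g‖ ^ 2)) ∂(planarGaussian δ)
      = ENNReal.ofReal (1 / (1 + 2 * δ ^ 2 * κ)) := by
  have hv : (δ ^ 2).toNNReal ≠ 0 := by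
    simpa using hδ.ne'
  have hm : Measurable fun g : Plane => expNeg (ENNReal.ofReal (κ * ‖g‖ ^ 2)) := by fun_prop
  rw [planarGaussian, lintegral_map hm (by fun_prop)]
  have h1 : ∀ x : Fin 2 → ℝ, expNeg (ENNReal.ofReal (κ * ‖(WithLp.toLp 2 x : Plane)‖ ^ 2))
      = ∏ i ∈ Finset.univ, expNeg (ENNReal.ofReal (κ * x i ^ 2)) := by
    intro x
    rw [EuclideanSpace.real_norm_sq_eq, ← expNeg_sum, ← ENNReal.ofReal_sum_of_nonneg,
      Finset.mul_sum]
    intro i _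
    positivity
  simp_rw [h1]
  have hf : Measurable fun x : ℝ => expNeg (ENNReal.ofReal (κ * x ^ 2)) := by fun_prop
  rw [lintegral_prod_eq_prod_lintegral_of_indepFun Finset.univ
    (fun i (x : Fin 2 → ℝ) => expNeg (ENNReal.ofReal (κ * x i ^ 2)))
    (iIndepFun_pi (X := fun _ (x : ℝ) => expNeg (ENNReal.ofReal (κ * x ^ 2)))
      fun _ => hf.aemeasurable) (fun i => hf.comp (measurable_pi_apply i))]
  have h2 : ∀ i : Fin 2, ∫⁻ x, expNeg (ENNReal.ofReal (κ * x i ^ 2))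
      ∂(Measure.pi fun _ : Fin 2 => gaussianReal 0 (δ ^ 2).toNNReal)
      = ENNReal.ofReal (√(1 + 2 * δ ^ 2 * κ))⁻¹ := by
    intro i
    have h3 := (measurePreserving_eval (fun _ : Fin 2 => gaussianReal 0 (δ ^ 2).toNNReal) i)
    have h4 := lintegral_expNeg_sq_gaussianReal hv hκ
    rw [Real.coe_toNNReal _ (by positivity)] at h4
    rw [← h4, ← h3.lintegral_comp hf]
  simp_rw [h2]
  rw [Finset.prod_const, Finset.card_univ, Fintype.card_fin, ← ENNReal.ofReal_pow (by positivity)]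
  congr 1
  rw [inv_pow, Real.sq_sqrt (by positivity), one_div]

end Integrals

/-! ### The factor contributed by one interferer -/

section ThinnedFactor

variable {α β : ℝ} {q D : ℝ≥0∞}

/-- The success probability of a link with signal gain `D` under the interference of one
transmitter at distance `r`, that is active with probability `q`. -/
def thinnedFactor (α β : ℝ) (q D r : ℝ≥0∞) : ℝ≥0∞ :=
  q * (1 + ENNReal.ofReal β * r ^ (-α) / D)⁻¹ + (1 - q)

lemma thinnedFactor_le_one (hq : q ≤ 1) (r : ℝ≥0∞) : thinnedFactor α β q D r ≤ 1 := by
  calc thinnedFactor α β q D r ≤ q * 1 + (1 - q) := by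
        unfold thinnedFactor
        gcongr
        exact ENNReal.inv_le_one.2 le_self_add
    _ = 1 := by rw [mul_one, add_tsub_cancel_of_le hq]

lemma one_sub_thinnedFactor (hq : q ≤ 1) (r : ℝ≥0∞) :
    1 - thinnedFactor α β q D r = q * (1 - (1 + ENNReal.ofReal β * r ^ (-α) / D)⁻¹) := by
  unfold thinnedFactor
  have h1 : (1 + ENNReal.ofReal β * r ^ (-α) / D)⁻¹ ≤ 1 := ENNReal.inv_le_one.2 le_self_add
  generalize (1 + ENNReal.ofReal β * r ^ (-α) / D)⁻¹ = a at *
  have hq' : q ≠ ∞ := (hq.trans_lt ENNReal.one_lt_top).ne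
  refine ENNReal.sub_eq_of_eq_add_rev ?_ ?_
  · refine ENNReal.add_ne_top.2 ⟨ENNReal.mul_ne_top hq' (h1.trans_lt ENNReal.one_lt_top).ne, ?_⟩
    exact (tsub_le_self.trans_lt ENNReal.one_lt_top).ne
  · calc (1 : ℝ≥0∞) = q * ((1 - a) + a) + (1 - q) := by
          rw [tsub_add_cancel_of_le h1, mul_one, add_tsub_cancel_of_le hq]
      _ = _ := by ring

@[fun_prop]
lemma measurable_thinnedFactor {Ω : Type*} [MeasurableSpace Ω] {D r : Ω → ℝ≥0∞}
    (hD : Measurable D) (hr : Measurable r) :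
    Measurable fun a => thinnedFactor α β q (D a) (r a) := by
  unfold thinnedFactor
  fun_prop

lemma thinnedFactor_mono (hα : 0 ≤ α) : Monotone (thinnedFactor α β q D) := by
  intro r r' h
  unfold thinnedFactor
  have : r' ^ (-α) ≤ r ^ (-α) := by
    rw [ENNReal.rpow_neg, ENNReal.rpow_neg]
    exact ENNReal.inv_le_inv.2 (ENNReal.rpow_le_rpow h hα)
  gcongr

lemma thinnedFactor_ne_zero (hα : 0 < α) {r : ℝ≥0∞} (hr : r ≠ 0) (hD : D ≠ 0) :
    thinnedFactor α β q D r ≠ 0 := by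
  unfold thinnedFactor
  intro h
  obtain ⟨h1, h2⟩ := add_eq_zero.1 h
  rcases mul_eq_zero.1 h1 with h3 | h3
  · simp [h3] at h2
  · rw [ENNReal.inv_eq_zero] at h3
    revert h3
    refine ENNReal.add_ne_top.2 ⟨ENNReal.one_ne_top, ENNReal.div_ne_top (ENNReal.mul_ne_top
      ENNReal.ofReal_ne_top ?_) hD⟩
    rw [ENNReal.rpow_neg]
    refine ENNReal.inv_ne_top.2 ?_
    simp [ENNReal.rpow_eq_zero_iff, hr, hα, hα.not_gt]

lemma tendsto_thinnedFactor (hD : D ≠ 0) (hq : q ≤ 1) {r : ℕ → ℝ≥0∞} {r₀ : ℝ≥0∞}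
    (h : Tendsto r atTop (𝓝 r₀)) :
    Tendsto (fun n => thinnedFactor α β q D (r n)) atTop (𝓝 (thinnedFactor α β q D r₀)) := by
  unfold thinnedFactor
  refine Tendsto.add ?_ tendsto_const_nhds
  refine ENNReal.Tendsto.const_mul ?_ (Or.inr (hq.trans_lt ENNReal.one_lt_top).ne)
  refine (continuous_inv.tendsto _).comp (Tendsto.add tendsto_const_nhds ?_)
  refine ENNReal.Tendsto.div_const ?_ (Or.inr hD)
  exact ENNReal.Tendsto.const_mul ((ENNReal.continuous_rpow_const.tendsto _).comp h)
    (Or.inr ENNReal.ofReal_ne_top)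

lemma one_sub_inv_one_add_ofReal (hβ : 0 ≤ β) {R t : ℝ} (hR : 0 < R) (ht : 0 < t) :
    1 - (1 + ENNReal.ofReal β * ENNReal.ofReal t ^ (-α) / ENNReal.ofReal R ^ (-α))⁻¹
      = ENNReal.ofReal (β * R ^ α / (t ^ α + β * R ^ α)) := by
  have hRa : 0 < R ^ α := Real.rpow_pos_of_pos hR _
  have hta : 0 < t ^ α := Real.rpow_pos_of_pos ht _
  have h1 : ENNReal.ofReal β * ENNReal.ofReal t ^ (-α) / ENNReal.ofReal R ^ (-α)
      = ENNReal.ofReal (β * R ^ α / t ^ α) := by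
    rw [ENNReal.ofReal_rpow_of_pos ht, ENNReal.ofReal_rpow_of_pos hR, ← ENNReal.ofReal_mul hβ,
      ← ENNReal.ofReal_div_of_pos (Real.rpow_pos_of_pos hR _), Real.rpow_neg ht.le,
      Real.rpow_neg hR.le]
    congr 1
    field_simp
  have hpos : 0 < 1 + β * R ^ α / t ^ α := by positivity
  rw [h1, ← ENNReal.ofReal_one, ← ENNReal.ofReal_add zero_le_one (by positivity),
    ← ENNReal.ofReal_inv_of_pos hpos, ← ENNReal.ofReal_sub _ (by positivity)]
  congr 1
  field_simp
  ring

/-- The total effect of a homogeneous field of interferers. -/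
lemma lintegral_one_sub_thinnedFactor (hα : 2 < α) (hβ : 0 ≤ β) (hq : q ≤ 1) {R : ℝ} (hR : 0 < R)
    (c : Plane) :
    ∫⁻ y : Plane, (1 - thinnedFactor α β q (ENNReal.ofReal R ^ (-α)) (edist y c))
      = q * ENNReal.ofReal (β ^ (2 / α) * R ^ 2 *
        (2 * Real.pi ^ 2 / α / Real.sin (2 * Real.pi / α))) := by
  have hα0 : 0 < α := by linarith
  have hm : Measurable fun t : ℝ => 1 - (1 + ENNReal.ofReal β * ENNReal.ofReal t ^ (-α) /
      ENNReal.ofReal R ^ (-α))⁻¹ := by fun_prop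
  simp_rw [one_sub_thinnedFactor hq, edist_dist]
  rw [lintegral_const_mul _ (by fun_prop), lintegral_fun_dist hm]
  congr 1
  have h1 : ∀ t ∈ Set.Ioi (0 : ℝ), ENNReal.ofReal (2 * Real.pi * t) * (1 - (1 + ENNReal.ofReal β *
        ENNReal.ofReal t ^ (-α) / ENNReal.ofReal R ^ (-α))⁻¹)
      = ENNReal.ofReal (2 * Real.pi * t) * ENNReal.ofReal (β * R ^ α / (t ^ α + β * R ^ α)) :=
    fun t ht => by rw [one_sub_inv_one_add_ofReal hβ hR ht]
  rw [setLIntegral_congr_fun measurableSet_Ioi h1]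
  rcases hβ.eq_or_lt with rfl | hβ
  · simp [Real.zero_rpow (show 2 / α ≠ 0 by positivity)]
  · rw [lintegral_radial_success hα (by positivity)]
    congr 2
    rw [Real.mul_rpow hβ.le (by positivity), ← Real.rpow_mul hR.le, mul_div_cancel₀ _ hα0.ne',
      Real.rpow_two]

end ThinnedFactor

/-! ### Discretization of the plane -/

/-- The radius of the cells of the `n`-th discretization. -/
def cellRadius (n : ℕ) : ℝ≥0∞ := (n : ℝ≥0∞)⁻¹

/-- At n = 0 the radius is 0⁻¹ = ∞, which is harmless. -/
lemma cellRadius_pos (n : ℕ) : 0 < cellRadius n := by simp [cellRadius]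

lemma tendsto_cellRadius : Tendsto cellRadius atTop (𝓝 0) := ENNReal.tendsto_inv_nat_nhds_zero

lemma exists_edist_denseSeq_lt (n : ℕ) (x : Plane) :
    ∃ m, edist x (TopologicalSpace.denseSeq Plane m) < cellRadius n := by
  obtain ⟨y, ⟨m, rfl⟩, hy⟩ := EMetric.mem_closure_iff.1
    ((TopologicalSpace.denseRange_denseSeq Plane) x) _ (cellRadius_pos n)
  exact ⟨m, hy⟩

open Classical in
/-- The index of the cell of the `n`-th discretization that contains `x`. -/
def cellIndex (n : ℕ) (x : Plane) : ℕ := Nat.find (exists_edist_denseSeq_lt n x)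

lemma edist_cellIndex_lt (n : ℕ) (x : Plane) :
    edist x (TopologicalSpace.denseSeq Plane (cellIndex n x)) < cellRadius n := by
  classical
  exact Nat.find_spec (exists_edist_denseSeq_lt n x)

lemma measurable_cellIndex (n : ℕ) : Measurable (cellIndex n) := by
  classical
  exact measurable_find _ fun m => measurableSet_lt (by fun_prop) measurable_const

/-! ### Coverage of the D2D links -/

section D2DCoverage

lemma measurableSet_transmits {Ω : Type*} [MeasurableSpace Ω] {M : ℕ} {T F : Fin M × ℕ → Ω → Bool}
    (hT : ∀ k, Measurable (T k)) (hF : ∀ k, Measurable (F k)) (k : Fin M × ℕ) :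
    MeasurableSet {ω | transmits T F k ω} :=
  (hT k (measurableSet_singleton true)).inter (hF k (measurableSet_singleton true))

lemma measurable_d2dSINR {Ω : Type*} [MeasurableSpace Ω] {M : ℕ} {X G : Fin M × ℕ → Ω → Plane}
    {T F : Fin M × ℕ → Ω → Bool} {h : Fin M × ℕ → Fin M × ℕ → Ω → ℝ} (hX : ∀ k, Measurable (X k))
    (hG : ∀ k, Measurable (G k)) (hT : ∀ k, Measurable (T k)) (hF : ∀ k, Measurable (F k))
    (hh : ∀ k l, Measurable (h k l)) (PD α s : ℝ) (l : Fin M × ℕ) :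
    Measurable (d2dSINR X G T F h PD α s l) := by
  unfold d2dSINR d2dInterference receivedPower receiver
  refine Measurable.div (by fun_prop) (Measurable.add (Measurable.tsum fun k => ?_)
    measurable_const)
  refine Measurable.ite ?_ (by fun_prop) measurable_const
  exact (MeasurableSet.const (k ≠ l)).inter (measurableSet_transmits hT hF k)

/-- The conditional probability that link `l` transmits, has its receiver in `W` and is covered,
given the positions `x` and displacements `d` and the activities `t`, `f` of all links. -/
def linkCoverage {M : ℕ} (W : Set Plane) (PD α s β : ℝ) (l : Fin M × ℕ)
    (x d : Fin M × ℕ → Plane) (t f : Fin M × ℕ → Bool) : ℝ≥0∞ :=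
  W.indicator (fun _ => 1) (x l + d l) *
    expNeg (ENNReal.ofReal β * ENNReal.ofReal s / (ENNReal.ofReal PD * ‖d l‖ₑ ^ (-α))) *
    infProd fun k =>
      if f k = true then
        if t k = true then
          if k = l then 1
          else (1 + ENNReal.ofReal β * edist (x k) (x l + d l) ^ (-α) / ‖d l‖ₑ ^ (-α))⁻¹
        else if k = l then 0 else 1
      else if k = l then 0 else 1

lemma linkCoverage_le_one_aux {r D b : ℝ≥0∞} (p : Prop) [Decidable p] :
    (if p then 1 else (1 + b * r / D)⁻¹ : ℝ≥0∞) ≤ 1 := by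
  split_ifs
  exacts [le_rfl, ENNReal.inv_le_one.2 le_self_add]

lemma measurable_linkCoverage {Ω : Type*} [MeasurableSpace Ω] {M : ℕ}
    {X G : Fin M × ℕ → Ω → Plane} {T F : Fin M × ℕ → Ω → Bool} (hX : ∀ k, Measurable (X k))
    (hG : ∀ k, Measurable (G k)) (hT : ∀ k, Measurable (T k)) (hF : ∀ k, Measurable (F k))
    {W : Set Plane} (hW : MeasurableSet W) (PD α s β : ℝ) (l : Fin M × ℕ) :
    Measurable fun ω => linkCoverage W PD α s β l (fun k => X k ω) (fun k => G k ω)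
      (fun k => T k ω) (fun k => F k ω) := by
  unfold linkCoverage
  refine Measurable.mul (Measurable.mul ?_ (by fun_prop)) (measurable_infProd fun k => ?_)
  · exact (measurable_const.indicator hW).comp ((hX l).add (hG l))
  · refine Measurable.ite (hF k (measurableSet_singleton true)) (Measurable.ite
      (hT k (measurableSet_singleton true)) ?_ measurable_const) measurable_const
    split_ifs
    · exact measurable_const
    · fun_prop

open Classical in
-- At threshold and noise 0 every interferer's factor is 1, so the formula for the numerator of the
-- Palm ratio also yields its denominator.
lemma linkCoverage_zero {M : ℕ} (W : Set Plane) (PD α : ℝ) (l : Fin M × ℕ)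
    (x d : Fin M × ℕ → Plane) (t f : Fin M × ℕ → Bool) :
    linkCoverage W PD α 0 0 l x d t f
      = if t l = true ∧ f l = true ∧ x l + d l ∈ W then 1 else 0 := by
  unfold linkCoverage
  rw [infProd_eq_mul (fun k => by split_ifs <;> simp) l]
  have h1 : (infProd fun k => if k = l then 1 else if f k = true then if t k = true then
      if k = l then 1 else (1 + ENNReal.ofReal 0 * edist (x k) (x l + d l) ^ (-α) /
        ‖d l‖ₑ ^ (-α))⁻¹ else if k = l then 0 else 1 else if k = l then 0 else 1) = 1 := by
    have : ∀ k : Fin M × ℕ, (if k = l then 1 else if f k = true then if t k = true then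
      if k = l then 1 else (1 + ENNReal.ofReal 0 * edist (x k) (x l + d l) ^ (-α) /
        ‖d l‖ₑ ^ (-α))⁻¹ else if k = l then 0 else 1 else if k = l then 0 else 1)
        = (1 : ℝ≥0∞) := by
      intro k
      split_ifs <;> simp
    simp_rw [this]
    simp [infProd]
  rw [h1]
  by_cases ht : t l = true <;> by_cases hf : f l = true <;> by_cases hw : x l + d l ∈ W <;>
    simp [ht, hf, hw]

variable {Ω : Type*} [MeasurableSpace Ω] {μ : Measure Ω} [IsProbabilityMeasure μ] {M : ℕ}
  {lamD pt pf : Fin M → ℝ} {δ : ℝ} {X G : Fin M × ℕ → Ω → Plane} {T F : Fin M × ℕ → Ω → Bool}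
  {h : Fin M × ℕ → Fin M × ℕ → Ω → ℝ}

instance isProbabilityMeasure_planarGaussian (δ : ℝ) : IsProbabilityMeasure (planarGaussian δ) :=
  Measure.isProbabilityMeasure_map (WithLp.measurable_toLp 2 _).aemeasurable

lemma ae_ne_zero_planarGaussian (hδ : 0 < δ) : ∀ᵐ g ∂(planarGaussian δ), g ≠ 0 := by
  have hv : (δ ^ 2).toNNReal ≠ 0 := by simpa using hδ.ne'
  have := nullSingletonClass_gaussianReal (μ := 0) hv
  rw [planarGaussian, ae_map_iff (WithLp.measurable_toLp 2 _).aemeasurable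
    (p := fun g : Plane => g ≠ 0) (measurableSet_singleton (0 : Plane)).compl]
  have h0 : ∀ᵐ x ∂(gaussianReal 0 (δ ^ 2).toNNReal), x ≠ 0 := by
    simp [ae_iff]
  filter_upwards [(Measure.quasiMeasurePreserving_eval
    (fun _ : Fin 2 => gaussianReal 0 (δ ^ 2).toNNReal) 0).ae h0] with x hx hx0
  refine hx ?_
  simpa using congrArg (fun z : Plane => z 0) hx0

/-- The positions, displacements and activities of all links. -/
abbrev LinkState (M : ℕ) : Type :=
  (Fin M × ℕ → Plane) × (Fin M × ℕ → Plane) × (Fin M × ℕ → Bool) × (Fin M × ℕ → Bool)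

/-- Fading is independent of everything else, so it may be integrated first with the link state
frozen. The displacement is almost surely nonzero, which makes the signal gain finite and positive.
-/
lemma measure_linkCovered (hD : IsD2DNetwork μ lamD pt pf δ X G T F h) (hδ : 0 < δ) {PD α β : ℝ}
    (hPD : 0 < PD) (hβ : 0 < β) (s : ℝ) {W : Set Plane} (hW : MeasurableSet W)
    (hXm : ∀ k, Measurable (X k)) (l : Fin M × ℕ) :
    μ {ω | transmits T F l ω ∧ receiver X G l ω ∈ W ∧
        ENNReal.ofReal β < d2dSINR X G T F h PD α s l ω}
      = ∫⁻ ω, linkCoverage W PD α s β l (fun k => X k ω) (fun k => G k ω) (fun k => T k ω)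
          (fun k => F k ω) ∂μ := by
  have hG := hD.displacement_measurable
  have hT := hD.time_measurable
  have hF := hD.freq_measurable
  have hh := hD.fading_measurable
  -- Coordinate maps on the space of (link state, fading): they express the event as a measurable
  -- set `S` of pairs, as Fubini requires.
  let X' : Fin M × ℕ → LinkState M × (Fin M × ℕ → Fin M × ℕ → ℝ) → Plane := fun k p => p.1.1 k
  let G' : Fin M × ℕ → LinkState M × (Fin M × ℕ → Fin M × ℕ → ℝ) → Plane := fun k p => p.1.2.1 k
  let T' : Fin M × ℕ → LinkState M × (Fin M × ℕ → Fin M × ℕ → ℝ) → Bool := fun k p => p.1.2.2.1 k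
  let F' : Fin M × ℕ → LinkState M × (Fin M × ℕ → Fin M × ℕ → ℝ) → Bool := fun k p => p.1.2.2.2 k
  let h' : Fin M × ℕ → Fin M × ℕ → LinkState M × (Fin M × ℕ → Fin M × ℕ → ℝ) → ℝ :=
    fun k l p => p.2 k l
  have hX' : ∀ k, Measurable (X' k) := fun k => by fun_prop
  have hG' : ∀ k, Measurable (G' k) := fun k => by fun_prop
  have hT' : ∀ k, Measurable (T' k) := fun k => by fun_prop
  have hF' : ∀ k, Measurable (F' k) := fun k => by fun_prop
  have hh' : ∀ k l, Measurable (h' k l) := fun k l => by fun_prop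
  let S : Set (LinkState M × (Fin M × ℕ → Fin M × ℕ → ℝ)) :=
    {p | transmits T' F' l p ∧ receiver X' G' l p ∈ W ∧
    ENNReal.ofReal β < d2dSINR X' G' T' F' h' PD α s l p}
  have hS : MeasurableSet S := by
    refine (measurableSet_transmits hT' hF' l).inter (MeasurableSet.inter ?_ ?_)
    · exact ((hX' l).add (hG' l)) hW
    · exact measurableSet_lt measurable_const (measurable_d2dSINR hX' hG' hT' hF' hh' PD α s l)
  let U : Ω → LinkState M := fun ω =>
    ((fun k => X k ω), (fun k => G k ω), (fun k => T k ω), (fun k => F k ω))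
  let V : Ω → Fin M × ℕ → Fin M × ℕ → ℝ := fun ω k l => h k l ω
  have hU : Measurable U := by fun_prop
  have hV : Measurable V := by fun_prop
  have h1 := lintegral_indepFun hU hV hD.indep_fading
    (φ := S.indicator fun _ => 1) (measurable_const.indicator hS)
  have h2 : μ {ω | transmits T F l ω ∧ receiver X G l ω ∈ W ∧
        ENNReal.ofReal β < d2dSINR X G T F h PD α s l ω}
      = ∫⁻ ω, S.indicator (fun _ => 1) (U ω, V ω) ∂μ := by
    rw [show {ω | transmits T F l ω ∧ receiver X G l ω ∈ W ∧
        ENNReal.ofReal β < d2dSINR X G T F h PD α s l ω} = (fun ω => (U ω, V ω)) ⁻¹' S from rfl,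
      ← lintegral_indicator_one (hU.prodMk hV hS)]
    rfl
  rw [h2, h1]
  have hGne : ∀ᵐ ω ∂μ, G l ω ≠ 0 :=
    ae_of_ae_map (hG l).aemeasurable (p := fun g => g ≠ 0)
      ((hD.displacement_law l).map_eq ▸ ae_ne_zero_planarGaussian hδ)
  refine lintegral_congr_ae ?_
  filter_upwards [hGne] with ω hω
  have h3 : ∫⁻ ω', S.indicator (fun _ => 1) (U ω, V ω') ∂μ = μ {ω' | (U ω, V ω') ∈ S} := by
    have hS3 : MeasurableSet {ω' | (U ω, V ω') ∈ S} := (measurable_const.prodMk hV) hS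
    rw [← lintegral_indicator_one hS3]
    rfl
  rw [h3]
  have hg0 : ‖G l ω‖ₑ ≠ 0 := by simpa using hω
  have hgt : ‖G l ω‖ₑ ≠ ∞ := enorm_ne_top
  have hdist : edist (X l ω) (X l ω + G l ω) = ‖G l ω‖ₑ := by
    rw [edist_eq_enorm_sub]; simp
  have hD0 : ‖G l ω‖ₑ ^ (-α) ≠ 0 := (ENNReal.rpow_pos (pos_iff_ne_zero.2 hg0) hgt).ne'
  have hDt : ‖G l ω‖ₑ ^ (-α) ≠ ∞ := ENNReal.rpow_ne_top_of_ne_zero hg0 hgt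
  unfold linkCoverage
  rw [infProd_eq_mul (fun k => ?_) l]
  swap
  · split_ifs
    all_goals first | exact le_rfl | exact ENNReal.inv_le_one.2 le_self_add | exact zero_le_one
  by_cases hTF : transmits T F l ω
  swap
  · have : {ω' | (U ω, V ω') ∈ S} = ∅ := by
      ext ω'
      simp only [Set.mem_ofPred_eq, Set.mem_empty_iff_false, iff_false]
      exact fun hc => hTF hc.1
    rw [this, measure_empty]
    have : ¬ (T l ω = true ∧ F l ω = true) := hTF
    by_cases hT1 : T l ω = true <;> by_cases hF1 : F l ω = true <;> simp_all
  by_cases hWl : X l ω + G l ω ∈ W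
  swap
  · have : {ω' | (U ω, V ω') ∈ S} = ∅ := by
      ext ω'
      simp only [Set.mem_ofPred_eq, Set.mem_empty_iff_false, iff_false]
      exact fun hc => hWl hc.2.1
    rw [this, measure_empty, Set.indicator_of_notMem hWl, zero_mul, zero_mul]
  -- Only the fading towards the receiver of `l` enters.
  have hind : iIndepFun (fun k => h k l) μ :=
    hD.fading_indep.precomp (g := fun k => (k, l)) fun a b hab => congrArg Prod.fst hab
  classical
  have h4 := measure_lt_sinr hind (fun k => hh k l) (fun k => hD.fading_law k l) (l := l)
    (y := fun k => if k ≠ l ∧ transmits T F k ω then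
      edist (X k ω) (X l ω + G l ω) ^ (-α) else 0) (by simp) hD0 hDt (S := ENNReal.ofReal s) hPD hβ
  have h5 : {ω' | (U ω, V ω') ∈ S} = {ω' | ENNReal.ofReal β < ENNReal.ofReal (PD * h l l ω') *
      ‖G l ω‖ₑ ^ (-α) / (∑' k, ENNReal.ofReal (PD * h k l ω') * (if k ≠ l ∧ transmits T F k ω then
      edist (X k ω) (X l ω + G l ω) ^ (-α) else 0) + ENNReal.ofReal s)} := by
    ext ω'
    have h6 : d2dSINR X' G' T' F' h' PD α s l (U ω, V ω') = ENNReal.ofReal (PD * h l l ω') *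
      ‖G l ω‖ₑ ^ (-α) / (∑' k, ENNReal.ofReal (PD * h k l ω') * (if k ≠ l ∧ transmits T F k ω then
      edist (X k ω) (X l ω + G l ω) ^ (-α) else 0) + ENNReal.ofReal s) := by
      rw [← hdist]
      unfold d2dSINR d2dInterference
      congr 2
      refine tsum_congr fun k => ?_
      have hiff : transmits T' F' k (U ω, V ω') ↔ transmits T F k ω := Iff.rfl
      by_cases hk : k ≠ l ∧ transmits T F k ω
      · rw [if_pos hk, if_pos (by rwa [hiff])]
        rfl
      · rw [if_neg hk, if_neg (by rwa [hiff]), mul_zero]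
    simp only [Set.mem_ofPred_eq, S]
    rw [h6]
    exact ⟨fun hc => hc.2.2, fun hc => ⟨hTF, hWl, hc⟩⟩
  rw [h5, h4, Set.indicator_of_mem hWl, if_pos hTF.1, if_pos hTF.2, if_pos rfl, one_mul, one_mul]
  congr 2
  ext k
  by_cases hk : k = l
  · simp [hk]
  · rw [if_neg hk, if_neg hk, if_neg hk]
    by_cases hT1 : T k ω = true <;> by_cases hF1 : F k ω = true <;>
      simp [hk, hT1, hF1, transmits]

/-- The conditional probability that link `l` transmits, has its receiver in `W` and is covered,
given the positions `x` of all transmitters and its own displacement `g`. -/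
def linkAverage {ι : Type*} [DecidableEq ι] (W : Set Plane) (PD α s β : ℝ) (q : ι → ℝ≥0∞) (l : ι)
    (x : ι → Plane) (g : Plane) : ℝ≥0∞ :=
  W.indicator (fun _ => 1) (x l + g) *
    expNeg (ENNReal.ofReal β * ENNReal.ofReal s / (ENNReal.ofReal PD * ‖g‖ₑ ^ (-α))) *
    (q l * infProd fun k => if k = l then 1 else
      thinnedFactor α β (q k) (‖g‖ₑ ^ (-α)) (edist (x k) (x l + g)))

lemma measurable_linkAverage {ι : Type*} [DecidableEq ι] [Countable ι] {W : Set Plane}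
    (hW : MeasurableSet W) (PD α s β : ℝ) (q : ι → ℝ≥0∞) (l : ι) :
    Measurable fun p : Plane × (ι → Plane) => linkAverage W PD α s β q l p.2 p.1 := by
  unfold linkAverage
  refine Measurable.mul (Measurable.mul ?_ (by fun_prop))
    (Measurable.const_mul (measurable_infProd fun k => ?_) _)
  · exact (measurable_const.indicator hW).comp
      (((measurable_pi_apply l).comp measurable_snd).add measurable_fst)
  · split_ifs
    · exact measurable_const
    · fun_prop

/-- The probability that a link of type `i` transmits. -/
def transmitProb (pt pf : Fin M → ℝ) (i : Fin M) : ℝ≥0∞ :=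
  ENNReal.ofReal (pt i) * ENNReal.ofReal (pf i)

lemma transmitProb_le_one (hpt : ∀ i, pt i ∈ Set.Icc (0 : ℝ) 1)
    (hpf : ∀ i, pf i ∈ Set.Icc (0 : ℝ) 1) (i : Fin M) : transmitProb pt pf i ≤ 1 :=
  mul_le_one' (ENNReal.ofReal_le_one.2 (hpt i).2) (ENNReal.ofReal_le_one.2 (hpf i).2)

lemma mul_add_one_sub_mul {p : ℝ≥0∞} (hp : p ≤ 1) (e : ℝ≥0∞) : p * e + (1 - p) * e = e := by
  rw [← add_mul, add_tsub_cancel_of_le hp, one_mul]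

/-- Two successive independent thinnings act as one with the product probability. -/
lemma thinning_identity {p q a : ℝ≥0∞} (hp : p ≤ 1) (hq : q ≤ 1) :
    p * (q * a + (1 - q) * 1) + (1 - p) * 1 = p * q * a + (1 - p * q) := by
  have hpq : p * q ≤ 1 := mul_le_one' hp hq
  have hne : p * q ≠ ∞ := (hpq.trans_lt ENNReal.one_lt_top).ne
  have h1 : p * (1 - q) + (1 - p) = 1 - p * q := by
    refine (ENNReal.sub_eq_of_eq_add_rev hne ?_).symm
    calc (1 : ℝ≥0∞) = p * (q + (1 - q)) + (1 - p) := by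
          rw [add_tsub_cancel_of_le hq, mul_one, add_tsub_cancel_of_le hp]
      _ = _ := by ring
  rw [← h1]
  ring

omit [IsProbabilityMeasure μ] in
lemma IsD2DNetwork.measurable_points (hD : IsD2DNetwork μ lamD pt pf δ X G T F h)
    (k : Fin M × ℕ) : Measurable (X k) := (hD.points_ppp k.1).measurable k.2

/-- Subband access and then slot activity are averaged factor by factor. The own factor, 1 if `l`
transmits and 0 otherwise, averages to its transmission probability. -/
lemma lintegral_linkCoverage (hD : IsD2DNetwork μ lamD pt pf δ X G T F h)
    (hpt : ∀ i, pt i ∈ Set.Icc (0 : ℝ) 1) (hpf : ∀ i, pf i ∈ Set.Icc (0 : ℝ) 1)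
    (PD α s β : ℝ) {W : Set Plane} (hW : MeasurableSet W) (l : Fin M × ℕ) :
    ∫⁻ ω, linkCoverage W PD α s β l (fun k => X k ω) (fun k => G k ω) (fun k => T k ω)
        (fun k => F k ω) ∂μ
      = ∫⁻ ω, linkAverage W PD α s β (fun k => transmitProb pt pf k.1) l (fun k => X k ω)
        (G l ω) ∂μ := by
  have hX := hD.measurable_points
  have hG := hD.displacement_measurable
  have hT := hD.time_measurable
  have hF := hD.freq_measurable
  obtain ⟨c, hc⟩ : ∃ c : (Fin M × ℕ → Plane) → (Fin M × ℕ → Plane) → ℝ≥0∞, c = fun x d =>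
    W.indicator (fun _ => 1) (x l + d l) *
    expNeg (ENNReal.ofReal β * ENNReal.ofReal s / (ENNReal.ofReal PD * ‖d l‖ₑ ^ (-α))) := ⟨_, rfl⟩
  obtain ⟨A, hA⟩ : ∃ A : Fin M × ℕ → (Fin M × ℕ → Plane) → (Fin M × ℕ → Plane) → ℝ≥0∞,
    A = fun k x d => if k = l then 1 else
      (1 + ENNReal.ofReal β * edist (x k) (x l + d l) ^ (-α) / ‖d l‖ₑ ^ (-α))⁻¹ := ⟨_, rfl⟩
  obtain ⟨e, he⟩ : ∃ e : Fin M × ℕ → ℝ≥0∞, e = fun k => if k = l then 0 else 1 := ⟨_, rfl⟩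
  have hlink : ∀ x d t f, linkCoverage W PD α s β l x d t f = c x d * infProd fun k =>
      if f k = true then if t k = true then A k x d else e k else e k := by
    intro x d t f
    rw [hc, hA, he]
    rfl
  let pT : Fin M × ℕ → ℝ≥0∞ := fun k => ENNReal.ofReal (pt k.1)
  let pF : Fin M × ℕ → ℝ≥0∞ := fun k => ENNReal.ofReal (pf k.1)
  have hpT : ∀ k, pT k ≤ 1 := fun k => ENNReal.ofReal_le_one.2 (hpt k.1).2
  have hpF : ∀ k, pF k ≤ 1 := fun k => ENNReal.ofReal_le_one.2 (hpf k.1).2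
  have hA1 : ∀ k x d, A k x d ≤ 1 := fun k x d => by
    rw [hA]
    exact linkCoverage_le_one_aux _
  have he1 : ∀ k, e k ≤ 1 := fun k => by
    rw [he]
    dsimp only
    split_ifs
    exacts [zero_le_one, le_rfl]
  have hmix1 : ∀ k x d, pF k * A k x d + (1 - pF k) * e k ≤ 1 := fun k x d =>
    calc _ ≤ pF k * 1 + (1 - pF k) * 1 := by gcongr; exacts [hA1 k x d, he1 k]
      _ = 1 := mul_add_one_sub_mul (hpF k) 1
  have hcm : Measurable fun p : (Fin M × ℕ → Plane) × (Fin M × ℕ → Plane) => c p.1 p.2 := by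
    rw [hc]
    refine Measurable.mul ((measurable_const.indicator hW).comp ?_) (by fun_prop)
    fun_prop
  have hAm : ∀ k, Measurable fun p : (Fin M × ℕ → Plane) × (Fin M × ℕ → Plane) =>
      A k p.1 p.2 := by
    intro k
    rw [hA]
    dsimp only
    split_ifs
    · exact measurable_const
    · fun_prop
  -- averaging over the access to the subband
  have h1 := lintegral_indepFun
    (U := fun ω => ((fun k => X k ω), (fun k => G k ω), (fun k => T k ω)))
    (V := fun ω k => F k ω) (by fun_prop) (by fun_prop) hD.indep_freq
    (φ := fun p => linkCoverage W PD α s β l p.1.1 p.1.2.1 p.1.2.2 p.2)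
    (measurable_linkCoverage
      (X := fun k (p : ((Fin M × ℕ → Plane) × (Fin M × ℕ → Plane) × (Fin M × ℕ → Bool)) ×
        (Fin M × ℕ → Bool)) => p.1.1 k)
      (G := fun k p => p.1.2.1 k) (T := fun k p => p.1.2.2 k) (F := fun k p => p.2 k)
      (fun k => by fun_prop) (fun k => by fun_prop) (fun k => by fun_prop) (fun k => by fun_prop)
      hW PD α s β l)
  have h2 : ∀ x d t, ∫⁻ ω', linkCoverage W PD α s β l x d t (fun k => F k ω') ∂μ
      = c x d * infProd fun k => if t k = true then
        pF k * A k x d + (1 - pF k) * e k else e k := by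
    intro x d t
    have hle : ∀ k, (if t k = true then A k x d else e k) ≤ 1 := fun k => by
      split_ifs
      exacts [hA1 k x d, he1 k]
    have h3 := lintegral_infProd_bool hD.freq_indep hF (p := pF) (fun k => hD.freq_prob k) hle he1
    have hm : Measurable fun ω' => infProd fun k => if F k ω' = true then
        (if t k = true then A k x d else e k) else e k :=
      measurable_infProd fun k => Measurable.ite (hF k (measurableSet_singleton true))
        measurable_const measurable_const
    simp_rw [hlink]
    rw [lintegral_const_mul _ hm, h3]
    congr 2
    ext k
    split_ifs
    · rfl
    · exact mul_add_one_sub_mul (hpF k) _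
  rw [h1]
  simp_rw [h2]
  -- averaging over the activity in the time slot
  have hφ : Measurable fun p : ((Fin M × ℕ → Plane) × (Fin M × ℕ → Plane)) × (Fin M × ℕ → Bool) =>
      c p.1.1 p.1.2 * infProd fun k => if p.2 k = true then
        pF k * A k p.1.1 p.1.2 + (1 - pF k) * e k else e k := by
    refine (hcm.comp measurable_fst).mul (measurable_infProd fun k => Measurable.ite ?_ ?_
      measurable_const)
    · have hk : Measurable fun p : ((Fin M × ℕ → Plane) × (Fin M × ℕ → Plane)) ×
        (Fin M × ℕ → Bool) => p.2 k := by fun_prop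
      exact hk (measurableSet_singleton true)
    · exact ((((hAm k).comp measurable_fst).const_mul _).add_const _)
  have h4 := lintegral_indepFun
    (U := fun ω => ((fun k => X k ω), (fun k => G k ω)))
    (V := fun ω k => T k ω) (by fun_prop) (by fun_prop) hD.indep_time hφ
  have h6 : ∀ x d, ∫⁻ ω', c x d * infProd (fun k => if T k ω' = true then
        pF k * A k x d + (1 - pF k) * e k else e k) ∂μ
      = linkAverage W PD α s β (fun k => transmitProb pt pf k.1) l x (d l) := by
    intro x d
    have h5 := lintegral_infProd_bool hD.time_indep hT (p := pT) (fun k => hD.time_prob k)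
      (fun k => hmix1 k x d) he1
    have hm : Measurable fun ω' => infProd fun k => if T k ω' = true then
        pF k * A k x d + (1 - pF k) * e k else e k :=
      measurable_infProd fun k => Measurable.ite (hT k (measurableSet_singleton true))
        measurable_const measurable_const
    rw [lintegral_const_mul _ hm, h5, infProd_eq_mul (fun k => ?_) l]
    · rw [hc, hA, he, linkAverage]
      congr 1
      congr 1
      · simp [pT, pF, transmitProb]
      · congr 1
        ext k
        by_cases hk : k = l
        · simp [hk]
        · simp only [hk, if_false, thinnedFactor]
          exact thinning_identity (hpT k) (hpF k)
    · calc _ ≤ pT k * 1 + (1 - pT k) * 1 := by gcongr; exacts [hmix1 k x d, he1 k]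
        _ = 1 := mul_add_one_sub_mul (hpT k) 1
  exact h4.trans (lintegral_congr fun ω => h6 (fun k => X k ω) (fun k => G k ω))

/-- The expected number of covered links with a given displacement. -/
lemma tsum_lintegral_linkAverage (hD : IsD2DNetwork μ lamD pt pf δ X G T F h)
    (hlamD : ∀ i, 0 < lamD i)
    (hpt : ∀ i, pt i ∈ Set.Icc (0 : ℝ) 1) (hpf : ∀ i, pf i ∈ Set.Icc (0 : ℝ) 1)
    {PD α s β : ℝ} (hα : 2 < α) (hβ : 0 ≤ β) {W : Set Plane} (hW : MeasurableSet W)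
    (hWf : volume W ≠ ∞) {g : Plane} (hg : g ≠ 0) :
    ∑' l, ∫⁻ ω, linkAverage W PD α s β (fun k => transmitProb pt pf k.1) l (fun k => X k ω) g ∂μ
      = expNeg (ENNReal.ofReal β * ENNReal.ofReal s / (ENNReal.ofReal PD * ‖g‖ₑ ^ (-α))) *
        (ENNReal.ofReal (transmitDensity lamD pt pf) * volume W *
          expNeg (ENNReal.ofReal (transmitDensity lamD pt pf * (β ^ (2 / α) *
            (2 * Real.pi ^ 2 / α / Real.sin (2 * Real.pi / α))) * ‖g‖ ^ 2))) := by
  have hX := hD.measurable_points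
  have hα0 : 0 < α := by linarith
  have hsin : 0 < Real.sin (2 * Real.pi / α) := by
    refine Real.sin_pos_of_pos_of_lt_pi (by positivity) ?_
    rw [div_lt_iff₀ hα0, mul_comm 2]
    exact mul_lt_mul_of_pos_left hα Real.pi_pos
  set K : ℝ := β ^ (2 / α) * (2 * Real.pi ^ 2 / α / Real.sin (2 * Real.pi / α)) with hK
  have hK0 : 0 ≤ K := by positivity
  set q : Fin M → ℝ≥0∞ := transmitProb pt pf with hq
  have hq1 : ∀ i, q i ≤ 1 := transmitProb_le_one hpt hpf
  -- Types are kept as marks because the transmission probability depends on them.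
  set Λ : Measure (Fin M × Plane) :=
    Measure.sum fun i => (ENNReal.ofReal (lamD i) • (volume : Measure Plane)).map (Prod.mk i) with hΛ
  set Y : Fin M × ℕ → Ω → Fin M × Plane := fun k ω => (k.1, X k ω) with hY
  have hYm : ∀ k, Measurable (Y k) := fun k => measurable_const.prodMk (hX k)
  have hPGFL : HasPoissonPGFL μ Y Λ := HasPoissonPGFL.superposition hX
    (fun i => IsHomogeneousPPP.hasPoissonPGFL (hD.points_ppp i)) hD.points_indep
  have hg0 : ‖g‖ₑ ≠ 0 := by simpa using hg
  have hDg0 : ‖g‖ₑ ^ (-α) ≠ 0 := (ENNReal.rpow_pos (pos_iff_ne_zero.2 hg0) enorm_ne_top).ne'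
  -- the factors and their discretizations
  let v : Fin M × Plane → Fin M × Plane → ℝ≥0∞ := fun x y =>
    thinnedFactor α β (q y.1) (‖g‖ₑ ^ (-α)) (edist y.2 (x.2 + g))
  -- Adding the cell radius to the distance from the cell centre bounds the true distance from
  -- above. So these factors dominate `v`, and they never vanish.
  let w : ℕ → ℕ → Fin M × Plane → ℝ≥0∞ := fun n j y =>
    thinnedFactor α β (q y.1) (‖g‖ₑ ^ (-α))
      (edist y.2 (TopologicalSpace.denseSeq Plane j + g) + cellRadius n)
  have hle : ∀ n (x y : Fin M × Plane), edist y.2 (x.2 + g)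
      ≤ edist y.2 (TopologicalSpace.denseSeq Plane (cellIndex n x.2) + g) + cellRadius n := by
    intro n x y
    refine (edist_triangle _ (TopologicalSpace.denseSeq Plane (cellIndex n x.2) + g) _).trans ?_
    gcongr
    rw [edist_add_right, edist_comm]
    exact (edist_cellIndex_lt n x.2).le
  have hge : ∀ n (x y : Fin M × Plane),
      edist y.2 (TopologicalSpace.denseSeq Plane (cellIndex n x.2) + g) + cellRadius n
      ≤ edist y.2 (x.2 + g) + (cellRadius n + cellRadius n) := by
    intro n x y
    rw [← add_assoc]
    gcongr
    refine (edist_triangle _ (x.2 + g) _).trans ?_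
    gcongr
    rw [edist_add_right]
    exact (edist_cellIndex_lt n x.2).le
  have hintv : ∀ x, ∫⁻ y, (1 - v x y) ∂Λ
      = ENNReal.ofReal (transmitDensity lamD pt pf * K * ‖g‖ ^ 2) := by
    intro x
    have hvm : Measurable fun y => 1 - v x y := by
      refine measurable_const.sub (measurable_from_prod_countable_right fun i => ?_)
      dsimp only [v, w]
      fun_prop
    have hR : ‖g‖ₑ = ENNReal.ofReal ‖g‖ := (ofReal_norm g).symm
    rw [hΛ, lintegral_sum_measure, tsum_fintype, transmitDensity, Finset.sum_mul, Finset.sum_mul,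
      ENNReal.ofReal_sum_of_nonneg]
    · refine Finset.sum_congr rfl fun i _ => ?_
      rw [lintegral_map hvm measurable_prodMk_left, lintegral_smul_measure]
      simp only [v, hR]
      rw [lintegral_one_sub_thinnedFactor hα hβ (hq1 i) (norm_pos_iff.2 hg), smul_eq_mul, hq,
        transmitProb, ← ENNReal.ofReal_mul (hpt i).1,
        ← ENNReal.ofReal_mul (mul_nonneg (hpt i).1 (hpf i).1), ← ENNReal.ofReal_mul (hlamD i).le]
      congr 1
      rw [hK]
      ring
    · intro i _
      exact mul_nonneg (mul_nonneg (mul_nonneg (mul_nonneg (hpt i).1 (hpf i).1) (hlamD i).le) hK0)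
        (by positivity)
  have hWg : MeasurableSet ((fun z : Plane => z + g) ⁻¹' W) := (measurable_add_const g) hW
  have hAm : ∀ i, MeasurableSet ({i} ×ˢ ((fun z : Plane => z + g) ⁻¹' W) : Set (Fin M × Plane)) :=
    fun i => (measurableSet_singleton i).prod hWg
  have hΛA : ∀ i, Λ ({i} ×ˢ ((fun z : Plane => z + g) ⁻¹' W))
      = ENNReal.ofReal (lamD i) * volume W := by
    intro i
    rw [hΛ, Measure.sum_apply _ (hAm i), tsum_eq_single i]
    · rw [Measure.map_apply measurable_prodMk_left (hAm i),
        Set.mk_preimage_prod_right (Set.mem_singleton i),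
        Measure.smul_apply, smul_eq_mul, measure_preimage_add_right]
    · intro j hj
      rw [Measure.map_apply measurable_prodMk_left (hAm i),
        Set.mk_preimage_prod_right_eq_empty (by simpa using hj), measure_empty]
  -- A receiver in W means a transmitter in W - g, of the same area; by translation invariance the
  -- exponent does not depend on the location.
  have hmecke : ∀ i, ∑' l, ∫⁻ ω, (({i} ×ˢ ((fun z : Plane => z + g) ⁻¹' W)).indicator
      (fun _ => 1) (Y l ω) * infProd (fun k => if k = l then 1 else v (Y l ω) (Y k ω))) ∂μ
      = expNeg (ENNReal.ofReal (transmitDensity lamD pt pf * K * ‖g‖ ^ 2)) *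
        (ENNReal.ofReal (lamD i) * volume W) := by
    intro i
    rw [hPGFL.tsum_lintegral_infProd hYm (v := v) (c := fun n x => cellIndex n x.2)
      (fun n => (measurable_cellIndex n).comp measurable_snd) (w := w) ?_ ?_ ?_ ?_ ?_ ?_ (hAm i) ?_]
    · simp_rw [hintv]
      rw [setLIntegral_const, hΛA]
    · intro n j
      refine measurable_from_prod_countable_right fun i => ?_
      dsimp only [v, w]
      fun_prop
    · exact fun n j y => thinnedFactor_le_one (hq1 _) _
    · intro n x
      exact thinnedFactor_ne_zero hα0 (by simp [(cellRadius_pos n).ne']) hDg0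
    · exact fun n x y => thinnedFactor_mono hα0.le (hle n x y)
    · intro x y
      refine tendsto_thinnedFactor hDg0 (hq1 _) ?_
      refine tendsto_of_tendsto_of_tendsto_of_le_of_le tendsto_const_nhds ?_
        (fun n => hle n x y) (fun n => hge n x y)
      have := (tendsto_const_nhds (x := edist y.2 (x.2 + g))).add
        (tendsto_cellRadius.add tendsto_cellRadius)
      simpa using this
    · intro x
      rw [hintv]
      exact ENNReal.ofReal_ne_top
    · rw [hΛA]
      exact ENNReal.mul_ne_top ENNReal.ofReal_ne_top hWf
  have hmm : ∀ i l, Measurable fun ω => (({i} ×ˢ ((fun z : Plane => z + g) ⁻¹' W)).indicator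
      (fun _ => (1 : ℝ≥0∞)) (Y l ω) * infProd (fun k => if k = l then 1 else v (Y l ω) (Y k ω))) := by
    intro i l
    refine ((measurable_const.indicator (hAm i)).comp (hYm l)).mul (measurable_infProd fun k => ?_)
    split_ifs
    · exact measurable_const
    · change Measurable fun ω => thinnedFactor α β (q k.1) (‖g‖ₑ ^ (-α))
        (edist (X k ω) (X l ω + g))
      fun_prop
  set E := expNeg (ENNReal.ofReal β * ENNReal.ofReal s / (ENNReal.ofReal PD * ‖g‖ₑ ^ (-α))) with hE
  have hdec : ∀ l ω, linkAverage W PD α s β (fun k => transmitProb pt pf k.1) l (fun k => X k ω) g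
      = ∑ i, E * q i * (({i} ×ˢ ((fun z : Plane => z + g) ⁻¹' W)).indicator
      (fun _ => 1) (Y l ω) * infProd (fun k => if k = l then 1 else v (Y l ω) (Y k ω))) := by
    intro l ω
    rw [Finset.sum_eq_single l.1]
    · unfold linkAverage
      by_cases hx : X l ω + g ∈ W
      · rw [Set.indicator_of_mem hx, Set.indicator_of_mem (by exact ⟨rfl, hx⟩), one_mul, one_mul,
          mul_assoc]
      · rw [Set.indicator_of_notMem hx, Set.indicator_of_notMem (fun hc => hx hc.2), zero_mul,
          zero_mul, zero_mul, mul_zero]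
    · intro i _ hi
      rw [Set.indicator_of_notMem (fun hc => hi hc.1.symm), zero_mul, mul_zero]
    · simp
  calc _ = ∑' l, ∑ i, E * q i * ∫⁻ ω, (({i} ×ˢ ((fun z : Plane => z + g) ⁻¹' W)).indicator
      (fun _ => 1) (Y l ω) * infProd (fun k => if k = l then 1 else v (Y l ω) (Y k ω))) ∂μ := by
        refine tsum_congr fun l => ?_
        rw [lintegral_congr (hdec l), lintegral_finsetSum _ fun i _ => (hmm i l).const_mul _]
        refine Finset.sum_congr rfl fun i _ => ?_
        rw [lintegral_const_mul _ (hmm i l)]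
    _ = ∑ i, E * q i * (expNeg (ENNReal.ofReal (transmitDensity lamD pt pf * K * ‖g‖ ^ 2)) *
        (ENNReal.ofReal (lamD i) * volume W)) := by
        rw [Summable.tsum_finsetSum fun _ _ => ENNReal.summable]
        refine Finset.sum_congr rfl fun i _ => ?_
        rw [ENNReal.tsum_mul_left, hmecke]
    _ = _ := by
        have hdens : ENNReal.ofReal (transmitDensity lamD pt pf)
            = ∑ i, q i * ENNReal.ofReal (lamD i) := by
          rw [transmitDensity, ENNReal.ofReal_sum_of_nonneg fun i _ =>
            mul_nonneg (mul_nonneg (hpt i).1 (hpf i).1) (hlamD i).le]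
          refine Finset.sum_congr rfl fun i _ => ?_
          rw [ENNReal.ofReal_mul (mul_nonneg (hpt i).1 (hpf i).1), ENNReal.ofReal_mul (hpt i).1]
          rfl
        rw [hdens, Finset.sum_mul, Finset.sum_mul, Finset.mul_sum]
        refine Finset.sum_congr rfl fun i _ => ?_
        ring

/-- The expected number of covered links, given the positions and activities of the links. -/
lemma tsum_lintegral_linkCoverage (hD : IsD2DNetwork μ lamD pt pf δ X G T F h)
    (hlamD : ∀ i, 0 < lamD i) (hδ : 0 < δ)
    (hpt : ∀ i, pt i ∈ Set.Icc (0 : ℝ) 1) (hpf : ∀ i, pf i ∈ Set.Icc (0 : ℝ) 1)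
    {PD α β : ℝ} (s : ℝ) (hα : 2 < α) (hβ : 0 ≤ β) {W : Set Plane} (hW : MeasurableSet W)
    (hWf : volume W ≠ ∞) :
    ∑' l, ∫⁻ ω, linkCoverage W PD α s β l (fun k => X k ω) (fun k => G k ω) (fun k => T k ω)
        (fun k => F k ω) ∂μ
      = ENNReal.ofReal (transmitDensity lamD pt pf) * volume W *
        ∫⁻ g, expNeg (ENNReal.ofReal β * ENNReal.ofReal s / (ENNReal.ofReal PD * ‖g‖ₑ ^ (-α))) *
          expNeg (ENNReal.ofReal (transmitDensity lamD pt pf * (β ^ (2 / α) *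
            (2 * Real.pi ^ 2 / α / Real.sin (2 * Real.pi / α))) * ‖g‖ ^ 2)) ∂(planarGaussian δ) := by
  have hX := hD.measurable_points
  have hG := hD.displacement_measurable
  have hm := fun l => measurable_linkAverage (ι := Fin M × ℕ) hW PD α s β
    (fun k => transmitProb pt pf k.1) l
  have hXm : Measurable fun ω k => X k ω := by fun_prop
  have hm' : ∀ l, Measurable fun p : Plane × Ω =>
      linkAverage W PD α s β (fun k => transmitProb pt pf k.1) l (fun k => X k p.2) p.1 := fun l =>
    (hm l).comp (measurable_fst.prodMk (hXm.comp measurable_snd))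
  have h1 : ∀ l, ∫⁻ ω, linkCoverage W PD α s β l (fun k => X k ω) (fun k => G k ω)
        (fun k => T k ω) (fun k => F k ω) ∂μ
      = ∫⁻ g, ∫⁻ ω, linkAverage W PD α s β (fun k => transmitProb pt pf k.1) l
        (fun k => X k ω) g ∂μ ∂(planarGaussian δ) := by
    intro l
    rw [lintegral_linkCoverage hD hpt hpf PD α s β hW l]
    have hind : IndepFun (G l) (fun ω k => X k ω) μ :=
      hD.indep_points_displacement.symm.comp (measurable_pi_apply l) measurable_id
    refine (lintegral_indepFun (hG l) hXm hind (hm l)).trans ?_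
    rw [← (hD.displacement_law l).map_eq, lintegral_map (hm' l).lintegral_prod_right' (hG l)]
  simp_rw [h1]
  rw [← lintegral_tsum fun l => (hm' l).lintegral_prod_right'.aemeasurable,
    ← lintegral_const_mul _ (by fun_prop)]
  refine lintegral_congr_ae ?_
  filter_upwards [ae_ne_zero_planarGaussian hδ] with g hg
  rw [tsum_lintegral_linkAverage hD hlamD hpt hpf hα hβ hW hWf hg]
  ring

/-- Numerator and denominator of the Palm ratio share the factor λ̃ |W|, which is positive and
finite; hence the result is the same for every window. -/
lemma d2dCoverage_eq (hD : IsD2DNetwork μ lamD pt pf δ X G T F h) (hlamD : ∀ i, 0 < lamD i)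
    (hδ : 0 < δ) (hpt : ∀ i, pt i ∈ Set.Icc (0 : ℝ) 1) (hpf : ∀ i, pf i ∈ Set.Icc (0 : ℝ) 1)
    (hdens : 0 < transmitDensity lamD pt pf) {PD α β : ℝ} (hPD : 0 < PD) (hα : 2 < α) (hβ : 0 < β)
    (s : ℝ) {W : Set Plane} (hW : MeasurableSet W) (hW0 : volume W ≠ 0) (hWf : volume W ≠ ∞) :
    d2dCoverage X G T F h μ PD α s β W = (∫⁻ g,
      expNeg (ENNReal.ofReal β * ENNReal.ofReal s / (ENNReal.ofReal PD * ‖g‖ₑ ^ (-α))) *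
      expNeg (ENNReal.ofReal (transmitDensity lamD pt pf * (β ^ (2 / α) *
            (2 * Real.pi ^ 2 / α / Real.sin (2 * Real.pi / α))) * ‖g‖ ^ 2))
        ∂(planarGaussian δ)).toReal := by
  have hX := hD.measurable_points
  have hG := hD.displacement_measurable
  have hT := hD.time_measurable
  have hF := hD.freq_measurable
  have hrec : ∀ l, MeasurableSet {ω | receiver X G l ω ∈ W} := fun l => ((hX l).add (hG l)) hW
  have hS1 : ∀ l, MeasurableSet {ω | transmits T F l ω ∧ receiver X G l ω ∈ W ∧
      ENNReal.ofReal β < d2dSINR X G T F h PD α s l ω} := fun l =>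
    (measurableSet_transmits hT hF l).inter ((hrec l).inter
      (measurableSet_lt measurable_const
        (measurable_d2dSINR hX hG hT hF hD.fading_measurable PD α s l)))
  have hS0 : ∀ l, MeasurableSet {ω | transmits T F l ω ∧ receiver X G l ω ∈ W} := fun l =>
    (measurableSet_transmits hT hF l).inter (hrec l)
  have hnum := tsum_lintegral_linkCoverage hD hlamD hδ hpt hpf (PD := PD) s hα hβ.le hW hWf
  have hden := tsum_lintegral_linkCoverage hD hlamD hδ hpt hpf (PD := PD) 0 hα le_rfl hW hWf
  simp_rw [← measure_linkCovered hD hδ hPD hβ s hW hX] at hnum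
  have hmeas0 : ∀ l, ∫⁻ ω, linkCoverage W PD α 0 0 l (fun k => X k ω) (fun k => G k ω)
      (fun k => T k ω) (fun k => F k ω) ∂μ = μ {ω | transmits T F l ω ∧ receiver X G l ω ∈ W} := by
    intro l
    rw [← lintegral_indicator_one (hS0 l)]
    refine lintegral_congr fun ω => ?_
    rw [linkCoverage_zero]
    classical
    rw [Set.indicator_apply]
    simp only [Set.mem_ofPred_eq, transmits, receiver, and_assoc, Pi.one_apply]
  simp_rw [hmeas0] at hden
  have hone : ∀ g : Plane, expNeg (ENNReal.ofReal 0 * ENNReal.ofReal 0 / (ENNReal.ofReal PD *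
      ‖g‖ₑ ^ (-α))) * expNeg (ENNReal.ofReal (transmitDensity lamD pt pf * ((0 : ℝ) ^ (2 / α) *
      (2 * Real.pi ^ 2 / α / Real.sin (2 * Real.pi / α))) * ‖g‖ ^ 2)) = 1 := by
    intro g
    have : (2 : ℝ) / α ≠ 0 := by positivity
    simp [Real.zero_rpow this]
  simp_rw [hone] at hden
  rw [lintegral_one, measure_univ, mul_one] at hden
  unfold d2dCoverage
  rw [lintegral_tsum fun l => (measurable_const.indicator (hS1 l)).aemeasurable,
    lintegral_tsum fun l => (measurable_const.indicator (hS0 l)).aemeasurable]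
  simp_rw [lintegral_indicator_const (hS1 _), lintegral_indicator_const (hS0 _), one_mul]
  have hc0 : ENNReal.ofReal (transmitDensity lamD pt pf) * volume W ≠ 0 :=
    mul_ne_zero (by simpa using hdens) hW0
  have hct : ENNReal.ofReal (transmitDensity lamD pt pf) * volume W ≠ ∞ :=
    ENNReal.mul_ne_top ENNReal.ofReal_ne_top hWf
  rw [hnum, hden, mul_comm (_ * volume W), ENNReal.mul_div_cancel_right hc0 hct]

theorem d2dCoverage_tendsto (hD : IsD2DNetwork μ lamD pt pf δ X G T F h)
    (hlamD : ∀ i, 0 < lamD i)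
    (hδ : 0 < δ) (hpt : ∀ i, pt i ∈ Set.Icc (0 : ℝ) 1) (hpf : ∀ i, pf i ∈ Set.Icc (0 : ℝ) 1)
    (hdens : 0 < transmitDensity lamD pt pf) {PD α β : ℝ} (hPD : 0 < PD) (hα : 2 < α) (hβ : 0 < β)
    {W : Set Plane} (hW : MeasurableSet W) (hW0 : volume W ≠ 0) (hWf : volume W ≠ ∞) :
    Tendsto (fun s : ℝ => d2dCoverage X G T F h μ PD α s β W) (𝓝[>] 0)
        (𝓝 (d2dCoverage X G T F h μ PD α 0 β W)) := by
  simp_rw [fun s => d2dCoverage_eq hD hlamD hδ hpt hpf hdens hPD hα hβ s hW hW0 hWf]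
  have hle : ∀ a b : ℝ≥0∞, expNeg a * expNeg b ≤ 1 := fun a b =>
    mul_le_one' (expNeg_le_one _) (expNeg_le_one _)
  refine (ENNReal.tendsto_toReal ?_).comp ?_
  · exact ((lintegral_mono fun g => hle _ _).trans_lt (by simp)).ne
  refine tendsto_lintegral_filter_of_dominated_convergence (fun _ => 1)
    (Eventually.of_forall fun s => by fun_prop)
    (Eventually.of_forall fun s => Eventually.of_forall fun g => hle _ _) (by simp) ?_
  filter_upwards [ae_ne_zero_planarGaussian hδ] with g hg
  have hg0 : ‖g‖ₑ ≠ 0 := by simpa using hg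
  refine ENNReal.Tendsto.mul_const ?_ (Or.inr (expNeg_ne_top _))
  refine (continuous_expNeg.tendsto _).comp ?_
  refine ENNReal.Tendsto.div_const (ENNReal.Tendsto.const_mul ?_ (Or.inr ENNReal.ofReal_ne_top))
    (Or.inr ?_)
  · exact (ENNReal.continuous_ofReal.tendsto 0).mono_left nhdsWithin_le_nhds
  · exact mul_ne_zero (by simpa using hPD)
      (ENNReal.rpow_pos (pos_iff_ne_zero.2 hg0) enorm_ne_top).ne'

theorem d2dCoverage_zero (hD : IsD2DNetwork μ lamD pt pf δ X G T F h)
    (hlamD : ∀ i, 0 < lamD i)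
    (hδ : 0 < δ) (hpt : ∀ i, pt i ∈ Set.Icc (0 : ℝ) 1) (hpf : ∀ i, pf i ∈ Set.Icc (0 : ℝ) 1)
    (hdens : 0 < transmitDensity lamD pt pf) {PD α β : ℝ} (hPD : 0 < PD) (hα : 2 < α) (hβ : 0 < β)
    {W : Set Plane} (hW : MeasurableSet W) (hW0 : volume W ≠ 0) (hWf : volume W ≠ ∞) :
    d2dCoverage X G T F h μ PD α 0 β W =
      1 / (1 + 2 * δ ^ 2 * transmitDensity lamD pt pf *
        ((2 * Real.pi ^ 2 / α) / Real.sin (2 * Real.pi / α)) * β ^ (2 / α)) := by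
  have hα0 : 0 < α := by linarith
  have hsin : 0 < Real.sin (2 * Real.pi / α) := by
    refine Real.sin_pos_of_pos_of_lt_pi (by positivity) ?_
    rw [div_lt_iff₀ hα0, mul_comm 2]
    exact mul_lt_mul_of_pos_left hα Real.pi_pos
  rw [d2dCoverage_eq hD hlamD hδ hpt hpf hdens hPD hα hβ 0 hW hW0 hWf]
  simp only [ENNReal.ofReal_zero, mul_zero, ENNReal.zero_div, expNeg_zero, one_mul]
  rw [lintegral_expNeg_sq_planarGaussian hδ (by positivity), ENNReal.toReal_ofReal (by positivity)]
  congr 2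
  ring

end D2DCoverage

/-! ### Coverage of the cellular users -/

/-! ### The Campbell–Mecke formula over the whole space -/

section MeckeUniv

variable {Ω E ι : Type*} [MeasurableSpace Ω] [MeasurableSpace E] [Countable ι] [DecidableEq ι]
  {μ : Measure Ω} [IsProbabilityMeasure μ] {Y : ι → Ω → E} {Λ : Measure E} [SigmaFinite Λ]

/-- Both sides are total masses of measures that agree on an exhausting sequence of sets of finite
intensity. -/
theorem HasPoissonPGFL.tsum_lintegral_infProd_univ (hY : HasPoissonPGFL μ Y Λ)
    (hYm : ∀ k, Measurable (Y k)) {v : E → E → ℝ≥0∞} {c : ℕ → E → ℕ} (hc : ∀ n, Measurable (c n))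
    {w : ℕ → ℕ → E → ℝ≥0∞} (hw : ∀ n j, Measurable (w n j)) (hw1 : ∀ n j x, w n j x ≤ 1)
    (hw0 : ∀ n x, w n (c n x) x ≠ 0) (hvw : ∀ n x y, v x y ≤ w n (c n x) y)
    (hlim : ∀ x y, Tendsto (fun n => w n (c n x) y) atTop (𝓝 (v x y)))
    (hfin : ∀ x, ∫⁻ y, (1 - v x y) ∂Λ ≠ ∞) :
    ∑' l, ∫⁻ ω, infProd (fun k => if k = l then 1 else v (Y l ω) (Y k ω)) ∂μ
      = ∫⁻ x, expNeg (∫⁻ y, (1 - v x y) ∂Λ) ∂Λ := by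
  have hwm : ∀ n, Measurable fun z : E × E => w n (c n z.1) z.2 := fun n =>
    (measurable_from_prod_countable_right (f := fun z : ℕ × E => w n z.1 z.2) (hw n)).comp
      (((hc n).comp measurable_fst).prodMk measurable_snd)
  have hvm : Measurable fun z : E × E => v z.1 z.2 :=
    measurable_of_tendsto_metrizable hwm (tendsto_pi_nhds.2 fun z => hlim z.1 z.2)
  have hDm : ∀ l, Measurable fun ω => infProd (fun k => if k = l then 1 else v (Y l ω) (Y k ω)) := by
    refine fun l => measurable_infProd fun k => ?_
    split_ifs
    exacts [measurable_const, hvm.comp ((hYm l).prodMk (hYm k))]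
  let ν₁ : Measure E := Measure.sum fun l => (μ.withDensity fun ω =>
    infProd (fun k => if k = l then 1 else v (Y l ω) (Y k ω))).map (Y l)
  let ν₂ : Measure E := Λ.withDensity fun x => expNeg (∫⁻ y, (1 - v x y) ∂Λ)
  have h1 : ∀ A, MeasurableSet A → ν₁ A = ∑' l, ∫⁻ ω, A.indicator (fun _ => 1) (Y l ω) *
        infProd (fun k => if k = l then 1 else v (Y l ω) (Y k ω)) ∂μ := by
    intro A hA
    rw [Measure.sum_apply _ hA]
    refine tsum_congr fun l => ?_
    rw [Measure.map_apply (hYm l) hA, withDensity_apply _ (hYm l hA),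
      ← lintegral_indicator (hYm l hA)]
    refine lintegral_congr fun ω => ?_
    by_cases hx : Y l ω ∈ A
    · rw [Set.indicator_of_mem (show ω ∈ Y l ⁻¹' A from hx), Set.indicator_of_mem hx, one_mul]
    · rw [Set.indicator_of_notMem (show ω ∉ Y l ⁻¹' A from hx), Set.indicator_of_notMem hx,
        zero_mul]
  have h2 : ∀ n, ν₁ (spanningSets Λ n) = ν₂ (spanningSets Λ n) := by
    intro n
    have hA := measurableSet_spanningSets Λ n
    rw [h1 _ hA, withDensity_apply _ hA]
    exact hY.tsum_lintegral_infProd hYm hc hw hw1 hw0 hvw hlim hfin hA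
      (measure_spanningSets_lt_top Λ n).ne
  have h3 : ν₁ Set.univ = ν₂ Set.univ := by
    rw [← iUnion_spanningSets Λ]
    refine tendsto_nhds_unique (tendsto_measure_iUnion_atTop (monotone_spanningSets Λ)) ?_
    exact (tendsto_measure_iUnion_atTop (monotone_spanningSets Λ)).congr fun n => (h2 n).symm
  rw [h1 _ MeasurableSet.univ, withDensity_apply _ MeasurableSet.univ, Measure.restrict_univ] at h3
  simpa using h3

end MeckeUniv

section CellularCoverage

/-- The success probability of the link from a base station at `x` to a user at `u` under the
interference of one base station at `y` that is active with probability `q`, with value zero if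
the latter is closer to the user. -/
def cellFactor (α β : ℝ) (q : ℝ≥0∞) (u : Plane) (r : ℝ≥0∞) (y : Plane) : ℝ≥0∞ :=
  if r ≤ edist y u then thinnedFactor α β q (r ^ (-α)) (edist y u) else 0

variable {α β : ℝ} {q : ℝ≥0∞} {u : Plane}

lemma thinnedFactor_top (hq : q ≤ 1) (r : ℝ≥0∞) : thinnedFactor α β q ∞ r = 1 := by
  unfold thinnedFactor
  rw [ENNReal.div_top, add_zero, inv_one, mul_one, add_tsub_cancel_of_le hq]

lemma cellFactor_le_one (hq : q ≤ 1) (r : ℝ≥0∞) (y : Plane) : cellFactor α β q u r y ≤ 1 := by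
  unfold cellFactor
  split_ifs
  exacts [thinnedFactor_le_one hq _, zero_le_one]

lemma measurable_cellFactor (α β : ℝ) (q : ℝ≥0∞) (u : Plane) (r : ℝ≥0∞) :
    Measurable (cellFactor α β q u r) := by
  unfold cellFactor
  exact Measurable.ite (measurableSet_le measurable_const (by fun_prop))
    (measurable_thinnedFactor measurable_const (by fun_prop)) measurable_const

/-- A closer server has a stronger signal and excludes fewer stations. Rounding the serving distance
down therefore approximates the factors from above. -/
lemma cellFactor_anti (hα : 0 ≤ α) {r r' : ℝ≥0∞} (h : r ≤ r') (y : Plane) :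
    cellFactor α β q u r' y ≤ cellFactor α β q u r y := by
  unfold cellFactor
  by_cases h' : r' ≤ edist y u
  · rw [if_pos h', if_pos (h.trans h')]
    unfold thinnedFactor
    have : r' ^ (-α) ≤ r ^ (-α) := by
      rw [ENNReal.rpow_neg, ENNReal.rpow_neg]
      exact ENNReal.inv_le_inv.2 (ENNReal.rpow_le_rpow h hα)
    gcongr
  · rw [if_neg h']
    exact zero_le

/-- The distance of a point from the user, rounded down to a multiple of `1 / n`. -/
def roundedDist (n j : ℕ) : ℝ≥0∞ := ENNReal.ofReal (j / n)

lemma roundedDist_le (n : ℕ) (x u : Plane) : roundedDist n ⌊n * dist x u⌋₊ ≤ edist x u := by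
  rw [roundedDist, edist_dist]
  refine ENNReal.ofReal_le_ofReal ?_
  rcases Nat.eq_zero_or_pos n with rfl | hn
  · simp
  · have hn' : (0 : ℝ) < n := by exact_mod_cast hn
    rw [div_le_iff₀ hn', mul_comm]
    exact Nat.floor_le (by positivity)

lemma tendsto_roundedDist (x u : Plane) :
    Tendsto (fun n => roundedDist n ⌊n * dist x u⌋₊) atTop (𝓝 (edist x u)) := by
  rw [edist_dist]
  refine (ENNReal.continuous_ofReal.tendsto _).comp ?_
  have := (tendsto_nat_floor_mul_div_atTop (R := ℝ) (a := dist x u) dist_nonneg).comp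
    tendsto_natCast_atTop_atTop
  refine this.congr fun n => ?_
  simp [mul_comm]

lemma cellFactor_roundedDist_ne_zero (hα : 0 < α) (hq : q ≤ 1) (n : ℕ) (x : Plane) :
    cellFactor α β q u (roundedDist n ⌊n * dist x u⌋₊) x ≠ 0 := by
  have hle := roundedDist_le n x u
  rw [cellFactor, if_pos hle]
  rcases eq_or_ne (edist x u) 0 with h0 | h0
  · rw [h0, nonpos_iff_eq_zero] at hle
    rw [hle, ENNReal.zero_rpow_of_neg (by linarith), thinnedFactor_top hq]
    exact one_ne_zero
  · refine thinnedFactor_ne_zero hα h0 ?_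
    rw [ENNReal.rpow_neg, Ne, ENNReal.inv_eq_zero, roundedDist]
    exact ENNReal.rpow_ne_top_of_nonneg hα.le ENNReal.ofReal_ne_top

/-- The jump of the factor is harmless: if y is at least as far as x, all rounded distances lie on
the same side of it; if y is strictly closer, they eventually exceed its distance. -/
lemma tendsto_cellFactor_roundedDist (hq : q ≤ 1) (x y : Plane) :
    Tendsto (fun n : ℕ => cellFactor α β q u (roundedDist n ⌊n * dist x u⌋₊) y) atTop
      (𝓝 (cellFactor α β q u (edist x u) y)) := by
  have hle := fun n => roundedDist_le n x u
  have hlim := tendsto_roundedDist x u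
  by_cases h : edist x u ≤ edist y u
  · have hn : ∀ n : ℕ, roundedDist n ⌊n * dist x u⌋₊ ≤ edist y u := fun n => (hle n).trans h
    simp only [cellFactor, if_pos h, hn, if_true]
    rcases eq_or_ne (edist x u) 0 with h0 | h0
    · have : ∀ n : ℕ, roundedDist n ⌊n * dist x u⌋₊ = 0 := fun n => by
        simpa [h0] using hle n
      simp only [this, h0]
      exact tendsto_const_nhds
    · unfold thinnedFactor
      refine Tendsto.add ?_ tendsto_const_nhds
      refine ENNReal.Tendsto.const_mul ?_ (Or.inr (hq.trans_lt ENNReal.one_lt_top).ne)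
      refine (continuous_inv.tendsto _).comp (Tendsto.add tendsto_const_nhds ?_)
      refine ENNReal.Tendsto.const_div ((ENNReal.continuous_rpow_const.tendsto _).comp hlim)
        (Or.inl ?_)
      exact ENNReal.rpow_ne_top_of_ne_zero h0 (edist_ne_top _ _)
  · have hev : ∀ᶠ n : ℕ in atTop, edist y u < roundedDist n ⌊n * dist x u⌋₊ :=
      hlim.eventually_const_lt (not_le.1 h)
    refine Tendsto.congr' ?_ tendsto_const_nhds
    filter_upwards [hev] with n hn
    rw [cellFactor, cellFactor, if_neg h, if_neg hn.not_ge]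

/-- Closer stations contribute 1 each, hence the disc area πr²; farther ones contribute 2πρ H₁ r².
-/
lemma lintegral_one_sub_cellFactor (hα : 2 < α) (hβ : 0 < β) {ρ : ℝ} (hρ : ρ ∈ Set.Icc (0 : ℝ) 1)
    (x : Plane) :
    ∫⁻ y : Plane, (1 - cellFactor α β (ENNReal.ofReal ρ) u (edist x u) y)
      = ENNReal.ofReal (Real.pi * (1 + 2 * ρ * H₁ β α) * dist x u ^ 2) := by
  have hα0 : 0 < α := by linarith
  have hq : ENNReal.ofReal ρ ≤ 1 := ENNReal.ofReal_le_one.2 hρ.2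
  have hH := H₁_nonneg (α := α) hβ
  rcases (dist_nonneg (x := x) (y := u)).eq_or_lt with h0 | hr
  · have h0' : edist x u = 0 := by rw [edist_dist, ← h0, ENNReal.ofReal_zero]
    simp [cellFactor, h0', ENNReal.zero_rpow_of_neg (show -α < 0 by linarith),
      thinnedFactor_top hq, ← h0]
  set r := dist x u with hrdef
  let f : ℝ → ℝ≥0∞ := fun t => 1 - (if ENNReal.ofReal r ≤ ENNReal.ofReal t then
    thinnedFactor α β (ENNReal.ofReal ρ) (ENNReal.ofReal r ^ (-α)) (ENNReal.ofReal t) else 0)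
  have hf : Measurable f := measurable_const.sub (Measurable.ite
    (measurableSet_le measurable_const (by fun_prop))
    (measurable_thinnedFactor measurable_const (by fun_prop)) measurable_const)
  have h1 : ∀ y, 1 - cellFactor α β (ENNReal.ofReal ρ) u (edist x u) y = f (dist y u) := by
    intro y
    simp only [f, cellFactor, edist_dist, hrdef]
  simp_rw [h1]
  rw [lintegral_fun_dist hf]
  have hsplit : Set.Ioi (0 : ℝ) = Set.Ioo 0 r ∪ Set.Ici r := (Set.Ioo_union_Ici_eq_Ioi hr).symm
  have hdisj : Disjoint (Set.Ioo (0 : ℝ) r) (Set.Ici r) :=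
    Set.disjoint_left.2 fun t ht ht' => absurd ht.2 (not_lt.2 ht')
  rw [hsplit, lintegral_union measurableSet_Ici hdisj]
  have h2 : ∫⁻ t in Set.Ioo 0 r, ENNReal.ofReal (2 * Real.pi * t) * f t
      = ENNReal.ofReal (Real.pi * r ^ 2) := by
    rw [← lintegral_radial_inside hr.le]
    refine setLIntegral_congr_fun measurableSet_Ioo fun t ht => ?_
    simp only [f]
    rw [if_neg (by rw [ENNReal.ofReal_le_ofReal_iff ht.1.le]; exact not_le.2 ht.2), tsub_zero,
      mul_one]
  have h3 : ∫⁻ t in Set.Ici r, ENNReal.ofReal (2 * Real.pi * t) * f t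
      = ENNReal.ofReal ρ * ENNReal.ofReal (2 * Real.pi * r ^ 2 * H₁ β α) := by
    rw [setLIntegral_congr Ioi_ae_eq_Ici.symm, ← lintegral_radial_outside hα hβ hr,
      ← lintegral_const_mul _ (by fun_prop)]
    refine setLIntegral_congr_fun measurableSet_Ioi fun t ht => ?_
    simp only [f]
    rw [if_pos (ENNReal.ofReal_le_ofReal (le_of_lt ht)), one_sub_thinnedFactor hq,
      one_sub_inv_one_add_ofReal hβ.le hr (hr.trans ht)]
    ring
  rw [h2, h3, ← ENNReal.ofReal_mul hρ.1, ← ENNReal.ofReal_add (by positivity)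
    (mul_nonneg hρ.1 (by positivity))]
  congr 1
  ring

/-- The base station `l` is nearest to `u` among the base stations at `z`. -/
def IsNearest (u : Plane) (z : ℕ → Plane) (l : ℕ) : Prop := ∀ m, dist (z l) u ≤ dist (z m) u

/-- The SINR of a user at `u` that is served by the base station `l`. -/
def stationSINR (PB α s : ℝ) (u : Plane) (l : ℕ) (z : ℕ → Plane) (b : ℕ → Bool) (c : ℕ → ℝ) :
    ℝ≥0∞ :=
  receivedPower PB α (c l) (z l) u /
    ((∑' k, if k ≠ l ∧ b k = true then receivedPower PB α (c k) (z k) u else 0) +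
      ENNReal.ofReal s)

/-- The conditional probability that the base station `l` is nearest to the user and covers it
without noise, given the positions `z` and activities `b` of all base stations. -/
def stationCoverage (α β : ℝ) (u : Plane) (l : ℕ) (z : ℕ → Plane) (b : ℕ → Bool) : ℝ≥0∞ :=
  infProd fun k =>
    if b k = true then
      if k = l then 1
      else if edist (z l) u ≤ edist (z k) u then
        (1 + ENNReal.ofReal β * edist (z k) u ^ (-α) / edist (z l) u ^ (-α))⁻¹
      else 0
    else if k = l then 1 else if edist (z l) u ≤ edist (z k) u then 1 else 0

lemma measurable_stationSINR (PB α s : ℝ) (u : Plane) (l : ℕ) :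
    Measurable fun p : ((ℕ → Plane) × (ℕ → Bool)) × (ℕ → ℝ) =>
      stationSINR PB α s u l p.1.1 p.1.2 p.2 := by
  unfold stationSINR receivedPower
  refine Measurable.div (by fun_prop) (Measurable.add (Measurable.tsum fun k => ?_)
    measurable_const)
  refine Measurable.ite ?_ (by fun_prop) measurable_const
  have hk : Measurable fun p : ((ℕ → Plane) × (ℕ → Bool)) × (ℕ → ℝ) => p.1.2 k := by fun_prop
  exact (MeasurableSet.const (k ≠ l)).inter (hk (measurableSet_singleton true))

lemma measurableSet_isNearest (u : Plane) (l : ℕ) :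
    MeasurableSet {z : ℕ → Plane | IsNearest u z l} := by
  have : {z : ℕ → Plane | IsNearest u z l} = ⋂ m, {z | dist (z l) u ≤ dist (z m) u} := by
    ext z
    simp [IsNearest]
  rw [this]
  exact MeasurableSet.iInter fun m => measurableSet_le (by fun_prop) (by fun_prop)

lemma measurable_stationCoverage (α β : ℝ) (u : Plane) (l : ℕ) :
    Measurable fun p : (ℕ → Plane) × (ℕ → Bool) => stationCoverage α β u l p.1 p.2 := by
  unfold stationCoverage
  refine measurable_infProd fun k => ?_
  have hk : Measurable fun p : (ℕ → Plane) × (ℕ → Bool) => p.2 k := by fun_prop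
  have hle : MeasurableSet {p : (ℕ → Plane) × (ℕ → Bool) | edist (p.1 l) u ≤ edist (p.1 k) u} :=
    measurableSet_le (by fun_prop) (by fun_prop)
  refine Measurable.ite (hk (measurableSet_singleton true)) ?_ ?_
  · split_ifs
    · exact measurable_const
    · exact Measurable.ite hle (by fun_prop) measurable_const
  · split_ifs
    · exact measurable_const
    · exact Measurable.ite hle measurable_const measurable_const

lemma stationCoverage_factor_le_one {α β : ℝ} {u : Plane} {l : ℕ} {z : ℕ → Plane} {b : ℕ → Bool}
    (k : ℕ) : (if b k = true then
      if k = l then 1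
      else if edist (z l) u ≤ edist (z k) u then
        (1 + ENNReal.ofReal β * edist (z k) u ^ (-α) / edist (z l) u ^ (-α))⁻¹
      else 0
    else if k = l then 1 else if edist (z l) u ≤ edist (z k) u then 1 else 0 : ℝ≥0∞) ≤ 1 := by
  split_ifs
  all_goals first | exact le_rfl | exact ENNReal.inv_le_one.2 le_self_add | exact zero_le_one

/-! ### The nearest base station and its coverage probability -/

variable {Ω : Type*} [MeasurableSpace Ω] {μ : Measure Ω} [IsProbabilityMeasure μ]
  {lamB ρ : ℝ} {Z : ℕ → Ω → Plane} {a : ℕ → Ω → Bool} {g : ℕ → Ω → ℝ}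

lemma IsHomogeneousPPP.ae_ne {lam : ℝ} (hZ : IsHomogeneousPPP μ Z lam) (u : Plane) (l : ℕ) :
    ∀ᵐ ω ∂μ, Z l ω ≠ u := by
  have h := hZ.hasPoissonPGFL.tsum_lintegral_indicator_one hZ.measurable
    (measurableSet_singleton u) (by simp)
  rw [Measure.smul_apply, measure_singleton, smul_zero, ENNReal.tsum_eq_zero] at h
  have h2 := h l
  have hm : Measurable fun ω => ({u} : Set Plane).indicator (fun _ => (1 : ℝ≥0∞)) (Z l ω) :=
    (measurable_const.indicator (measurableSet_singleton u)).comp (hZ.measurable l)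
  rw [lintegral_eq_zero_iff hm] at h2
  filter_upwards [h2] with ω hω heq
  simp [heq] at hω

/-- Every ball has finite mean count, hence almost surely finitely many points; minimize over a ball
large enough to contain `Z 0`. -/
lemma IsHomogeneousPPP.ae_exists_isNearest {lam : ℝ} (hZ : IsHomogeneousPPP μ Z lam) (u : Plane) :
    ∀ᵐ ω ∂μ, ∃ l, IsNearest u (fun k => Z k ω) l := by
  have hfin : ∀ n : ℕ, ∀ᵐ ω ∂μ, pointCount Z (Metric.ball u n) ω ≠ ∞ := by
    intro n
    have hΛ : (ENNReal.ofReal lam • (volume : Measure Plane)) (Metric.ball u n) ≠ ∞ :=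
      ENNReal.mul_ne_top ENNReal.ofReal_ne_top measure_ball_lt_top.ne
    have hball : MeasurableSet (Metric.ball u (n : ℝ)) := Metric.isOpen_ball.measurableSet
    have h := hZ.hasPoissonPGFL.tsum_lintegral_indicator_one hZ.measurable hball hΛ
    have hm : ∀ l, Measurable fun ω => (Metric.ball u (n : ℝ)).indicator (fun _ => (1 : ℝ≥0∞))
        (Z l ω) := fun l => (measurable_const.indicator hball).comp (hZ.measurable l)
    rw [← lintegral_tsum fun l => (hm l).aemeasurable] at h
    have h' : ∫⁻ ω, pointCount Z (Metric.ball u n) ω ∂μ ≠ ∞ := by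
      refine ne_of_eq_of_ne ?_ hΛ
      exact h
    filter_upwards [ae_lt_top (measurable_pointCount hZ.measurable hball) h'] with ω hω using hω.ne
  filter_upwards [ae_all_iff.2 hfin] with ω hω
  obtain ⟨n, hn⟩ := exists_nat_gt (dist (Z 0 ω) u)
  have hF : {k | Z k ω ∈ Metric.ball u n}.Finite := by
    refine (ENNReal.finite_const_le_of_tsum_ne_top (hω n) one_ne_zero).subset fun k hk => ?_
    simp only [Set.mem_ofPred_eq] at hk ⊢
    rw [Set.indicator_of_mem hk]
  obtain ⟨l, hl, hmin⟩ := Set.exists_min_image _ (fun k => dist (Z k ω) u) hF ⟨0, hn⟩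
  refine ⟨l, fun m => ?_⟩
  by_cases hm : Z m ω ∈ Metric.ball u n
  · exact hmin m hm
  · exact (le_of_lt hl).trans (not_lt.1 hm)

/-- By the Mecke formula this is the planar integral of λ exp(-λ π (1 + 2ρH₁) |x - u|²). -/
lemma tsum_lintegral_cellFactor (hZ : IsHomogeneousPPP μ Z lamB) (hlamB : 0 < lamB) {α β : ℝ}
    (hα : 2 < α) (hβ : 0 < β) (hρ : ρ ∈ Set.Icc (0 : ℝ) 1) (u : Plane) :
    ∑' l, ∫⁻ ω, infProd (fun k => if k = l then 1 else
        cellFactor α β (ENNReal.ofReal ρ) u (edist (Z l ω) u) (Z k ω)) ∂μ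
      = ENNReal.ofReal (1 / (2 * ρ * H₁ β α + 1)) := by
  have hα0 : 0 < α := by linarith
  have hq : ENNReal.ofReal ρ ≤ 1 := ENNReal.ofReal_le_one.2 hρ.2
  have hH := H₁_nonneg (α := α) hβ
  have hK : 0 < 1 + 2 * ρ * H₁ β α := by have := hρ.1; positivity
  have : SigmaFinite (ENNReal.ofReal lamB • (volume : Measure Plane)) :=
    SMul.sigmaFinite (μ := (volume : Measure Plane)) lamB.toNNReal
  have hint : ∀ x : Plane, ∫⁻ y, (1 - cellFactor α β (ENNReal.ofReal ρ) u (edist x u) y)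
      ∂(ENNReal.ofReal lamB • (volume : Measure Plane))
      = ENNReal.ofReal (lamB * (Real.pi * (1 + 2 * ρ * H₁ β α)) * dist x u ^ 2) := by
    intro x
    rw [lintegral_smul_measure, lintegral_one_sub_cellFactor hα hβ hρ, smul_eq_mul,
      ← ENNReal.ofReal_mul hlamB.le, mul_assoc lamB]
  rw [hZ.hasPoissonPGFL.tsum_lintegral_infProd_univ hZ.measurable
    (v := fun x y => cellFactor α β (ENNReal.ofReal ρ) u (edist x u) y)
    (c := fun n x => ⌊n * dist x u⌋₊) (fun n => Nat.measurable_floor.comp (by fun_prop))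
    (w := fun n j => cellFactor α β (ENNReal.ofReal ρ) u (roundedDist n j))
    (fun n j => measurable_cellFactor _ _ _ _ _) (fun n j => cellFactor_le_one hq _)
    (fun n x => cellFactor_roundedDist_ne_zero hα0 hq n x)
    (fun n x y => cellFactor_anti hα0.le (roundedDist_le n x u) y)
    (fun x y => tendsto_cellFactor_roundedDist hq x y)
    (fun x => by rw [hint]; exact ENNReal.ofReal_ne_top)]
  simp_rw [hint]
  rw [lintegral_smul_measure, lintegral_exp_neg_sq_dist (by positivity), smul_eq_mul,
    ← ENNReal.ofReal_mul hlamB.le]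
  congr 1
  rw [add_comm (2 * ρ * H₁ β α)]
  field_simp

lemma lintegral_stationCoverage (hC : IsCellularNetwork μ lamB ρ Z a g)
    (hρ : ρ ∈ Set.Icc (0 : ℝ) 1) (α β : ℝ) (u : Plane) (l : ℕ) :
    ∫⁻ ω, stationCoverage α β u l (fun k => Z k ω) (fun k => a k ω) ∂μ
      = ∫⁻ ω, infProd (fun k => if k = l then 1 else
        cellFactor α β (ENNReal.ofReal ρ) u (edist (Z l ω) u) (Z k ω)) ∂μ := by
  have hZ := hC.points_ppp.measurable
  have ha := hC.normal_measurable
  have hq : ENNReal.ofReal ρ ≤ 1 := ENNReal.ofReal_le_one.2 hρ.2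
  have h1 := lintegral_indepFun (U := fun ω k => Z k ω) (V := fun ω k => a k ω) (by fun_prop)
    (by fun_prop) hC.indep_points_normal (measurable_stationCoverage α β u l)
  have h2 : ∀ z : ℕ → Plane, ∫⁻ ω', stationCoverage α β u l z (fun k => a k ω') ∂μ
      = infProd fun k => if k = l then 1 else
        cellFactor α β (ENNReal.ofReal ρ) u (edist (z l) u) (z k) := by
    intro z
    refine (lintegral_infProd_bool hC.normal_indep ha (fun k => hC.normal_prob k)
      (fun k => ?_) fun k => ?_).trans ?_
    · split_ifs
      all_goals first | exact le_rfl | exact ENNReal.inv_le_one.2 le_self_add | exact zero_le_one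
    · split_ifs
      all_goals first | exact le_rfl | exact zero_le_one
    · congr 1
      ext k
      unfold cellFactor thinnedFactor
      split_ifs
      · exact mul_add_one_sub_mul hq 1
      · rw [mul_one]
      · simp
  exact h1.trans (lintegral_congr fun ω => h2 _)

/-- If `l` is nearest, this is the Rayleigh success probability; otherwise a closer station makes
the product vanish. -/
lemma measure_stationCovered_aux (hC : IsCellularNetwork μ lamB ρ Z a g) {PB α β : ℝ}
    (hPB : 0 < PB) (hβ : 0 < β) {u : Plane} {l : ℕ} {z : ℕ → Plane} (hz : z l ≠ u)
    (b : ℕ → Bool) :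
    μ {ω | IsNearest u z l ∧ ENNReal.ofReal β < stationSINR PB α 0 u l z b (fun k => g k ω)}
      = stationCoverage α β u l z b := by
  have hle : ∀ k, edist (z l) u ≤ edist (z k) u ↔ dist (z l) u ≤ dist (z k) u := fun k => by
    rw [edist_dist, edist_dist, ENNReal.ofReal_le_ofReal_iff dist_nonneg]
  by_cases hN : IsNearest u z l
  · have hr0 : edist (z l) u ≠ 0 := by simpa using hz
    have h4 := measure_lt_sinr hC.fading_indep hC.fading_measurable hC.fading_law (l := l)
      (y := fun k => if k ≠ l ∧ b k = true then edist (z k) u ^ (-α) else 0) (by simp)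
      (D := edist (z l) u ^ (-α)) (ENNReal.rpow_pos (pos_iff_ne_zero.2 hr0) (edist_ne_top _ _)).ne'
      (ENNReal.rpow_ne_top_of_ne_zero hr0 (edist_ne_top _ _)) (S := ENNReal.ofReal 0) hPB hβ
    rw [ENNReal.ofReal_zero, mul_zero, ENNReal.zero_div, expNeg_zero, one_mul] at h4
    refine Eq.trans ?_ (h4.trans ?_)
    · congr 1
      ext ω
      simp only [Set.mem_ofPred_eq, stationSINR, receivedPower, ENNReal.ofReal_zero, mul_ite,
        mul_zero]
      exact ⟨fun h => h.2, fun h => ⟨hN, h⟩⟩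
    · unfold stationCoverage
      congr 1
      ext k
      have hk := (hle k).2 (hN k)
      by_cases hkl : k = l
      · simp [hkl]
      · by_cases hb : b k = true <;> simp [hkl, hb, hk]
  · have hex : ∃ m, ¬ dist (z l) u ≤ dist (z m) u := not_forall.1 hN
    obtain ⟨m, hm⟩ := hex
    have hml : m ≠ l := fun h => hm (by rw [h])
    have h0 : {ω | IsNearest u z l ∧
        ENNReal.ofReal β < stationSINR PB α 0 u l z b (fun k => g k ω)} = ∅ := by
      ext ω
      simp [hN]
    rw [h0, measure_empty]
    unfold stationCoverage
    rw [infProd_eq_mul stationCoverage_factor_le_one m]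
    simp [hml, hle, hm]

lemma measurableSet_stationCovered (PB α s β : ℝ) (u : Plane) (l : ℕ) :
    MeasurableSet {p : ((ℕ → Plane) × (ℕ → Bool)) × (ℕ → ℝ) | IsNearest u p.1.1 l ∧
      ENNReal.ofReal β < stationSINR PB α s u l p.1.1 p.1.2 p.2} := by
  refine MeasurableSet.inter ?_
    (measurableSet_lt measurable_const (measurable_stationSINR PB α s u l))
  exact (measurable_fst.comp measurable_fst) (measurableSet_isNearest u l)

lemma measure_stationCovered (hC : IsCellularNetwork μ lamB ρ Z a g) {PB α β : ℝ}
    (hPB : 0 < PB) (hβ : 0 < β) (u : Plane) (l : ℕ) :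
    μ {ω | IsNearest u (fun k => Z k ω) l ∧ ENNReal.ofReal β <
        stationSINR PB α 0 u l (fun k => Z k ω) (fun k => a k ω) (fun k => g k ω)}
      = ∫⁻ ω, stationCoverage α β u l (fun k => Z k ω) (fun k => a k ω) ∂μ := by
  have hZ := hC.points_ppp.measurable
  have ha := hC.normal_measurable
  have hg := hC.fading_measurable
  have hS := measurableSet_stationCovered PB α 0 β u l
  let U : Ω → (ℕ → Plane) × (ℕ → Bool) := fun ω => ((fun k => Z k ω), (fun k => a k ω))
  let V : Ω → ℕ → ℝ := fun ω k => g k ω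
  have hU : Measurable U := by fun_prop
  have hV : Measurable V := by fun_prop
  have h1 := lintegral_indepFun hU hV hC.indep_fading
    (φ := Set.indicator _ fun _ => 1) (measurable_const.indicator hS)
  have h2 := lintegral_indicator_one (μ := μ) ((hU.prodMk hV) hS)
  refine h2.symm.trans (h1.trans (lintegral_congr_ae ?_))
  filter_upwards [hC.points_ppp.ae_ne u l] with ω hω
  rw [← measure_stationCovered_aux hC hPB hβ (α := α) (z := fun k => Z k ω) hω]
  exact lintegral_indicator_one (μ := μ) ((measurable_const.prodMk hV : Measurable
    fun ω' => (U ω, V ω')) hS)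

lemma ae_existsUnique_isNearest (hC : IsCellularNetwork μ lamB ρ Z a g) (hlamB : 0 < lamB)
    (u : Plane) : ∀ᵐ ω ∂μ, ∃! l, IsNearest u (fun k => Z k ω) l := by
  have hZm : Measurable fun ω k => Z k ω := measurable_pi_lambda _ hC.points_ppp.measurable
  have hN : ∀ l, MeasurableSet {ω | IsNearest u (fun k => Z k ω) l} := fun l =>
    hZm (measurableSet_isNearest u l)
  -- With ρ = 0 the factors only test for being nearest, so this says that the mean number of
  -- nearest stations is 1; α and β are arbitrary admissible values. As that number is almost surely
  -- at least 1, it equals 1.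
  have hsum := tsum_lintegral_cellFactor hC.points_ppp hlamB (α := 3) (β := 1) (ρ := 0)
    (by norm_num) one_pos ⟨le_rfl, zero_le_one⟩ u
  have hfac : ∀ l ω, infProd (fun k => if k = l then 1 else
      cellFactor 3 1 (ENNReal.ofReal 0) u (edist (Z l ω) u) (Z k ω))
      = {ω | IsNearest u (fun k => Z k ω) l}.indicator (fun _ => 1) ω := by
    intro l ω
    have hle : ∀ k, edist (Z l ω) u ≤ edist (Z k ω) u ↔ dist (Z l ω) u ≤ dist (Z k ω) u :=
      fun k => by rw [edist_dist, edist_dist, ENNReal.ofReal_le_ofReal_iff dist_nonneg]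
    have hcf : ∀ k, cellFactor 3 1 (ENNReal.ofReal 0) u (edist (Z l ω) u) (Z k ω)
        = if dist (Z l ω) u ≤ dist (Z k ω) u then 1 else 0 := by
      intro k
      simp [cellFactor, thinnedFactor, hle]
    simp_rw [hcf]
    by_cases h : IsNearest u (fun k => Z k ω) l
    · rw [Set.indicator_of_mem (by exact h)]
      have : ∀ k, (if k = l then 1 else if dist (Z l ω) u ≤ dist (Z k ω) u then 1 else 0)
          = (1 : ℝ≥0∞) := fun k => by rw [if_pos (h k), ite_self]
      simp_rw [this]
      simp [infProd]
    · rw [Set.indicator_of_notMem (by exact h)]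
      have hex : ∃ m, ¬ dist (Z l ω) u ≤ dist (Z m ω) u := not_forall.1 h
      obtain ⟨m, hm⟩ := hex
      have hml : m ≠ l := fun h => hm (by rw [h])
      rw [infProd_eq_mul (fun k => by split_ifs <;> simp) m, if_neg hml, if_neg hm, zero_mul]
  simp_rw [hfac] at hsum
  rw [← lintegral_tsum fun l => (measurable_const.indicator (hN l)).aemeasurable] at hsum
  have hge : ∀ᵐ ω ∂μ, 1 ≤ ∑' l, {ω | IsNearest u (fun k => Z k ω) l}.indicator
      (fun _ => (1 : ℝ≥0∞)) ω := by
    filter_upwards [hC.points_ppp.ae_exists_isNearest u] with ω ⟨l, hl⟩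
    refine le_trans ?_ (ENNReal.le_tsum l)
    rw [Set.indicator_of_mem (by exact hl)]
  have heq := ae_eq_of_ae_le_of_lintegral_le hge (by simp)
    (Measurable.tsum fun l => measurable_const.indicator (hN l)).aemeasurable
    (by rw [hsum]; simp)
  filter_upwards [hC.points_ppp.ae_exists_isNearest u, heq] with ω ⟨l, hl⟩ hω
  refine ⟨l, hl, fun m hm => ?_⟩
  by_contra hml
  have h2 := ENNReal.sum_le_tsum (f := fun l => {ω | IsNearest u (fun k => Z k ω) l}.indicator
      (fun _ => (1 : ℝ≥0∞)) ω) {m, l}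
  rw [← hω, Finset.sum_pair hml, Set.indicator_of_mem (by exact hm),
    Set.indicator_of_mem (by exact hl), one_add_one_eq_two] at h2
  exact absurd h2 (by norm_num)

omit [MeasurableSpace Ω] in
lemma servingBS_eq {u : Plane} {ω : Ω} (h : ∃! l, IsNearest u (fun k => Z k ω) l) {l : ℕ}
    (hl : IsNearest u (fun k => Z k ω) l) : servingBS Z u ω = l :=
  h.unique (Nat.sInf_mem (s := {n | ∀ m, dist (Z n ω) u ≤ dist (Z m ω) u}) ⟨l, hl⟩) hl

/-- Almost sure uniqueness of the nearest station makes the coverage event an almost disjoint union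
over the serving index. -/
lemma measure_cellularSINR (hC : IsCellularNetwork μ lamB ρ Z a g) (hlamB : 0 < lamB)
    (hρ : ρ ∈ Set.Icc (0 : ℝ) 1) {PB α β : ℝ} (hPB : 0 < PB) (hα : 2 < α) (hβ : 0 < β)
    (u : Plane) :
    μ {ω | ENNReal.ofReal β < cellularSINR Z a g PB α 0 u ω}
      = ENNReal.ofReal (1 / (2 * ρ * H₁ β α + 1)) := by
  have hZ := hC.points_ppp.measurable
  have ha := hC.normal_measurable
  have hg := hC.fading_measurable
  have huniq := ae_existsUnique_isNearest hC hlamB u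
  rw [← tsum_lintegral_cellFactor hC.points_ppp hlamB hα hβ hρ u]
  simp_rw [← lintegral_stationCoverage hC hρ α β u, ← measure_stationCovered hC hPB hβ u]
  rw [← measure_iUnion₀]
  · refine measure_congr (eventuallyEq_set.2 ?_)
    filter_upwards [huniq] with ω hω
    simp only [Set.mem_iUnion, Set.mem_ofPred_eq]
    constructor
    · intro h
      obtain ⟨l, hl, -⟩ := id hω
      refine ⟨l, hl, ?_⟩
      rw [← servingBS_eq hω hl]
      exact h
    · rintro ⟨l, hl, h⟩
      rw [← servingBS_eq hω hl] at h
      exact h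
  · intro l m hlm
    refine measure_eq_zero_iff_ae_notMem.2 ?_
    filter_upwards [huniq] with ω hω hmem
    exact hlm (hω.unique hmem.1.1 hmem.2.1)
  · intro l
    have hUV : Measurable fun ω => (((fun k => Z k ω), (fun k => a k ω)), (fun k => g k ω)) := by
      fun_prop
    exact (hUV (measurableSet_stationCovered PB α 0 β u l)).nullMeasurableSet

theorem cellularCoverage_zero (hC : IsCellularNetwork μ lamB ρ Z a g) (hlamB : 0 < lamB)
    (hρ : ρ ∈ Set.Icc (0 : ℝ) 1) {PB α β : ℝ} (hPB : 0 < PB) (hα : 2 < α) (hβ : 0 < β)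
    (u : Plane) : cellularCoverage Z a g μ PB α 0 β u = 1 / (2 * ρ * H₁ β α + 1) := by
  have hH := H₁_nonneg (α := α) hβ
  have := hρ.1
  rw [cellularCoverage, measure_cellularSINR hC hlamB hρ hPB hα hβ,
    ENNReal.toReal_ofReal (by positivity)]

/-! ### The limit of vanishing noise for cellular users -/

omit [MeasurableSpace Ω] in
lemma cellularSINR_anti {PB α : ℝ} {u : Plane} {s t : ℝ} (h : s ≤ t) (ω : Ω) :
    cellularSINR Z a g PB α t u ω ≤ cellularSINR Z a g PB α s u ω := by
  unfold cellularSINR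
  gcongr

lemma tendsto_div_add_ofReal (x y : ℝ≥0∞) :
    Tendsto (fun s : ℝ => x / (y + ENNReal.ofReal s)) (𝓝 0) (𝓝 (x / (y + ENNReal.ofReal 0))) := by
  rcases eq_or_ne x ∞ with rfl | hx
  · rcases eq_or_ne y ∞ with rfl | hy
    · simp
    · have : ∀ s : ℝ, ∞ / (y + ENNReal.ofReal s) = ∞ := fun s =>
        ENNReal.top_div_of_ne_top (ENNReal.add_ne_top.2 ⟨hy, ENNReal.ofReal_ne_top⟩)
      simp_rw [this]
      exact tendsto_const_nhds
  · exact ENNReal.Tendsto.const_div (tendsto_const_nhds.add (ENNReal.continuous_ofReal.tendsto 0))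
      (Or.inr hx)

/-- The coverage events increase as the noise decreases. Since the inequality is strict and the SINR
is continuous in the noise at 0, their union is the noiseless event. -/
theorem cellularCoverage_tendsto (Z : ℕ → Ω → Plane) (a : ℕ → Ω → Bool) (g : ℕ → Ω → ℝ)
    (PB α β : ℝ) (u : Plane) :
    Tendsto (fun s : ℝ => cellularCoverage Z a g μ PB α s β u) (𝓝[>] 0)
      (𝓝 (cellularCoverage Z a g μ PB α 0 β u)) := by
  set S : ℝ → Set Ω := fun s => {ω | ENNReal.ofReal β < cellularSINR Z a g PB α s u ω} with hS
  have hanti : Antitone S := fun s t h ω hω => lt_of_lt_of_le hω (cellularSINR_anti h ω)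
  have hseq : Tendsto (fun n : ℕ => 1 / ((n : ℝ) + 1)) atTop (𝓝 0) :=
    tendsto_one_div_add_atTop_nhds_zero_nat
  have hunion : ⋃ n : ℕ, S (1 / ((n : ℝ) + 1)) = S 0 := by
    refine Set.Subset.antisymm (Set.iUnion_subset fun n => hanti (by positivity)) fun ω hω => ?_
    have h : Tendsto (fun n : ℕ => cellularSINR Z a g PB α (1 / ((n : ℝ) + 1)) u ω) atTop
        (𝓝 (cellularSINR Z a g PB α 0 u ω)) := (tendsto_div_add_ofReal _ _).comp hseq
    obtain ⟨n, hn⟩ := (h.eventually_const_lt hω).exists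
    exact Set.mem_iUnion.2 ⟨n, hn⟩
  have hmono : Monotone fun n : ℕ => S (1 / ((n : ℝ) + 1)) := fun m n h =>
    hanti (by gcongr)
  have hlim := tendsto_measure_iUnion_atTop (μ := μ) hmono
  rw [hunion] at hlim
  refine (ENNReal.tendsto_toReal (measure_ne_top μ _)).comp
    (tendsto_order.2 ⟨fun b hb => ?_, fun b hb => ?_⟩)
  · obtain ⟨n, hn⟩ := (hlim.eventually_const_lt hb).exists
    filter_upwards [Ioo_mem_nhdsGT (show (0 : ℝ) < 1 / ((n : ℝ) + 1) by positivity)] with s hs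
    exact hn.trans_le (measure_mono (hanti hs.2.le))
  · filter_upwards [self_mem_nhdsWithin] with s hs
    exact (measure_mono (hanti (le_of_lt hs))).trans_lt hb

lemma normalRBFraction_mem_Icc {M : ℕ} {lamD pt bD : Fin M → ℝ} {lamU bC B θ : ℝ}
    (hlamD : ∀ i, 0 < lamD i) (hpt : ∀ i, pt i ∈ Set.Icc (0 : ℝ) 1) (hbD : ∀ i, 0 ≤ bD i)
    (hlamB : 0 < lamB) (hlamU : 0 ≤ lamU) (hbC : 0 ≤ bC) (hB : 0 < B)
    (hθ : θ ∈ Set.Ico (0 : ℝ) 1) :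
    normalRBFraction lamD pt bD lamB lamU bC B θ ∈ Set.Icc (0 : ℝ) 1 := by
  have h1 : 0 ≤ ∑ i, (1 - pt i) * bD i * lamD i := Finset.sum_nonneg fun i _ =>
    mul_nonneg (mul_nonneg (sub_nonneg.2 (hpt i).2) (hbD i)) (hlamD i).le
  have h2 : 0 ≤ 1 - θ := sub_nonneg.2 hθ.2.le
  exact ⟨le_min (by positivity) zero_le_one, min_le_right _ _⟩

end CellularCoverage

end D2D

end

theorem mainTheorem5 {Ω : Type*} [MeasurableSpace Ω] (μ : Measure Ω) [IsProbabilityMeasure μ]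
    {M : ℕ} (lamD pt pf bD : Fin M → ℝ) (lamB lamU bC B θ δ PD PB α β : ℝ)
    (hlamD : ∀ i, 0 < lamD i) (hpt : ∀ i, pt i ∈ Set.Icc (0 : ℝ) 1)
    (hpf : ∀ i, pf i ∈ Set.Icc (0 : ℝ) 1) (hbD : ∀ i, 0 ≤ bD i)
    (hlamB : 0 < lamB) (hlamU : 0 ≤ lamU) (hbC : 0 ≤ bC) (hB : 0 < B)
    (hθ : θ ∈ Set.Ico (0 : ℝ) 1) (hδ : 0 < δ) (hPD : 0 < PD) (hPB : 0 < PB)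
    (hα : 2 < α) (hβ : 0 < β)
    (X G : Fin M × ℕ → Ω → D2D.Plane) (T F : Fin M × ℕ → Ω → Bool)
    (h : Fin M × ℕ → Fin M × ℕ → Ω → ℝ)
    (hD : D2D.IsD2DNetwork μ lamD pt pf δ X G T F h)
    (Z : ℕ → Ω → D2D.Plane) (a : ℕ → Ω → Bool) (g : ℕ → Ω → ℝ)
    (hC : D2D.IsCellularNetwork μ lamB
      (D2D.normalRBFraction lamD pt bD lamB lamU bC B θ) Z a g) :
    (0 < D2D.transmitDensity lamD pt pf →
      ∀ W : Set D2D.Plane, MeasurableSet W → volume W ≠ 0 → volume W ≠ ∞ →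
        Tendsto (fun s : ℝ => D2D.d2dCoverage X G T F h μ PD α s β W) (𝓝[>] 0)
          (𝓝 (1 / (1 + 2 * δ ^ 2 * D2D.transmitDensity lamD pt pf *
            ((2 * Real.pi ^ 2 / α) / Real.sin (2 * Real.pi / α)) * β ^ (2 / α)))) ∧
        D2D.d2dCoverage X G T F h μ PD α 0 β W =
          1 / (1 + 2 * δ ^ 2 * D2D.transmitDensity lamD pt pf *
            ((2 * Real.pi ^ 2 / α) / Real.sin (2 * Real.pi / α)) * β ^ (2 / α))) ∧
    (∀ u : D2D.Plane,
      Tendsto (fun s : ℝ => D2D.cellularCoverage Z a g μ PB α s β u) (𝓝[>] 0)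
        (𝓝 (1 / (2 * D2D.normalRBFraction lamD pt bD lamB lamU bC B θ * D2D.H₁ β α + 1))) ∧
      D2D.cellularCoverage Z a g μ PB α 0 β u =
        1 / (2 * D2D.normalRBFraction lamD pt bD lamB lamU bC B θ * D2D.H₁ β α + 1)) := by
  refine ⟨fun hdens W hW hW0 hWf => ?_, fun u => ?_⟩
  · have h0 := D2D.d2dCoverage_zero hD hlamD hδ hpt hpf hdens hPD hα hβ hW hW0 hWf
    exact ⟨h0 ▸ D2D.d2dCoverage_tendsto hD hlamD hδ hpt hpf hdens hPD hα hβ hW hW0 hWf, h0⟩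
  · have h0 := D2D.cellularCoverage_zero hC hlamB
      (D2D.normalRBFraction_mem_Icc hlamD hpt hbD hlamB hlamU hbC hB hθ) hPB hα hβ u
    exact ⟨h0 ▸ D2D.cellularCoverage_tendsto Z a g PB α β u, h0⟩
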